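/- Let $T>0$, $\Omega_T=(0,1)\times(0,T)$. For $h:(0,T)\to\mathbb C$ let $$(W_{0,N}h)(x,t)=\sum_{k=1}^\infty 2i(k\pi)^3\int_0^t e^{i(k\pi)^4(t-\tau)}h(\tau)\,d\tau\,\sin(k\pi x),\qquad 0\le t\le T,$$ where for each $t$ the series is taken in $L^2(0,1)$. Sobolev spaces $H^{\sigma,p}(I)$, $\sigma\ge 0$, on an interval $I$ (with $H^\sigma=H^{\sigma,2}$) are the spaces of restrictions to $I$ of functions in the Bessel potential space $H^{\sigma,p}(\mathbb R)$, with the quotient norm, and for $\sigma>\frac12$ we put $H^\sigma_0(0,T)=\{h\in H^\sigma(0,T): h(0)=0\}$, where $h(0)$ is the value of the continuous representative. (1) There is a constant $C=C(T)$ such that for every $h\in H^{3/4}(0,T)$ the series converges in $L^2(0,1)$ for every $t\in[0,T]$, its sum $u=W_{0,N}h$ belongs to $L^4(\Omega_T)\cap C([0,T];L^2(0,1))$, and $$\|u\|_{L^4(\Omega_T)}\le C\|h\|_{H^{3/4}(0,T)},\qquad \sup_{0\le t\le T}\|u(\cdot,t)\|_{L^2(0,1)}\le C\|h\|_{H^{3/4}(0,T)}.$$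 (2) For every $s\in[0,4]$ there is a constant $C=C(s,T)$ such that for every $h\in H_0^{(3+s)/4}(0,T)$ and $u=W_{0,N}h$, the derivative $\partial_x^s u$ belongs to $L^4(\Omega_T)\cap C([0,T];L^2(0,1))$, and $$\|\partial_x^s u\|_{L^4(\Omega_T)}\le C\|h\|_{H^{(3+s)/4}(0,T)},\qquad \sup_{0\le t\le T}\|\partial_x^s u(\cdot,t)\|_{L^2(0,1)}\le C\|h\|_{H^{(3+s)/4}(0,T)}.$$ Here, with $m=\lfloor s\rfloor$ and $\sigma=s-m\in[0,1)$, this means: for every $t\in[0,T]$ the weak derivative $w(t)=\partial_x^m u(\cdot,t)$ on $(0,1)$ exists in $L^2(0,1)$, and $w\in L^4(0,T;H^{\sigma,4}(0,1))\cap C([0,T];H^{\sigma}(0,1))$, with both norms at most $C\|h\|_{H^{(3+s)/4}(0,T)}$. For integer $s$ one has $\sigma=0$, and this is the literal statement about the weak derivative $\partial_x^s u$. -/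

import Mathlib

open MeasureTheory Filter Topology Set
open scoped ENNReal NNReal ContDiff SchwartzMap

noncomputable section

instance factOneLeFour : Fact ((1 : ℝ≥0∞) ≤ 4) := ⟨by norm_num⟩

/-! ### Fractional Sobolev spaces on an interval -/

/-- `F = J^σ U` for some `U ∈ L^p(ℝ)` that extends `g` from `I` to the line, where
`J^σ` is the Bessel potential operator. For `σ ≥ 0`, this says that `g` is the restriction to `I`
of the element `J^{-σ} F` of `H^{σ,p}(ℝ)`. -/
def IsSobolevExtension (σ : ℝ) (p : ℝ≥0∞) [Fact (1 ≤ p)] (I : Set ℝ) (g : ℝ → ℂ)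
    (F : Lp ℂ p (volume : Measure ℝ)) : Prop :=
  ∃ U : Lp ℂ p (volume : Measure ℝ),
    TemperedDistribution.besselPotential ℝ ℂ σ (U : 𝓢'(ℝ, ℂ)) = (F : 𝓢'(ℝ, ℂ)) ∧
      U =ᵐ[volume.restrict I] g

/-- The norm of `g` in `H^{σ,p}(I)`, `σ ≥ 0`: the infimum of the `H^{σ,p}(ℝ)`-norms of the
extensions of `g` to the line (`∞` if there is none). -/
def sobolevNorm (σ : ℝ) (p : ℝ≥0∞) [Fact (1 ≤ p)] (I : Set ℝ) (g : ℝ → ℂ) : ℝ≥0∞ :=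
  ⨅ (F : Lp ℂ p (volume : Measure ℝ)) (_ : IsSobolevExtension σ p I g F), ‖F‖ₑ

/-- `h ∈ H^σ(0,T)`. -/
def MemH (σ T : ℝ) (h : ℝ → ℂ) : Prop :=
  sobolevNorm σ 2 (Ioo 0 T) h < ⊤

/-- `h ∈ H^σ(0,T)` with `h(0) = 0`; the value at `0` is that of the continuous representative. -/
def MemHZero (σ T : ℝ) (h : ℝ → ℂ) : Prop :=
  MemH σ T h ∧ ∃ g : ℝ → ℂ, ContinuousOn g (Icc 0 T) ∧ g =ᵐ[volume.restrict (Ioo 0 T)] h ∧ g 0 = 0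

/-! ### The boundary integral operator -/

/-- The complex Hilbert space `L²(0,1)`. -/
abbrev LTwo : Type := Lp ℂ 2 (volume.restrict (Ioo (0 : ℝ) 1))

theorem memLp_sine (k : ℕ) :
    MemLp (fun x : ℝ => (Real.sin (k * Real.pi * x) : ℂ)) 2 (volume.restrict (Ioo (0 : ℝ) 1)) := by
  refine MemLp.of_bound (C := 1) (Continuous.aestronglyMeasurable (by fun_prop)) ?_
  refine Eventually.of_forall fun x => ?_
  rw [Complex.norm_real]
  exact Real.abs_sin_le_one _

/-- `x ↦ sin(kπx)` in `L²(0,1)`. -/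
def sine (k : ℕ) : LTwo := (memLp_sine k).toLp _

/-- `2i(kπ)³ ∫₀ᵗ e^{i(kπ)⁴(t-τ)} h(τ) dτ`. -/
def navierCoeff (h : ℝ → ℂ) (k : ℕ) (t : ℝ) : ℂ :=
  2 * Complex.I * (k * Real.pi : ℂ) ^ 3 *
    ∫ τ in (0 : ℝ)..t, Complex.exp (Complex.I * (k * Real.pi : ℂ) ^ 4 * (t - τ)) * h τ

/-- The `(n+1)`-st term of the series of `W_{0,N} h` at time `t`, so that `k = n + 1` runs over
the positive integers. -/
def navierTerm (h : ℝ → ℂ) (t : ℝ) (n : ℕ) : LTwo :=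
  navierCoeff h (n + 1) t • sine (n + 1)

/-- `(W_{0,N} h)(·,t)`, the sum of the series in `L²(0,1)`. -/
def navierZero (h : ℝ → ℂ) (t : ℝ) : LTwo := ∑' n : ℕ, navierTerm h t n

/-! ### Derivatives of integer and fractional order in `x` -/

/-- `g` is the weak derivative of order `m` of `f` on the open set `I`. -/
def IsWeakDeriv (m : ℕ) (I : Set ℝ) (f g : ℝ → ℂ) : Prop :=
  LocallyIntegrableOn f I ∧ LocallyIntegrableOn g I ∧
    ∀ φ : ℝ → ℂ, ContDiff ℝ ∞ φ → HasCompactSupport φ → tsupport φ ⊆ I →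
      ∫ x in I, f x * iteratedDeriv m φ x = (-1) ^ m * ∫ x in I, g x * φ x

/-- `u`, as a function of `(x,t)`, belongs to `L⁴((0,1) × (0,T))` with norm at most `B`. -/
def LFourBound (T : ℝ) (u : ℝ → LTwo) (B : ℝ≥0∞) : Prop :=
  ∃ v : ℝ × ℝ → ℂ,
    MemLp v 4 (volume.restrict (Ioo 0 1 ×ˢ Ioo 0 T)) ∧
    eLpNorm v 4 (volume.restrict (Ioo 0 1 ×ˢ Ioo 0 T)) ≤ B ∧
    ∀ᵐ t ∂(volume.restrict (Ioo 0 T)),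
      (fun x => v (x, t)) =ᵐ[volume.restrict (Ioo 0 1)] u t

/-- `w` belongs to `L⁴(0,T; H^{σ,4}(0,1))` with norm at most `B`: there is a function `F` in
`L⁴(ℝ × (0,T))` of norm at most `B` such that for almost every `t` the function `w(t)` is the
restriction to `(0,1)` of `J^{-σ} F(·,t)`. For `σ = 0`, this is `L⁴((0,1) × (0,T))`. -/
def LFourSobolevBound (σ T : ℝ) (w : ℝ → LTwo) (B : ℝ≥0∞) : Prop :=
  ∃ F : ℝ × ℝ → ℂ,
    MemLp F 4 (volume.restrict (univ ×ˢ Ioo 0 T)) ∧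
    eLpNorm F 4 (volume.restrict (univ ×ˢ Ioo 0 T)) ≤ B ∧
    ∀ᵐ t ∂(volume.restrict (Ioo 0 T)),
      ∃ hF : MemLp (fun x => F (x, t)) 4 (volume : Measure ℝ),
        IsSobolevExtension σ 4 (Ioo 0 1) (w t) (hF.toLp _)

/-- `w ∈ C([0,T]; H^σ(0,1))` and its maximum norm is at most `B`. -/
def ContSobolevBound (σ T : ℝ) (w : ℝ → LTwo) (B : ℝ≥0∞) : Prop :=
  (∀ t ∈ Icc 0 T, sobolevNorm σ 2 (Ioo 0 1) (w t) < ⊤) ∧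
  (∀ t₀ ∈ Icc 0 T,
    Tendsto (fun t => sobolevNorm σ 2 (Ioo 0 1) (w t - w t₀ : LTwo)) (𝓝[Icc 0 T] t₀) (𝓝 0)) ∧
  ∀ t ∈ Icc 0 T, sobolevNorm σ 2 (Ioo 0 1) (w t) ≤ B

/-- `∂_x^s u` belongs to `L⁴((0,1) × (0,T)) ∩ C([0,T]; L²(0,1))`, with both norms at most `B`.
With `m = ⌊s⌋` and `σ = s - m ∈ [0,1)`, the weak derivative `w(t) = ∂_x^m u(t)` exists for all
`t ∈ [0,T]`, and its derivative of fractional order `σ` is measured by the Bessel potential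
spaces: `w ∈ L⁴(0,T; H^{σ,4}(0,1)) ∩ C([0,T]; H^σ(0,1))`. -/
def DerivBound (s T : ℝ) (u : ℝ → LTwo) (B : ℝ≥0∞) : Prop :=
  ∃ w : ℝ → LTwo,
    (∀ t ∈ Icc 0 T, IsWeakDeriv ⌊s⌋₊ (Ioo 0 1) (u t) (w t)) ∧
    LFourSobolevBound (s - ⌊s⌋₊) T w B ∧
    ContSobolevBound (s - ⌊s⌋₊) T w B

end

noncomputable section

/-! ### Trigonometric sums -/

/-! Extend `h` to the line with a comparable norm and let `f` be the Fourier transform of the Bessel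
potential of order `(3 + s)/4` of the extension. Then `h` is a.e. on `(0,T)` the absolutely
convergent Fourier integral `traceFun s f`, because the order exceeds `1/2`.

Integrating by parts in `τ` turns `(nπ)³ ∫ e^{i(nπ)⁴(t-τ)} h` into three terms: a Duhamel term with
`h'` divided by `nπ`, a term `osc n t * h(0) / (inπ)`, and `-h(t) / (inπ)`. No derivative of `h` is
taken: on the Fourier side the step is the identity `mul_oscInt`. The coefficients are odd in `n`,
so the sine series is a series over all integers of `e^{inπx}`. The part `-h(t)/(inπ)` sums to the
smooth lift `h(t)(x - 1)` by the sawtooth series (`hasSum_sawtooth`). What remains is `bdryCoeff`,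
and the `h(0)` term is harmless if `s = 0` or `h(0) = 0`.

After multiplication by `|n|^s` the Duhamel coefficient is split at the resonance `|2πξ - (nπ)⁴| <
|n|³`.

Near the resonance the weight is bounded (`near_weight_le`), and the frequency bands of different
`|n|` are disjoint, so the amplitudes are square summable with total `≲ ‖f‖²`. In the modulation
variable `η = 2πξ - (nπ)⁴` this part is a superposition of free evolutions weighted by `oscInt η t`,
which is `O((1 + η²)^{-1/2})`. Minkowski in `η`, the periodic `L⁴` Strichartz estimate for each `η`,
and Cauchy–Schwarz give the `L⁴` bound. The Strichartz estimate rests on arithmetic: `a + b = c + d`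
and `a⁴ + b⁴ = c⁴ + d⁴` have only trivial integer solutions.

Away from the resonance the coefficient is `O(|n|^{-4/5})` uniformly in `t` (`far_weight_le`). This
lies in `ℓ²` and in `ℓ^{4/3}`, and a Hausdorff–Young inequality at fixed time gives `L⁴`.

To reach Bessel potential norms on `(0,1)`, each mode is extended by a smooth cutoff. The Bessel
potential of a cut mode is, up to the decaying factor `1/(1 + 2πix)`, an integral over `ζ` of the
mode times a unimodular factor and a multiplier bounded by `besselSymbol σ (n/2) * symbolWeight ζ`.
Minkowski in `ζ` reduces norms on the line to norms of trigonometric sums over one period with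
arbitrary multipliers of modulus at most one (`exists_lintegral_besselSchwartz_sum_le`); this is why
the coefficient estimates carry a free sequence `b`. Bounds on finite sums give convergence of the
series, and closedness of the Bessel potential and of the weak derivative passes everything to the
limit. -/

/-- The character `e^{inπx}`. -/
def expo (n : ℤ) (x : ℝ) : ℂ := Complex.exp (Complex.I * (n * Real.pi * x : ℝ))

/-- The eigenvalue `(nπ)⁴`. -/
def quart (n : ℤ) : ℝ := (n * Real.pi) ^ 4

/-- The free evolution factor `e^{i(nπ)⁴t}`. -/
def osc (n : ℤ) (t : ℝ) : ℂ := Complex.exp (Complex.I * (quart n * t : ℝ))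

theorem norm_expo (n : ℤ) (x : ℝ) : ‖expo n x‖ = 1 := by
  rw [expo, mul_comm, Complex.norm_exp_ofReal_mul_I]

theorem norm_osc (n : ℤ) (t : ℝ) : ‖osc n t‖ = 1 := by
  rw [osc, mul_comm, Complex.norm_exp_ofReal_mul_I]

@[fun_prop]
theorem continuous_expo (n : ℤ) : Continuous (expo n) := by
  unfold expo; fun_prop

@[fun_prop]
theorem continuous_osc (n : ℤ) : Continuous (osc n) := by
  unfold osc; fun_prop

theorem integral_exp_period (w : ℝ) (hw : w ≠ 0) (N : ℕ) (j : ℤ) :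
    ∫ x in (0 : ℝ)..(N * (2 * Real.pi / w)), Complex.exp (Complex.I * (j * w * x : ℝ)) =
      if j = 0 then (N * (2 * Real.pi / w) : ℝ) else 0 := by
  split_ifs with h
  · simp [h]
  · have hc : Complex.I * (j * w : ℝ) ≠ 0 := by
      simp [h, hw]
    have : ∀ x : ℝ, Complex.I * (j * w * x : ℝ) = Complex.I * (j * w : ℝ) * x := by
      intro x; push_cast; ring
    simp_rw [this]
    rw [integral_exp_mul_complex hc]
    have h2 : Complex.I * (j * w : ℝ) * ((N * (2 * Real.pi / w) : ℝ) : ℂ) =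
        ((j * N : ℤ) : ℂ) * (2 * Real.pi * Complex.I) := by
      have : (w : ℂ) ≠ 0 := by exact_mod_cast hw
      push_cast
      field_simp
    rw [h2, Complex.exp_int_mul_two_pi_mul_I]
    simp

/-- Expansion of the fourth power of the modulus of a sum of four factors. -/
theorem integral_norm_sum_pow_four_le {Z : Type*} [MeasurableSpace Z] (μ : Measure Z)
    [IsFiniteMeasure μ] (ψ : ℤ → Z → ℂ) (hψ : ∀ n, AEStronglyMeasurable (ψ n) μ)
    (hb : ∀ n z, ‖ψ n z‖ ≤ 1) (S : Finset ℤ) (c : ℤ → ℂ) :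
    ∫⁻ z, ‖∑ n ∈ S, c n * ψ n z‖ₑ ^ 4 ∂μ ≤ ENNReal.ofReal
      (∑ p ∈ (S ×ˢ S) ×ˢ (S ×ˢ S), ‖c p.1.1‖ * ‖c p.1.2‖ * ‖c p.2.1‖ * ‖c p.2.2‖ *
        ‖∫ z, ψ p.1.1 z * ψ p.1.2 z * (starRingEnd ℂ (ψ p.2.1 z) * starRingEnd ℂ (ψ p.2.2 z)) ∂μ‖) := by
  set f : Z → ℂ := fun z => ∑ n ∈ S, c n * ψ n z with hf
  have hfm : AEStronglyMeasurable f μ := by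
    refine Finset.aestronglyMeasurable_fun_sum _ fun n _ => (hψ n).const_mul _
  have hfb : ∀ z, ‖f z‖ ≤ ∑ n ∈ S, ‖c n‖ := fun z => by
    refine (norm_sum_le _ _).trans (Finset.sum_le_sum fun n _ => ?_)
    rw [norm_mul]
    exact mul_le_of_le_one_right (norm_nonneg _) (hb n z)
  have hint : Integrable (fun z => ‖f z‖ ^ 4) μ := by
    refine Integrable.of_bound (hfm.norm.pow 4) ((∑ n ∈ S, ‖c n‖) ^ 4) (.of_forall fun z => ?_)
    rw [Real.norm_of_nonneg (by positivity)]
    exact pow_le_pow_left₀ (norm_nonneg _) (hfb z) 4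
  have e1 : ∫⁻ z, ‖f z‖ₑ ^ 4 ∂μ = ENNReal.ofReal (∫ z, ‖f z‖ ^ 4 ∂μ) := by
    rw [ofReal_integral_eq_lintegral_ofReal hint (.of_forall fun z => by positivity)]
    refine lintegral_congr fun z => ?_
    rw [ENNReal.ofReal_pow (norm_nonneg _), ofReal_norm]
  rw [e1]
  refine ENNReal.ofReal_le_ofReal ?_
  have hexp : ∀ z, ((‖f z‖ ^ 4 : ℝ) : ℂ) = ∑ p ∈ (S ×ˢ S) ×ˢ (S ×ˢ S),
      (c p.1.1 * c p.1.2 * (starRingEnd ℂ (c p.2.1) * starRingEnd ℂ (c p.2.2))) *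
      (ψ p.1.1 z * ψ p.1.2 z * (starRingEnd ℂ (ψ p.2.1 z) * starRingEnd ℂ (ψ p.2.2 z))) := by
    intro z
    have h1 : ((‖f z‖ ^ 4 : ℝ) : ℂ) = (f z * f z) * (starRingEnd ℂ (f z) * starRingEnd ℂ (f z)) := by
      have := Complex.mul_conj' (f z)
      push_cast
      linear_combination (-(f z * starRingEnd ℂ (f z)) - (‖f z‖ : ℂ) ^ 2) * this
    rw [h1, hf]
    simp only [map_sum, map_mul]
    rw [Finset.sum_mul_sum, Finset.sum_mul_sum, ← Finset.sum_product', ← Finset.sum_product',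
      Finset.sum_mul_sum, ← Finset.sum_product']
    refine Finset.sum_congr rfl fun p _ => ?_
    ring
  have hstar : ∀ n, AEStronglyMeasurable (fun z => starRingEnd ℂ (ψ n z)) μ := fun n =>
    Complex.continuous_conj.comp_aestronglyMeasurable (hψ n)
  have e2 : ((∫ z, ‖f z‖ ^ 4 ∂μ : ℝ) : ℂ) = ∑ p ∈ (S ×ˢ S) ×ˢ (S ×ˢ S),
      (c p.1.1 * c p.1.2 * (starRingEnd ℂ (c p.2.1) * starRingEnd ℂ (c p.2.2))) *
      ∫ z, (ψ p.1.1 z * ψ p.1.2 z * (starRingEnd ℂ (ψ p.2.1 z) * starRingEnd ℂ (ψ p.2.2 z))) ∂μ := by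
    rw [← integral_complex_ofReal]
    simp_rw [hexp]
    rw [integral_finsetSum]
    · simp_rw [integral_const_mul]
    · intro p _
      refine Integrable.const_mul (Integrable.of_bound (C := 1) ?_ (.of_forall fun z => ?_)) _
      · exact ((hψ _).mul (hψ _)).mul ((hstar _).mul (hstar _))
      · simp only [norm_mul, RCLike.norm_conj]
        have := hb p.1.1 z; have := hb p.1.2 z; have := hb p.2.1 z; have := hb p.2.2 z
        refine mul_le_one₀ (mul_le_one₀ ?_ ?_ ?_) ?_ (mul_le_one₀ ?_ ?_ ?_) <;>
          first | assumption | positivity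
  have e3 : ∫ z, ‖f z‖ ^ 4 ∂μ = ‖((∫ z, ‖f z‖ ^ 4 ∂μ : ℝ) : ℂ)‖ := by
    rw [Complex.norm_real, Real.norm_of_nonneg (integral_nonneg fun z => by positivity)]
  rw [e3, e2]
  refine (norm_sum_le _ _).trans (le_of_eq ?_)
  refine Finset.sum_congr rfl fun p _ => ?_
  simp only [norm_mul, RCLike.norm_conj]
  ring

/-- With `S = a + b` and `D = a - b` one has `8(a⁴ + b⁴) = S⁴ + 6S²D² + D⁴`. Equal sums therefore
leave a product whose second factor, a sum of squares, vanishes only if both differences do. -/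
theorem eq_or_eq_of_add_eq_of_pow_four {a b c d : ℤ} (h1 : a + b = c + d)
    (h4 : a ^ 4 + b ^ 4 = c ^ 4 + d ^ 4) : (a = c ∧ b = d) ∨ (a = d ∧ b = c) := by
  have key : ((a - b) ^ 2 - (c - d) ^ 2) * (6 * (a + b) ^ 2 + (a - b) ^ 2 + (c - d) ^ 2) = 0 := by
    have hd : d = a + b - c := by linarith
    subst hd
    linear_combination 8 * h4
  have h2 : (a - b) ^ 2 = (c - d) ^ 2 := by
    rcases mul_eq_zero.1 key with h | h
    · linarith
    · nlinarith [sq_nonneg (a + b), sq_nonneg (a - b), sq_nonneg (c - d)]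
  rcases sq_eq_sq_iff_eq_or_eq_neg.1 h2 with h | h
  · left; constructor <;> omega
  · right; constructor <;> omega

theorem expo_mul_four (a b c d : ℤ) (x : ℝ) :
    expo a x * expo b x * (starRingEnd ℂ (expo c x) * starRingEnd ℂ (expo d x)) =
      expo (a + b - c - d) x := by
  simp only [expo, ← Complex.exp_conj, ← Complex.exp_add, map_mul, Complex.conj_I,
    Complex.conj_ofReal]
  congr 1
  push_cast
  ring

theorem osc_mul_four (a b c d : ℤ) (t : ℝ) :
    osc a t * osc b t * (starRingEnd ℂ (osc c t) * starRingEnd ℂ (osc d t)) =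
      Complex.exp (Complex.I * (((a ^ 4 + b ^ 4 - c ^ 4 - d ^ 4 : ℤ) : ℝ) * Real.pi ^ 4 * t : ℝ)) := by
  simp only [osc, quart, ← Complex.exp_conj, ← Complex.exp_add, map_mul, Complex.conj_I,
    Complex.conj_ofReal]
  congr 1
  push_cast
  ring

theorem integral_expo (n : ℤ) :
    ∫ x in Ioc (0 : ℝ) 2, expo n x = if n = 0 then 2 else 0 := by
  have := integral_exp_period Real.pi Real.pi_ne_zero 1 n
  have hp : ((1 : ℕ) : ℝ) * (2 * Real.pi / Real.pi) = 2 := by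
    have := Real.pi_ne_zero
    field_simp; norm_num
  rw [hp, intervalIntegral.integral_of_le (by norm_num)] at this
  unfold expo
  rw [this]
  split_ifs <;> simp

theorem integral_osc (N : ℕ) (j : ℤ) :
    ∫ t in Ioc (0 : ℝ) (N * (2 * Real.pi / Real.pi ^ 4)),
      Complex.exp (Complex.I * (j * Real.pi ^ 4 * t : ℝ)) =
      if j = 0 then ((N * (2 * Real.pi / Real.pi ^ 4) : ℝ) : ℂ) else 0 := by
  have := integral_exp_period (Real.pi ^ 4) (by positivity) N j
  rw [intervalIntegral.integral_of_le (by positivity)] at this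
  rw [this]
  split_ifs <;> simp

/-- A Hausdorff–Young inequality: the `L⁴` norm of a trigonometric sum is controlled by the
`ℓ^{4/3}` norm of its coefficients. -/
theorem lintegral_expo_sum_le (S : Finset ℤ) (c : ℤ → ℂ) (w : ℤ → ℝ) (hw : ∀ n, 0 ≤ w n)
    (hc : ∀ n, ‖c n‖ ≤ w n ^ 3) :
    ∫⁻ x in Ioc (0 : ℝ) 2, ‖∑ n ∈ S, c n * expo n x‖ₑ ^ 4 ≤
      ENNReal.ofReal (2 * (∑ n ∈ S, w n ^ 4) ^ 3) := by
  refine (integral_norm_sum_pow_four_le _ expo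
    (fun n => (continuous_expo n).aestronglyMeasurable) (fun n z => (norm_expo n z).le) S c).trans ?_
  refine ENNReal.ofReal_le_ofReal ?_
  simp_rw [expo_mul_four, integral_expo]
  let P : ℤ → ℝ := fun n => w n ^ 4
  have hP : ∀ n, 0 ≤ P n := fun n => by positivity
  -- AM-GM applied to the four triple products. Each resulting term omits one index, which the
  -- linear constraint determines from the other three, so it sums to at most `(∑ P n) ^ 3`.
  have amgm : ∀ a b e d : ℝ, 0 ≤ a → 0 ≤ b → 0 ≤ e → 0 ≤ d →
      4 * (a ^ 3 * b ^ 3 * e ^ 3 * d ^ 3) ≤ a ^ 4 * b ^ 4 * e ^ 4 + a ^ 4 * b ^ 4 * d ^ 4 +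
        a ^ 4 * e ^ 4 * d ^ 4 + b ^ 4 * e ^ 4 * d ^ 4 := by
    intro a b e d ha hb he hd
    have h : ∀ p q r s : ℝ, 4 * (p * q * r * s) ≤ p ^ 4 + q ^ 4 + r ^ 4 + s ^ 4 := by
      intro p q r s
      nlinarith [sq_nonneg (p * q - r * s), sq_nonneg (p ^ 2 - q ^ 2), sq_nonneg (r ^ 2 - s ^ 2)]
    have := h (a * b * e) (a * b * d) (a * e * d) (b * e * d)
    nlinarith [this]
  have step : ∀ p ∈ (S ×ˢ S) ×ˢ (S ×ˢ S),
      ‖c p.1.1‖ * ‖c p.1.2‖ * ‖c p.2.1‖ * ‖c p.2.2‖ *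
        ‖(if p.1.1 + p.1.2 - p.2.1 - p.2.2 = 0 then (2 : ℂ) else 0)‖ ≤
      (1 / 2) * ((if p.2.2 = p.1.1 + p.1.2 - p.2.1 then P p.1.1 * P p.1.2 * P p.2.1 else 0) +
        (if p.2.1 = p.1.1 + p.1.2 - p.2.2 then P p.1.1 * P p.1.2 * P p.2.2 else 0) +
        (if p.1.2 = p.2.1 + p.2.2 - p.1.1 then P p.1.1 * P p.2.1 * P p.2.2 else 0) +
        (if p.1.1 = p.2.1 + p.2.2 - p.1.2 then P p.1.2 * P p.2.1 * P p.2.2 else 0)) := by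
    rintro ⟨⟨a, b⟩, ⟨e, d⟩⟩ -
    dsimp only
    by_cases h : a + b - e - d = 0
    · rw [if_pos h, if_pos (by omega), if_pos (by omega), if_pos (by omega), if_pos (by omega)]
      have h1 : ‖c a‖ * ‖c b‖ * ‖c e‖ * ‖c d‖ ≤ w a ^ 3 * w b ^ 3 * w e ^ 3 * w d ^ 3 := by
        have := hw a; have := hw b; have := hw e; have := hw d
        gcongr <;> apply hc
      have h2 := amgm _ _ _ _ (hw a) (hw b) (hw e) (hw d)
      simp only [Complex.norm_ofNat, P]
      linarith
    · rw [if_neg h, if_neg (by omega), if_neg (by omega), if_neg (by omega), if_neg (by omega)]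
      simp
  refine (Finset.sum_le_sum step).trans ?_
  rw [← Finset.mul_sum]
  simp only [Finset.sum_add_distrib]
  have tot : ∑ a ∈ S, ∑ b ∈ S, ∑ e ∈ S, P a * P b * P e = (∑ n ∈ S, P n) ^ 3 := by
    simp_rw [← Finset.mul_sum, ← Finset.sum_mul, ← Finset.mul_sum, ← Finset.sum_mul]
    ring
  have ite_le : ∀ (g : ℤ) (v : ℝ), 0 ≤ v → ∑ d ∈ S, (if d = g then v else 0) ≤ v := by
    intro g v hv
    rw [Finset.sum_ite_eq']
    split_ifs <;> simp [hv]
  have b1 : ∑ p ∈ (S ×ˢ S) ×ˢ (S ×ˢ S),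
      (if p.2.2 = p.1.1 + p.1.2 - p.2.1 then P p.1.1 * P p.1.2 * P p.2.1 else 0) ≤
      (∑ n ∈ S, P n) ^ 3 := by
    rw [← tot]
    simp only [Finset.sum_product]
    gcongr with a _ b _ e _
    exact ite_le _ _ (by have := hP a; have := hP b; have := hP e; positivity)
  have b2 : ∑ p ∈ (S ×ˢ S) ×ˢ (S ×ˢ S),
      (if p.2.1 = p.1.1 + p.1.2 - p.2.2 then P p.1.1 * P p.1.2 * P p.2.2 else 0) ≤
      (∑ n ∈ S, P n) ^ 3 := by
    rw [← tot]
    simp only [Finset.sum_product]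
    refine Finset.sum_le_sum fun a _ => Finset.sum_le_sum fun b _ => ?_
    rw [Finset.sum_comm]
    refine Finset.sum_le_sum fun e _ => ?_
    exact ite_le _ _ (by have := hP a; have := hP b; have := hP e; positivity)
  have b3 : ∑ p ∈ (S ×ˢ S) ×ˢ (S ×ˢ S),
      (if p.1.2 = p.2.1 + p.2.2 - p.1.1 then P p.1.1 * P p.2.1 * P p.2.2 else 0) ≤
      (∑ n ∈ S, P n) ^ 3 := by
    rw [← tot]
    simp only [Finset.sum_product]
    refine Finset.sum_le_sum fun a _ => ?_
    rw [Finset.sum_comm]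
    refine Finset.sum_le_sum fun b _ => ?_
    rw [Finset.sum_comm]
    refine Finset.sum_le_sum fun e _ => ?_
    exact ite_le _ _ (by have := hP a; have := hP b; have := hP e; positivity)
  have b4 : ∑ p ∈ (S ×ˢ S) ×ˢ (S ×ˢ S),
      (if p.1.1 = p.2.1 + p.2.2 - p.1.2 then P p.1.2 * P p.2.1 * P p.2.2 else 0) ≤
      (∑ n ∈ S, P n) ^ 3 := by
    rw [← tot]
    simp only [Finset.sum_product]
    rw [Finset.sum_comm]
    refine Finset.sum_le_sum fun a _ => ?_
    rw [Finset.sum_comm]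
    refine Finset.sum_le_sum fun b _ => ?_
    rw [Finset.sum_comm]
    refine Finset.sum_le_sum fun e _ => ?_
    exact ite_le _ _ (by have := hP a; have := hP b; have := hP e; positivity)
  have : ∑ n ∈ S, w n ^ 4 = ∑ n ∈ S, P n := rfl
  rw [this]
  linarith

/-- The periodic `L⁴` Strichartz estimate for the biharmonic Schrödinger group. -/
theorem exists_lintegral_strichartz_le (T : ℝ) : ∃ C : ℝ≥0, ∀ (S : Finset ℤ) (c : ℤ → ℂ),
    ∫⁻ z, ‖∑ n ∈ S, c n * (expo n z.1 * osc n z.2)‖ₑ ^ 4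
      ∂((volume.restrict (Ioc (0 : ℝ) 2)).prod (volume.restrict (Ioo 0 T))) ≤
      C * (∑ n ∈ S, ‖c n‖ₑ ^ 2) ^ 2 := by
  have hper : 0 < 2 * Real.pi / Real.pi ^ 4 := by positivity
  -- The time interval is enlarged to a whole number of periods of `osc`, where the exponentials are
  -- exactly orthogonal.
  obtain ⟨N, hN⟩ := exists_nat_gt (T / (2 * Real.pi / Real.pi ^ 4))
  set L : ℝ := N * (2 * Real.pi / Real.pi ^ 4) with hL
  have hTL : T ≤ L := by
    rw [div_lt_iff₀ hper] at hN
    exact hN.le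
  have hL0 : 0 ≤ L := by positivity
  -- Here `2 * L` is the area of the enlarged cell, and the remaining factor 2 counts the two ways
  -- of pairing the indices.
  refine ⟨(4 * L).toNNReal, fun S c => ?_⟩
  set μ := (volume.restrict (Ioc (0 : ℝ) 2)).prod (volume.restrict (Ioc 0 L)) with hμ
  have hle : (volume.restrict (Ioc (0 : ℝ) 2)).prod (volume.restrict (Ioo 0 T)) ≤ μ := by
    rw [hμ, Measure.prod_restrict, Measure.prod_restrict]
    exact Measure.restrict_mono_set _ (prod_mono le_rfl fun t ht => ⟨ht.1, ht.2.le.trans hTL⟩)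
  refine (lintegral_mono' hle le_rfl).trans ?_
  refine (integral_norm_sum_pow_four_le μ (fun n z => expo n z.1 * osc n z.2)
    (fun n => Continuous.aestronglyMeasurable (by fun_prop))
    (fun n z => by simp [norm_expo, norm_osc]) S c).trans ?_
  have hker : ∀ a b e d : ℤ, ∫ z, (expo a z.1 * osc a z.2) * (expo b z.1 * osc b z.2) *
      (starRingEnd ℂ (expo e z.1 * osc e z.2) * starRingEnd ℂ (expo d z.1 * osc d z.2)) ∂μ =
      (if a + b - e - d = 0 then 2 else 0) *
        (if a ^ 4 + b ^ 4 - e ^ 4 - d ^ 4 = 0 then (L : ℂ) else 0) := by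
    intro a b e d
    rw [← integral_expo, ← integral_osc, ← integral_prod_mul]
    refine integral_congr_ae (.of_forall fun z => ?_)
    dsimp only
    rw [← expo_mul_four, ← osc_mul_four]
    simp only [map_mul]
    ring
  have hR : (∑ n ∈ S, ‖c n‖ₑ ^ 2) ^ 2 = ENNReal.ofReal ((∑ n ∈ S, ‖c n‖ ^ 2) ^ 2) := by
    rw [ENNReal.ofReal_pow (by positivity), ENNReal.ofReal_sum_of_nonneg fun n _ => by positivity]
    simp_rw [ENNReal.ofReal_pow (norm_nonneg _), ofReal_norm]
  rw [hR, ← ENNReal.ofReal_coe_nnreal, ← ENNReal.ofReal_mul (by positivity),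
    Real.coe_toNNReal _ (by positivity)]
  refine ENNReal.ofReal_le_ofReal ?_
  have step : ∀ p ∈ (S ×ˢ S) ×ˢ (S ×ˢ S),
      ‖c p.1.1‖ * ‖c p.1.2‖ * ‖c p.2.1‖ * ‖c p.2.2‖ *
        ‖∫ z, (expo p.1.1 z.1 * osc p.1.1 z.2) * (expo p.1.2 z.1 * osc p.1.2 z.2) *
          (starRingEnd ℂ (expo p.2.1 z.1 * osc p.2.1 z.2) *
            starRingEnd ℂ (expo p.2.2 z.1 * osc p.2.2 z.2)) ∂μ‖ ≤
      2 * L * ((if p.2.2 = p.1.2 then (if p.2.1 = p.1.1 then ‖c p.1.1‖ ^ 2 * ‖c p.1.2‖ ^ 2 else 0) else 0) +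
        (if p.2.2 = p.1.1 then (if p.2.1 = p.1.2 then ‖c p.1.1‖ ^ 2 * ‖c p.1.2‖ ^ 2 else 0) else 0)) := by
    rintro ⟨⟨a, b⟩, ⟨e, d⟩⟩ -
    dsimp only
    rw [hker]
    have hnn : ∀ u v u' v' : ℤ, (0 : ℝ) ≤
        (if u = v then (if u' = v' then ‖c a‖ ^ 2 * ‖c b‖ ^ 2 else 0) else 0) := by
      intro u v u' v'; split_ifs <;> positivity
    by_cases h : a + b - e - d = 0 ∧ a ^ 4 + b ^ 4 - e ^ 4 - d ^ 4 = 0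
    · rw [if_pos h.1, if_pos h.2]
      have hn : ‖(2 : ℂ) * L‖ = 2 * L := by
        rw [norm_mul, Complex.norm_real, Real.norm_of_nonneg hL0, Complex.norm_ofNat]
      rw [hn, mul_comm]
      refine mul_le_mul_of_nonneg_left ?_ (by positivity)
      rcases eq_or_eq_of_add_eq_of_pow_four (a := a) (b := b) (c := e) (d := d)
        (by linarith [h.1]) (by linarith [h.2]) with ⟨rfl, rfl⟩ | ⟨rfl, rfl⟩
      · rw [if_pos rfl, if_pos rfl]
        have := hnn b a a b
        nlinarith
      · rw [if_pos rfl, if_pos rfl]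
        have := hnn a b b a
        nlinarith
    · have : (if a + b - e - d = 0 then (2 : ℂ) else 0) *
        (if a ^ 4 + b ^ 4 - e ^ 4 - d ^ 4 = 0 then (L : ℂ) else 0) = 0 := by
        by_cases h1 : a + b - e - d = 0
        · rw [if_neg (fun h2 => h ⟨h1, h2⟩), mul_zero]
        · rw [if_neg h1, zero_mul]
      rw [this, norm_zero, mul_zero]
      have := hnn d b e a; have := hnn d a e b
      positivity
  refine (Finset.sum_le_sum step).trans ?_
  rw [← Finset.mul_sum]
  simp only [Finset.sum_add_distrib]
  have ite_le : ∀ (g g' : ℤ) (v : ℝ), 0 ≤ v →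
      ∑ e ∈ S, ∑ d ∈ S, (if d = g then (if e = g' then v else 0) else 0) ≤ v := by
    intro g g' v hv
    simp only [Finset.sum_ite_eq']
    split_ifs
    · rw [Finset.sum_ite_eq']
      split_ifs <;> simp [hv]
    · simpa using hv
  have tot : ∑ a ∈ S, ∑ b ∈ S, ‖c a‖ ^ 2 * ‖c b‖ ^ 2 = (∑ n ∈ S, ‖c n‖ ^ 2) ^ 2 := by
    rw [sq, Finset.sum_mul_sum]
  have b1 : ∑ p ∈ (S ×ˢ S) ×ˢ (S ×ˢ S),
      (if p.2.2 = p.1.2 then (if p.2.1 = p.1.1 then ‖c p.1.1‖ ^ 2 * ‖c p.1.2‖ ^ 2 else 0) else 0) ≤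
      (∑ n ∈ S, ‖c n‖ ^ 2) ^ 2 := by
    rw [← tot]
    simp only [Finset.sum_product]
    gcongr with a _ b _
    exact ite_le _ _ _ (by positivity)
  have b2 : ∑ p ∈ (S ×ˢ S) ×ˢ (S ×ˢ S),
      (if p.2.2 = p.1.1 then (if p.2.1 = p.1.2 then ‖c p.1.1‖ ^ 2 * ‖c p.1.2‖ ^ 2 else 0) else 0) ≤
      (∑ n ∈ S, ‖c n‖ ^ 2) ^ 2 := by
    rw [← tot]
    simp only [Finset.sum_product]
    gcongr with a _ b _
    exact ite_le _ _ _ (by positivity)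
  nlinarith

/-! ### Minkowski's integral inequality -/

/-- Hölder's inequality with a weight. -/
theorem lintegral_pow_le_of_weight {Z : Type*} [MeasurableSpace Z] {μ : Measure Z} (k : ℕ)
    (hk : k ≠ 0) {f A : Z → ℝ≥0∞} (hf : AEMeasurable f μ) (hA : AEMeasurable A μ)
    (hA0 : ∀ z, A z ≠ ⊤) (hfA : ∀ᵐ z ∂μ, A z = 0 → f z = 0) :
    (∫⁻ z, f z ∂μ) ^ (k + 1) ≤ (∫⁻ z, A z ∂μ) ^ k * ∫⁻ z, f z ^ (k + 1) * (A z ^ k)⁻¹ ∂μ := by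
  have hk' : (0 : ℝ) < k := by positivity
  set p : ℝ := k + 1
  set q : ℝ := p / k
  have hp0 : 0 < p := by positivity
  have hpq : q.HolderConjugate p := by
    rw [Real.holderConjugate_iff]
    constructor
    · rw [lt_div_iff₀ hk']; simp [p]
    · simp only [q, p]; field_simp
  set B : Z → ℝ≥0∞ := fun z => f z * (A z ^ (1 / q))⁻¹
  have hB : AEMeasurable B μ := hf.mul ((hA.pow_const _).inv)
  have h1 : ∫⁻ z, f z ∂μ ≤ ∫⁻ z, ((fun z => A z ^ (1 / q)) * B) z ∂μ := by
    refine lintegral_mono_ae (hfA.mono fun z hz => ?_)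
    by_cases h0 : A z = 0
    · simp [hz h0]
    · have hne : A z ^ (1 / q) ≠ 0 := by
        simp [ENNReal.rpow_eq_zero_iff, h0, hA0 z]
      have hnt : A z ^ (1 / q) ≠ ⊤ := ENNReal.rpow_ne_top_of_nonneg (by positivity) (hA0 z)
      simp only [Pi.mul_apply, B]
      rw [mul_comm (f z), ← mul_assoc, ENNReal.mul_inv_cancel hne hnt, one_mul]
  have h2 := ENNReal.lintegral_mul_le_Lp_mul_Lq μ hpq (hA.pow_const (1 / q)) hB
  have hq0 : 0 < q := by positivity
  have e1 : ∀ z, (A z ^ (1 / q)) ^ q = A z := fun z => by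
    rw [← ENNReal.rpow_mul, one_div_mul_cancel hq0.ne', ENNReal.rpow_one]
  have e2 : ∀ z, B z ^ p = f z ^ (k + 1) * (A z ^ k)⁻¹ := fun z => by
    have hpc : p = ((k + 1 : ℕ) : ℝ) := by simp [p]
    simp only [B]
    rw [ENNReal.mul_rpow_of_nonneg _ _ hp0.le, ENNReal.inv_rpow, ← ENNReal.rpow_mul]
    congr 1
    · rw [hpc, ENNReal.rpow_natCast]
    · congr 1
      have : 1 / q * p = (k : ℝ) := by simp only [q]; field_simp
      rw [this, ENNReal.rpow_natCast]
  simp_rw [e1, e2] at h2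
  have h3 := pow_le_pow_left' (h1.trans h2) (k + 1)
  refine h3.trans (le_of_eq ?_)
  rw [mul_pow, ← ENNReal.rpow_natCast, ← ENNReal.rpow_natCast, ← ENNReal.rpow_mul,
    ← ENNReal.rpow_mul]
  congr 1
  · rw [← ENNReal.rpow_natCast]
    congr 1
    simp only [q, p]; push_cast; field_simp
  · have : 1 / p * ((k + 1 : ℕ) : ℝ) = 1 := by simp only [p]; push_cast; field_simp
    rw [this, ENNReal.rpow_one]

/-- Minkowski's integral inequality. -/
theorem lintegral_lintegral_pow_le {Z X : Type*} [MeasurableSpace Z] [MeasurableSpace X]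
    {μ : Measure Z} {ν : Measure X} [SFinite μ] [SFinite ν] (k : ℕ) (hk : k ≠ 0)
    {f : Z → X → ℝ≥0∞} {A : Z → ℝ≥0∞} (hf : Measurable (Function.uncurry f)) (hA : Measurable A)
    (hA0 : ∀ z, A z ≠ ⊤) (h : ∀ z, ∫⁻ x, f z x ^ (k + 1) ∂ν ≤ A z ^ (k + 1)) :
    ∫⁻ x, (∫⁻ z, f z x ∂μ) ^ (k + 1) ∂ν ≤ (∫⁻ z, A z ∂μ) ^ (k + 1) := by
  have hfz : ∀ z, Measurable (f z) := fun z => hf.of_uncurry_left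
  -- The weighted Hölder inequality with weight `A` needs `f` to vanish where `A` does. The
  -- hypothesis gives this for each `z` and almost every `x`; Fubini for null sets exchanges the
  -- quantifiers.
  have hzero : ∀ᵐ x ∂ν, ∀ᵐ z ∂μ, A z = 0 → f z x = 0 := by
    rw [← Measure.ae_ae_comm]
    · refine .of_forall fun z => ?_
      by_cases hz : A z = 0
      · have := h z
        rw [hz, zero_pow k.succ_ne_zero, nonpos_iff_eq_zero,
          lintegral_eq_zero_iff ((hfz z).pow_const _)] at this
        filter_upwards [this] with x hx _
        simpa using hx
      · simp [hz]
    · refine MeasurableSet.imp ?_ ?_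
      · exact (hA.comp measurable_fst) (measurableSet_singleton 0)
      · exact hf (measurableSet_singleton 0)
  calc ∫⁻ x, (∫⁻ z, f z x ∂μ) ^ (k + 1) ∂ν
      ≤ ∫⁻ x, (∫⁻ z, A z ∂μ) ^ k * ∫⁻ z, f z x ^ (k + 1) * (A z ^ k)⁻¹ ∂μ ∂ν := by
        refine lintegral_mono_ae (hzero.mono fun x hx => ?_)
        exact lintegral_pow_le_of_weight k hk (hf.of_uncurry_right).aemeasurable hA.aemeasurable
          hA0 hx
    _ = (∫⁻ z, A z ∂μ) ^ k * ∫⁻ x, ∫⁻ z, f z x ^ (k + 1) * (A z ^ k)⁻¹ ∂μ ∂ν := by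
        rw [lintegral_const_mul]
        have : Measurable fun x : X × Z => f x.2 x.1 ^ (k + 1) * (A x.2 ^ k)⁻¹ :=
          ((hf.comp measurable_swap).pow_const _).mul
            ((hA.comp measurable_snd).pow_const _).inv
        exact this.lintegral_prod_right'
    _ = (∫⁻ z, A z ∂μ) ^ k * ∫⁻ z, ∫⁻ x, f z x ^ (k + 1) * (A z ^ k)⁻¹ ∂ν ∂μ := by
        rw [lintegral_lintegral_swap]
        exact (((hf.comp measurable_swap).pow_const _).mul
          ((hA.comp measurable_snd).pow_const _).inv).aemeasurable
    _ ≤ (∫⁻ z, A z ∂μ) ^ k * ∫⁻ z, A z ∂μ := by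
        gcongr with z
        rw [lintegral_mul_const _ ((hfz z).pow_const _)]
        by_cases hz : A z = 0
        · have := h z
          rw [hz, zero_pow k.succ_ne_zero, nonpos_iff_eq_zero] at this
          rw [this, zero_mul]
          exact zero_le
        · calc _ ≤ A z ^ (k + 1) * (A z ^ k)⁻¹ := by gcongr; exact h z
            _ = A z := by
              rw [pow_succ', mul_assoc, ENNReal.mul_inv_cancel (pow_ne_zero _ hz)
                (ENNReal.pow_ne_top (hA0 z)), mul_one]
    _ = _ := by rw [pow_succ]

/-! ### Frequency weights -/

/-- The fixed exponent 4 dominates every `a ≤ 4`, negative ones included, which keeps the constants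
below independent of `s`. -/
theorem rpow_div_le_of_mem {a r : ℝ} (ha : a ≤ 4) {y : ℝ} (h1 : 1 ≤ y) (hr : y ≤ r) :
    y ^ a ≤ r ^ (4 : ℝ) :=
  (Real.rpow_le_rpow_of_exponent_le h1 ha).trans
    (Real.rpow_le_rpow (by linarith) hr (by norm_num))

theorem rpow_mul_rpow_le_pow_four {a b ν X M : ℝ} (ha : a ≤ 4) (hb : b ≤ 4) (hab : a + b ≤ 4)
    (hν : 1 ≤ ν) (hX : 1 ≤ X) (hνM : ν ≤ M) (hXM : X ≤ M) : ν ^ a * X ^ b ≤ M ^ (4 : ℝ) := by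
  have hM : 1 ≤ M := hν.trans hνM
  have aux : ∀ {y : ℝ} (_ : 1 ≤ y) (_ : y ≤ M) (e : ℝ), y ^ e ≤ M ^ (max e 0) := by
    intro y hy hyM e
    calc y ^ e ≤ y ^ (max e 0) := Real.rpow_le_rpow_of_exponent_le hy (le_max_left _ _)
      _ ≤ M ^ (max e 0) := Real.rpow_le_rpow (by linarith) hyM (le_max_right _ _)
  calc ν ^ a * X ^ b ≤ M ^ (max a 0) * M ^ (max b 0) := by
        have := aux hν hνM a; have := aux hX hXM b; gcongr
    _ = M ^ (max a 0 + max b 0) := (Real.rpow_add (by linarith) _ _).symm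
    _ ≤ M ^ (4 : ℝ) := by
        refine Real.rpow_le_rpow_of_exponent_le hM ?_
        rcases le_total a 0 with h | h <;> rcases le_total b 0 with h' | h' <;>
          simp [h, h'] <;> linarith

/-- The eighth root of `1 + ξ²`. -/
def octic (ξ : ℝ) : ℝ := (1 + ξ ^ 2) ^ (1 / 8 : ℝ)

theorem one_le_octic (ξ : ℝ) : 1 ≤ octic ξ :=
  Real.one_le_rpow (by nlinarith [sq_nonneg ξ]) (by norm_num)

theorem octic_pow (ξ : ℝ) : octic ξ ^ 8 = 1 + ξ ^ 2 := by
  rw [octic, ← Real.rpow_natCast, ← Real.rpow_mul (by positivity)]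
  norm_num

theorem octic_rpow (ξ a : ℝ) : octic ξ ^ a = (1 + ξ ^ 2) ^ (a / 8) := by
  rw [octic, ← Real.rpow_mul (by positivity)]
  congr 1; ring

theorem abs_le_octic (ξ : ℝ) : |ξ| ≤ octic ξ ^ 4 := by
  have h := octic_pow ξ
  have h1 := one_le_octic ξ
  refine abs_le_of_sq_le_sq ?_ (by positivity)
  nlinarith

theorem octic_le_of_abs_le {ξ a : ℝ} (ha : 0 ≤ a) (h : 1 + ξ ^ 2 ≤ a ^ 8) : octic ξ ≤ a := by
  rw [← octic_pow] at h
  exact le_of_pow_le_pow_left₀ (by norm_num) ha h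

theorem le_octic_of_le {ξ a : ℝ} (h : a ^ 8 ≤ 1 + ξ ^ 2) : a ≤ octic ξ := by
  rw [← octic_pow] at h
  exact le_of_pow_le_pow_left₀ (by norm_num) (by have := one_le_octic ξ; linarith) h

theorem pi_pow_four_bounds : 96 ≤ Real.pi ^ 4 ∧ Real.pi ^ 4 ≤ 100 := by
  have h1 := Real.pi_gt_d2
  have h2 := Real.pi_lt_d2
  constructor
  · calc (96 : ℝ) ≤ 3.14 ^ 4 := by norm_num
      _ ≤ Real.pi ^ 4 := pow_le_pow_left₀ (by norm_num) h1.le 4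
  · calc Real.pi ^ 4 ≤ 3.15 ^ 4 := pow_le_pow_left₀ Real.pi_pos.le h2.le 4
      _ ≤ 100 := by norm_num

/-- Since `octic ξ` behaves like `|ξ|^{1/4}`, it is comparable to the wave number resonant with `ξ`.
The weight is homogeneous of degree zero in `(octic ξ, ν)`, so it is bounded wherever the two are
comparable. -/
theorem weight_eq (s ν ξ : ℝ) (hν : 0 < ν) :
    ν ^ (s - 1) * octic ξ ^ 4 * octic ξ ^ (-(3 + s)) = (octic ξ / ν) ^ (1 - s) := by
  have hX := one_le_octic ξ
  have hX0 : 0 < octic ξ := by linarith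
  have h4 : octic ξ ^ 4 * octic ξ ^ (-(3 + s)) = octic ξ ^ (1 - s) := by
    rw [← Real.rpow_natCast, ← Real.rpow_add hX0]
    congr 1; push_cast; ring
  rw [mul_assoc, h4, Real.div_rpow hX0.le hν.le, div_eq_mul_inv, ← Real.rpow_neg hν.le, mul_comm]
  congr 2; ring

/-- The weight near the resonance is bounded. -/
theorem near_weight_le {s ν ξ : ℝ} (hs : s ∈ Icc (0 : ℝ) 4) (hν : 1 ≤ ν)
    (h : |2 * Real.pi * ξ - (ν * Real.pi) ^ 4| < ν ^ 3) :
    ν ^ (s - 1) * |2 * Real.pi * ξ| * (1 + ξ ^ 2) ^ (-(3 + s) / 8) ≤ 162 * Real.pi := by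
  have hπ := Real.pi_gt_three
  obtain ⟨hp1, hp2⟩ := pi_pow_four_bounds
  have hν0 : 0 < ν := by linarith
  rw [abs_lt] at h
  have h34 : ν ^ 3 ≤ ν ^ 4 := pow_le_pow_right₀ hν (by norm_num)
  have hν4 : 1 ≤ ν ^ 4 := one_le_pow₀ hν
  -- On the resonance `2πξ` is at least `95ν⁴` and at most `101ν⁴`, which puts `ξ` between `ν⁴` and
  -- `25ν⁴`, hence `octic ξ` between `ν` and `3ν`.
  have hξl : ν ^ 4 ≤ ξ := by
    have : 2 * Real.pi * ν ^ 4 ≤ 2 * Real.pi * ξ := by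
      have : 2 * Real.pi * ν ^ 4 ≤ 8 * ν ^ 4 := by
        have := Real.pi_lt_d2; gcongr; linarith
      nlinarith [h.1]
    exact le_of_mul_le_mul_left this (by positivity)
  have hξu : ξ ≤ 25 * ν ^ 4 := by
    have : 2 * Real.pi * ξ ≤ 101 * ν ^ 4 := by nlinarith [h.2]
    nlinarith
  have hXl : ν ≤ octic ξ := le_octic_of_le (by nlinarith)
  have hXu : octic ξ ≤ 3 * ν := by
    refine octic_le_of_abs_le (by positivity) ?_
    have : ξ ^ 2 ≤ (25 * ν ^ 4) ^ 2 := pow_le_pow_left₀ (by linarith) hξu 2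
    nlinarith
  have hy1 : 1 ≤ octic ξ / ν := by rwa [one_le_div hν0]
  have hy3 : octic ξ / ν ≤ 3 := by rwa [div_le_iff₀ hν0]
  calc ν ^ (s - 1) * |2 * Real.pi * ξ| * (1 + ξ ^ 2) ^ (-(3 + s) / 8)
      ≤ ν ^ (s - 1) * (2 * Real.pi * octic ξ ^ 4) * octic ξ ^ (-(3 + s)) := by
        rw [octic_rpow, abs_mul, abs_of_pos (by positivity : 0 < 2 * Real.pi)]
        gcongr
        exact abs_le_octic ξ
    _ = 2 * Real.pi * (octic ξ / ν) ^ (1 - s) := by rw [← weight_eq s ν ξ hν0]; ring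
    _ ≤ 2 * Real.pi * 3 ^ (4 : ℝ) := by
        gcongr
        exact rpow_div_le_of_mem (by linarith [hs.1]) hy1 hy3
    _ = 162 * Real.pi := by norm_num; ring

/-- The weight away from the resonance. -/
theorem far_weight_le {s ν ξ : ℝ} (hs : s ∈ Icc (0 : ℝ) 4) (hν : 1 ≤ ν)
    (h : ν ^ 3 ≤ |2 * Real.pi * ξ - (ν * Real.pi) ^ 4|) :
    ν ^ (s - 1) * |2 * Real.pi * ξ| * (1 + ξ ^ 2) ^ (-(3 + s) / 8) ≤
      512 * Real.pi * |2 * Real.pi * ξ - (ν * Real.pi) ^ 4| *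
        (ν ^ (-(4 / 5) : ℝ) * (1 + ξ ^ 2) ^ (-(11 / 40) : ℝ)) := by
  have hπ := Real.pi_gt_three
  have hπ' := Real.pi_lt_d2
  obtain ⟨hp1, hp2⟩ := pi_pow_four_bounds
  have hν0 : 0 < ν := by linarith
  set X := octic ξ with hX
  have hX1 : 1 ≤ X := one_le_octic ξ
  have hX0 : 0 < X := by linarith
  set D := |2 * Real.pi * ξ - (ν * Real.pi) ^ 4| with hD
  have hνe : (ν * Real.pi) ^ 4 = ν ^ 4 * Real.pi ^ 4 := by ring
  -- The left side has degree 3. For `X ≤ ν` or `X > 4ν` the modulation `D` is at least the fourth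
  -- power of the larger variable; for comparable variables only `D ≥ ν³` is available, and it is
  -- just enough. In the final bound `ν^{-p} X^{-(3-p)}`, the power `ν^{-p}` is in `ℓ^{4/3}` for `p
  -- > 3/4` and the power of `X` is square integrable in `ξ` for `p < 1`; the choice is `p = 4/5`.
  have key : ν ^ (s - 1 / 5) * X ^ (16 / 5 - s) ≤ 256 * D := by
    rcases le_or_gt X ν with h1 | h1
    · have hDl : ν ^ 4 ≤ D := by
        refine le_trans ?_ (neg_le_abs _)
        have : 2 * Real.pi * ξ ≤ 8 * ν ^ 4 := by
          have h2 := (le_abs_self ξ).trans (abs_le_octic ξ)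
          have h3 : X ^ 4 ≤ ν ^ 4 := pow_le_pow_left₀ hX0.le h1 4
          have h4 : ξ ≤ ν ^ 4 := h2.trans h3
          have h5 : 2 * Real.pi * ξ ≤ 2 * Real.pi * ν ^ 4 := by gcongr
          nlinarith [pow_pos hν0 4]
        nlinarith [pow_pos hν0 4]
      have := rpow_mul_rpow_le_pow_four (a := s - 1 / 5) (b := 16 / 5 - s) (by linarith [hs.2])
        (by linarith [hs.1]) (by linarith) hν hX1 le_rfl h1
      rw [show (4 : ℝ) = ((4 : ℕ) : ℝ) by norm_num, Real.rpow_natCast] at this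
      nlinarith [pow_pos hν0 4]
    · rcases le_or_gt X (4 * ν) with h2 | h2
      · have : ν ^ (s - 1 / 5) * X ^ (16 / 5 - s) = ν ^ 3 * (X / ν) ^ (16 / 5 - s) := by
          rw [Real.div_rpow hX0.le hν0.le, div_eq_mul_inv (X ^ (16 / 5 - s)),
            ← Real.rpow_neg hν0.le, ← Real.rpow_natCast ν 3, mul_comm (X ^ (16 / 5 - s)),
            ← mul_assoc, ← Real.rpow_add hν0]
          congr 2; push_cast; ring
        rw [this]
        have h3 : (X / ν) ^ (16 / 5 - s) ≤ 4 ^ (4 : ℝ) :=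
          rpow_div_le_of_mem (by linarith [hs.1]) ((one_le_div hν0).2 h1.le)
            ((div_le_iff₀ hν0).2 h2)
        have h4 : (4 : ℝ) ^ (4 : ℝ) = 256 := by norm_num
        rw [h4] at h3
        calc ν ^ 3 * (X / ν) ^ (16 / 5 - s) ≤ D * 256 := by gcongr
          _ = _ := mul_comm _ _
      · have hDl : X ^ 4 ≤ D := by
          have h3 : (4 * ν) ^ 4 ≤ X ^ 4 := pow_le_pow_left₀ (by positivity) h2.le 4
          have h4 : X ^ 4 ≤ 2 * |ξ| := by
            refine le_of_sq_le_sq ?_ (by positivity)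
            have h5 := octic_pow ξ
            rw [mul_pow, sq_abs]
            have : 4 ≤ X := by linarith
            have : (4 : ℝ) ^ 8 ≤ X ^ 8 := pow_le_pow_left₀ (by norm_num) this 8
            nlinarith
          have h6 : |2 * Real.pi * ξ| - |(ν * Real.pi) ^ 4| ≤ D := abs_sub_abs_le_abs_sub _ _
          have h7 : |2 * Real.pi * ξ| = 2 * Real.pi * |ξ| := by
            rw [abs_mul, abs_of_pos (by positivity : 0 < 2 * Real.pi)]
          have h8 : |(ν * Real.pi) ^ 4| = ν ^ 4 * Real.pi ^ 4 := by
            rw [abs_of_pos (by positivity), hνe]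
          rw [h7, h8] at h6
          have h9 : 3 * (2 * |ξ|) ≤ Real.pi * (2 * |ξ|) := by gcongr
          nlinarith [pow_pos hν0 4, abs_nonneg ξ]
        have := rpow_mul_rpow_le_pow_four (a := s - 1 / 5) (b := 16 / 5 - s) (by linarith [hs.2])
          (by linarith [hs.1]) (by linarith) hν hX1 h1.le le_rfl
        rw [show (4 : ℝ) = ((4 : ℕ) : ℝ) by norm_num, Real.rpow_natCast] at this
        nlinarith [pow_pos hX0 4]
  calc ν ^ (s - 1) * |2 * Real.pi * ξ| * (1 + ξ ^ 2) ^ (-(3 + s) / 8)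
      ≤ ν ^ (s - 1) * (2 * Real.pi * X ^ 4) * X ^ (-(3 + s)) := by
        rw [octic_rpow, abs_mul, abs_of_pos (by positivity : 0 < 2 * Real.pi)]
        gcongr
        exact abs_le_octic ξ
    _ = 2 * Real.pi * (ν ^ (s - 1 / 5) * X ^ (16 / 5 - s)) *
          (ν ^ (-(4 / 5) : ℝ) * X ^ (-(11 / 5) : ℝ)) := by
        have e1 : ν ^ (s - 1) = ν ^ (s - 1 / 5) * ν ^ (-(4 / 5) : ℝ) := by
          rw [← Real.rpow_add hν0]; congr 1; ring
        have e2 : X ^ 4 * X ^ (-(3 + s)) = X ^ (16 / 5 - s) * X ^ (-(11 / 5) : ℝ) := by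
          rw [← Real.rpow_natCast, ← Real.rpow_add hX0, ← Real.rpow_add hX0]
          congr 1; push_cast; ring
        rw [e1]
        linear_combination (2 * Real.pi * ν ^ (s - 1 / 5) * ν ^ (-(4 / 5) : ℝ)) * e2
    _ ≤ 2 * Real.pi * (256 * D) * (ν ^ (-(4 / 5) : ℝ) * X ^ (-(11 / 5) : ℝ)) := by gcongr
    _ = _ := by
        rw [octic_rpow, show -(11 / 5) / 8 = (-(11 / 40) : ℝ) by norm_num]
        ring

/-! ### The Duhamel coefficients -/

/-- `∫₀ᵗ e^{iητ} dτ`. -/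
def oscInt (η t : ℝ) : ℂ := ∫ τ in (0 : ℝ)..t, Complex.exp (Complex.I * (η * τ : ℝ))

theorem continuous_oscInt : Continuous fun p : ℝ × ℝ => oscInt p.1 p.2 := by
  unfold oscInt
  exact intervalIntegral.continuous_parametric_intervalIntegral_of_continuous
    (f := fun p : ℝ × ℝ => fun τ : ℝ => Complex.exp (Complex.I * (p.1 * τ : ℝ)))
    (by fun_prop) continuous_snd

theorem norm_exp_I_mul (y : ℝ) : ‖Complex.exp (Complex.I * (y : ℝ))‖ = 1 := by
  rw [mul_comm, Complex.norm_exp_ofReal_mul_I]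

theorem norm_oscInt_le (η : ℝ) {t : ℝ} (ht : 0 ≤ t) : ‖oscInt η t‖ ≤ t := by
  have := intervalIntegral.norm_integral_le_of_norm_le_const (a := 0) (b := t) (C := 1)
    (f := fun τ : ℝ => Complex.exp (Complex.I * (η * τ : ℝ))) fun τ _ => (norm_exp_I_mul _).le
  rw [one_mul, sub_zero, abs_of_nonneg ht] at this
  exact this

theorem mul_oscInt (η t : ℝ) :
    Complex.I * η * oscInt η t = Complex.exp (Complex.I * (η * t : ℝ)) - 1 := by
  by_cases hη : η = 0
  · simp [hη]
  · have hc : Complex.I * (η : ℂ) ≠ 0 := by simp [hη]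
    have : ∀ τ : ℝ, Complex.I * (η * τ : ℝ) = Complex.I * η * τ := by
      intro τ; push_cast; ring
    simp_rw [oscInt, this]
    rw [integral_exp_mul_complex hc, mul_div_cancel₀ _ hc]
    simp

theorem abs_mul_norm_oscInt_le (η t : ℝ) : |η| * ‖oscInt η t‖ ≤ 2 := by
  have h := congrArg norm (mul_oscInt η t)
  rw [norm_mul, norm_mul, Complex.norm_I, one_mul, Complex.norm_real, Real.norm_eq_abs] at h
  rw [h]
  refine (norm_sub_le _ _).trans ?_
  rw [norm_exp_I_mul, norm_one]
  norm_num

/-- `(1 + η²)^{-1/2}`. -/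
def decay (η : ℝ) : ℝ := (Real.sqrt (1 + η ^ 2))⁻¹

theorem decay_nonneg (η : ℝ) : 0 ≤ decay η := by unfold decay; positivity

theorem continuous_decay : Continuous decay := by
  unfold decay
  refine Continuous.inv₀ (by fun_prop) fun x => ?_
  positivity

theorem decay_sq (η : ℝ) : decay η ^ 2 = (1 + η ^ 2)⁻¹ := by
  rw [decay, inv_pow, Real.sq_sqrt (by positivity)]

/-- Combines the trivial bound `T` with the oscillatory bound `2/|η|`, using `T² + 4 ≤ (T + 2)²`.
The result is square integrable in `η`, as the Cauchy–Schwarz step for the resonant part requires.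
-/
theorem norm_oscInt_le_decay (η : ℝ) {t T : ℝ} (ht : 0 ≤ t) (htT : t ≤ T) :
    ‖oscInt η t‖ ≤ (T + 2) * decay η := by
  have h1 := (norm_oscInt_le η ht).trans htT
  have h2 := abs_mul_norm_oscInt_le η t
  rw [decay, ← div_eq_mul_inv, le_div_iff₀ (by positivity)]
  refine le_of_sq_le_sq ?_ (by linarith)
  rw [mul_pow, Real.sq_sqrt (by positivity)]
  have h3 : ‖oscInt η t‖ ^ 2 ≤ T ^ 2 := pow_le_pow_left₀ (norm_nonneg _) h1 2
  have h4 : (|η| * ‖oscInt η t‖) ^ 2 ≤ 2 ^ 2 := pow_le_pow_left₀ (by positivity) h2 2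
  rw [mul_pow, sq_abs] at h4
  nlinarith

theorem lintegral_decay_sq :
    ∫⁻ η, ENNReal.ofReal (decay η) ^ 2 = ENNReal.ofReal Real.pi := by
  rw [← integral_univ_inv_one_add_sq,
    ofReal_integral_eq_lintegral_ofReal integrable_inv_one_add_sq
      (.of_forall fun x => by positivity)]
  refine lintegral_congr fun x => ?_
  rw [← ENNReal.ofReal_pow (decay_nonneg x), decay_sq]

theorem sq_lintegral_mul_le {Z : Type*} [MeasurableSpace Z] {μ : Measure Z} {f g : Z → ℝ≥0∞}
    (hf : AEMeasurable f μ) (hg : AEMeasurable g μ) :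
    (∫⁻ z, f z * g z ∂μ) ^ 2 ≤ (∫⁻ z, f z ^ 2 ∂μ) * ∫⁻ z, g z ^ 2 ∂μ := by
  have h := ENNReal.lintegral_mul_le_Lp_mul_Lq μ Real.HolderConjugate.two_two hf hg
  have h2 := pow_le_pow_left' h 2
  simp only [Pi.mul_apply] at h2
  refine h2.trans (le_of_eq ?_)
  rw [mul_pow]
  simp only [ENNReal.rpow_ofNat]
  rw [← ENNReal.rpow_ofNat, ← ENNReal.rpow_ofNat, ← ENNReal.rpow_mul, ← ENNReal.rpow_mul]
  norm_num

/-- The Bessel weight `(1 + ξ²)^{-q/2}` with `q = (3 + s)/4`. -/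
def besselWeight (s ξ : ℝ) : ℝ := (1 + ξ ^ 2) ^ (-(3 + s) / 8)

theorem besselWeight_nonneg (s ξ : ℝ) : 0 ≤ besselWeight s ξ := by
  unfold besselWeight; positivity

theorem continuous_rpow_weight (r : ℝ) : Continuous fun ξ : ℝ => (1 + ξ ^ 2) ^ r :=
  Continuous.rpow_const (by fun_prop) fun x => Or.inl (by positivity)

theorem continuous_besselWeight (s : ℝ) : Continuous (besselWeight s) :=
  continuous_rpow_weight _

theorem lintegral_rpow_weight_lt_top {r : ℝ} (hr : 1 / 4 < r) :
    ∫⁻ ξ : ℝ, ENNReal.ofReal ((1 + ξ ^ 2) ^ (-r)) ^ 2 < ⊤ := by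
  have h : Integrable fun x : ℝ => (1 + ‖x‖ ^ 2) ^ (-(4 * r) / 2) :=
    integrable_rpow_neg_one_add_norm_sq (by simp; linarith)
  have h2 := h.lintegral_lt_top
  refine lt_of_le_of_lt (le_of_eq (lintegral_congr fun x => ?_)) h2
  rw [← ENNReal.ofReal_pow (by positivity), ← Real.rpow_natCast, ← Real.rpow_mul (by positivity)]
  simp only [Real.norm_eq_abs, sq_abs]
  congr 2
  push_cast; ring

/-- The order `(3 + s)/4` is above `1/2`, so this is the mechanism of the Sobolev embedding into
continuous functions. -/
theorem lintegral_besselWeight_lt_top {s : ℝ} (hs : 0 ≤ s) :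
    ∫⁻ ξ : ℝ, ENNReal.ofReal (besselWeight s ξ) ^ 2 < ⊤ := by
  have := lintegral_rpow_weight_lt_top (r := (3 + s) / 8) (by linarith)
  simpa only [besselWeight, neg_div] using this

theorem integrable_besselWeight_mul {s : ℝ} (hs : 0 ≤ s) {f : ℝ → ℂ} (hf : Measurable f)
    (hf2 : ∫⁻ ξ, ‖f ξ‖ₑ ^ 2 < ⊤) : Integrable fun ξ => (besselWeight s ξ : ℂ) * f ξ := by
  refine ⟨((Complex.continuous_ofReal.comp (continuous_besselWeight s)).measurable.mul
    hf).aestronglyMeasurable, ?_⟩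
  have h := sq_lintegral_mul_le (μ := volume)
    ((continuous_besselWeight s).measurable.ennreal_ofReal.aemeasurable) hf.enorm.aemeasurable
  have h2 := h.trans_lt (ENNReal.mul_lt_top (lintegral_besselWeight_lt_top hs) hf2)
  have h3 : ∫⁻ z, ENNReal.ofReal (besselWeight s z) * ‖f z‖ₑ < ⊤ := by
    by_contra hc
    rw [not_lt, top_le_iff] at hc
    rw [hc] at h2
    simp at h2
  refine lt_of_le_of_lt (le_of_eq (lintegral_congr fun x => ?_)) h3
  rw [enorm_mul, ← ofReal_norm, Complex.norm_real, Real.norm_of_nonneg (besselWeight_nonneg s x)]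

/-- The integrand of the Duhamel coefficient. -/
def duhamelIntegrand (s : ℝ) (f : ℝ → ℂ) (n : ℤ) (t ξ : ℝ) : ℂ :=
  (2 * Real.pi * ξ : ℝ) * ((besselWeight s ξ : ℂ) * f ξ) *
    (osc n t * oscInt (2 * Real.pi * ξ - quart n) t)

/-- The Duhamel coefficient `(nπ)⁻¹ ∫ ω û(ξ) ∫₀ᵗ e^{i(nπ)⁴(t-τ)+iωτ} dτ dξ`, where `ω = 2πξ` and
`û` is `f` divided by the symbol of the Bessel potential. -/
def duhamel (s : ℝ) (f : ℝ → ℂ) (n : ℤ) (t : ℝ) : ℂ :=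
  (n * Real.pi : ℂ)⁻¹ * ∫ ξ, duhamelIntegrand s f n t ξ

/-- Writing `2πξ` as modulation plus eigenvalue, the modulation is absorbed by the oscillatory bound
on `oscInt`. The estimate is not uniform in `n`; it serves for integrability and for continuity in
`t`. -/
theorem norm_duhamelIntegrand_le (s : ℝ) (f : ℝ → ℂ) (n : ℤ) {t T : ℝ} (ht : 0 ≤ t)
    (htT : t ≤ T) (ξ : ℝ) :
    ‖duhamelIntegrand s f n t ξ‖ ≤ (quart n * T + 2) * ‖(besselWeight s ξ : ℂ) * f ξ‖ := by
  have hq : 0 ≤ quart n := by unfold quart; positivity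
  have h1 := (norm_oscInt_le (2 * Real.pi * ξ - quart n) ht).trans htT
  have h2 := abs_mul_norm_oscInt_le (2 * Real.pi * ξ - quart n) t
  rw [duhamelIntegrand, norm_mul, norm_mul, norm_mul (osc n t), norm_osc, one_mul,
    Complex.norm_real, Real.norm_eq_abs]
  have h3 : |2 * Real.pi * ξ| ≤ |2 * Real.pi * ξ - quart n| + quart n := by
    have := abs_add_le (2 * Real.pi * ξ - quart n) (quart n)
    rwa [sub_add_cancel, abs_of_nonneg hq] at this
  have h4 : |2 * Real.pi * ξ| * ‖oscInt (2 * Real.pi * ξ - quart n) t‖ ≤ quart n * T + 2 := by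
    nlinarith [norm_nonneg (oscInt (2 * Real.pi * ξ - quart n) t)]
  calc _ = (|2 * Real.pi * ξ| * ‖oscInt (2 * Real.pi * ξ - quart n) t‖) *
        ‖(besselWeight s ξ : ℂ) * f ξ‖ := by ring
    _ ≤ _ := by gcongr

theorem measurable_duhamelIntegrand (s : ℝ) {f : ℝ → ℂ} (hf : Measurable f) (n : ℤ) (t : ℝ) :
    Measurable (duhamelIntegrand s f n t) := by
  unfold duhamelIntegrand
  have h1 : Continuous fun ξ : ℝ => oscInt (2 * Real.pi * ξ - quart n) t :=
    continuous_oscInt.comp (by fun_prop : Continuous fun ξ : ℝ => (2 * Real.pi * ξ - quart n, t))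
  have h2 : Continuous fun ξ : ℝ => (besselWeight s ξ : ℂ) :=
    Complex.continuous_ofReal.comp (continuous_besselWeight s)
  have h3 : Continuous fun ξ : ℝ => ((2 * Real.pi * ξ : ℝ) : ℂ) := by fun_prop
  exact (h3.measurable.mul (h2.measurable.mul hf)).mul (h1.measurable.const_mul _)

theorem integrable_duhamelIntegrand {s : ℝ} (hs : 0 ≤ s) {f : ℝ → ℂ} (hf : Measurable f)
    (hf2 : ∫⁻ ξ, ‖f ξ‖ₑ ^ 2 < ⊤) (n : ℤ) {t : ℝ} (ht : 0 ≤ t) :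
    Integrable (duhamelIntegrand s f n t) :=
  ((integrable_besselWeight_mul hs hf hf2).norm.const_mul (quart n * t + 2)).mono'
    (measurable_duhamelIntegrand s hf n t).aestronglyMeasurable
    (.of_forall (norm_duhamelIntegrand_le s f n ht le_rfl))

theorem continuousOn_duhamel {s : ℝ} (hs : 0 ≤ s) {f : ℝ → ℂ} (hf : Measurable f)
    (hf2 : ∫⁻ ξ, ‖f ξ‖ₑ ^ 2 < ⊤) (n : ℤ) (T : ℝ) :
    ContinuousOn (duhamel s f n) (Icc 0 T) := by
  unfold duhamel
  refine continuousOn_const.mul ?_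
  refine continuousOn_of_dominated
    (bound := fun ξ => (quart n * T + 2) * ‖(besselWeight s ξ : ℂ) * f ξ‖)
    (fun t _ => (measurable_duhamelIntegrand s hf n t).aestronglyMeasurable) ?_ ?_ ?_
  · exact fun t ht => .of_forall (norm_duhamelIntegrand_le s f n ht.1 ht.2)
  · exact (integrable_besselWeight_mul hs hf hf2).norm.const_mul _
  · refine .of_forall fun ξ => Continuous.continuousOn ?_
    unfold duhamelIntegrand
    have : Continuous fun t : ℝ => oscInt (2 * Real.pi * ξ - quart n) t :=
      continuous_oscInt.comp (by fun_prop : Continuous fun t : ℝ => (2 * Real.pi * ξ - quart n, t))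
    fun_prop

/-! ### Splitting of the Duhamel coefficients at the resonance -/

/-- The density of the resonant part of the Duhamel coefficient, in terms of the modulation
`η = 2πξ - (nπ)⁴`. -/
def nearAmp (s : ℝ) (f : ℝ → ℂ) (n : ℤ) (η : ℝ) : ℂ :=
  if |η| < |(n : ℝ)| ^ 3 then
    ((|(n : ℝ)| ^ s : ℝ) * (n * Real.pi : ℂ)⁻¹ * (2 * Real.pi : ℂ)⁻¹) *
      ((quart n + η : ℝ) * ((besselWeight s ((quart n + η) / (2 * Real.pi)) : ℂ) *
        f ((quart n + η) / (2 * Real.pi))))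
  else 0

theorem measurable_nearAmp (s : ℝ) {f : ℝ → ℂ} (hf : Measurable f) (n : ℤ) :
    Measurable (nearAmp s f n) := by
  unfold nearAmp
  refine Measurable.ite (measurableSet_lt (by fun_prop) (by fun_prop)) ?_ measurable_const
  have h1 : Measurable fun η : ℝ => (quart n + η) / (2 * Real.pi) := by fun_prop
  have h2 := Complex.measurable_ofReal.comp ((continuous_besselWeight s).measurable.comp h1)
  have h3 : Measurable fun η : ℝ => ((quart n + η : ℝ) : ℂ) := by fun_prop
  exact (h3.mul (h2.mul (hf.comp h1))).const_mul _

theorem quart_eq_abs (n : ℤ) : quart n = (|(n : ℝ)| * Real.pi) ^ 4 := by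
  rw [quart, mul_pow, mul_pow, ← abs_pow, abs_of_nonneg (by positivity)]

theorem one_le_abs_intCast {n : ℤ} (hn : n ≠ 0) : (1 : ℝ) ≤ |(n : ℝ)| := by
  exact_mod_cast Int.one_le_abs hn

theorem norm_nearAmp_le {s : ℝ} (hs : s ∈ Icc (0 : ℝ) 4) (f : ℝ → ℂ) (n : ℤ) (η : ℝ) :
    ‖nearAmp s f n η‖ ≤
      if |η| < |(n : ℝ)| ^ 3 then 27 * ‖f ((quart n + η) / (2 * Real.pi))‖ else 0 := by
  unfold nearAmp
  split_ifs with h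
  · have hn : n ≠ 0 := by
      rintro rfl
      simp at h
      exact absurd h (not_lt.2 (abs_nonneg η))
    have hν := one_le_abs_intCast hn
    have hν0 : 0 < |(n : ℝ)| := by linarith
    set ξ := (quart n + η) / (2 * Real.pi) with hξ
    have e : 2 * Real.pi * ξ = quart n + η := by rw [hξ]; field_simp
    have hw := near_weight_le hs hν (ξ := ξ) (by
      rw [e, ← quart_eq_abs, add_sub_cancel_left]; exact h)
    rw [e] at hw
    have e2 : |(n : ℝ)| ^ (s - 1) = |(n : ℝ)| ^ s * |(n : ℝ)|⁻¹ := by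
      rw [Real.rpow_sub hν0, Real.rpow_one, div_eq_mul_inv]
    have hnorm : ‖((|(n : ℝ)| ^ s : ℝ) * (n * Real.pi : ℂ)⁻¹ * (2 * Real.pi : ℂ)⁻¹) *
      ((quart n + η : ℝ) * ((besselWeight s ξ : ℂ) * f ξ))‖ =
        (|(n : ℝ)| ^ (s - 1) * |quart n + η| * besselWeight s ξ) * ‖f ξ‖ *
          (Real.pi⁻¹ * (2 * Real.pi)⁻¹) := by
      simp only [norm_mul, norm_inv, Complex.norm_real, Complex.norm_intCast, Complex.norm_ofNat,
        Real.norm_eq_abs, abs_of_nonneg (besselWeight_nonneg s ξ), abs_of_pos Real.pi_pos]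
      rw [e2, abs_of_nonneg (by positivity : 0 ≤ |(n : ℝ)| ^ s), mul_inv, mul_inv]
      ring
    rw [hnorm]
    have hb : besselWeight s ξ = (1 + ξ ^ 2) ^ (-(3 + s) / 8) := rfl
    rw [hb]
    -- One factor `π⁻¹` comes from `(nπ)⁻¹`, and `(2π)⁻¹` is the Jacobian of the change from `ξ` to
    -- `η`.
    calc _ ≤ 162 * Real.pi * ‖f ξ‖ * (Real.pi⁻¹ * (2 * Real.pi)⁻¹) := by gcongr
      _ = 81 / Real.pi * ‖f ξ‖ := by field_simp; ring
      _ ≤ 27 * ‖f ξ‖ := by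
        gcongr
        rw [div_le_iff₀ Real.pi_pos]
        linarith [Real.pi_gt_three]
  · simp

theorem lintegral_comp_affine (g : ℝ → ℝ≥0∞) (hg : Measurable g) (a : ℝ) {c : ℝ} (hc : 0 < c) :
    ∫⁻ η, g ((a + η) / c) = ENNReal.ofReal c * ∫⁻ ξ, g ξ := by
  have h1 : ∫⁻ η, g ((a + η) / c) = ∫⁻ η, g (η / c) :=
    lintegral_add_left_eq_self (fun η => g (η / c)) a
  have h2 := Real.smul_map_volume_mul_left (a := c) hc.ne'
  rw [h1]
  conv_lhs => rw [← h2]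
  rw [lintegral_smul_measure, lintegral_map (by fun_prop) (by fun_prop), abs_of_pos hc, smul_eq_mul]
  congr 1
  refine lintegral_congr fun x => ?_
  rw [mul_div_cancel_left₀ _ hc.ne']

/-- For `μ ≥ ν + 1` the gap between eigenvalues satisfies `π⁴(μ⁴ - ν⁴) ≥ 96(μ³ + ν³)`, while two
overlapping bands would force it below `μ³ + ν³`. -/
theorem abs_eq_of_near {ξ : ℝ} {n m : ℤ} (hn : |2 * Real.pi * ξ - quart n| < |(n : ℝ)| ^ 3)
    (hm : |2 * Real.pi * ξ - quart m| < |(m : ℝ)| ^ 3) : |n| = |m| := by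
  have key : ∀ {n m : ℤ}, |2 * Real.pi * ξ - quart n| < |(n : ℝ)| ^ 3 →
      |2 * Real.pi * ξ - quart m| < |(m : ℝ)| ^ 3 → ¬ |n| < |m| := by
    intro n m hn hm hlt
    have h1 : |(n : ℝ)| + 1 ≤ |(m : ℝ)| := by exact_mod_cast hlt
    rw [quart_eq_abs] at hn hm
    set ν := |(n : ℝ)|
    set μ := |(m : ℝ)|
    have hν : 0 ≤ ν := abs_nonneg _
    rw [abs_lt] at hn hm
    have h2 : (μ * Real.pi) ^ 4 - (ν * Real.pi) ^ 4 < ν ^ 3 + μ ^ 3 := by linarith [hn.2, hm.1]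
    have h3 : μ ^ 3 + ν ^ 3 ≤ μ ^ 4 - ν ^ 4 := by
      have h4 : 0 ≤ (μ - ν - 1) * ((μ + ν) * (μ ^ 2 + ν ^ 2)) :=
        mul_nonneg (by linarith) (by positivity)
      have h5 : 0 ≤ μ * ν ^ 2 + ν * μ ^ 2 := by positivity
      nlinarith
    have h6 : (μ * Real.pi) ^ 4 - (ν * Real.pi) ^ 4 = Real.pi ^ 4 * (μ ^ 4 - ν ^ 4) := by ring
    have hμ : 0 < μ := by linarith
    have h7 : 0 < μ ^ 3 := by positivity
    have h8 : 0 ≤ ν ^ 3 := by positivity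
    nlinarith [pi_pow_four_bounds.1]
  exact le_antisymm (not_lt.1 (key hm hn)) (not_lt.1 (key hn hm))

theorem tsum_near_le (ξ : ℝ) :
    ∑' n : ℤ, (if |2 * Real.pi * ξ - quart n| < |(n : ℝ)| ^ 3 then (1 : ℝ≥0∞) else 0) ≤ 2 := by
  by_cases h : ∃ n₀ : ℤ, |2 * Real.pi * ξ - quart n₀| < |(n₀ : ℝ)| ^ 3
  · obtain ⟨n₀, hn₀⟩ := h
    rw [tsum_eq_sum (s := {n₀, -n₀})]
    · calc _ ≤ ∑ _ ∈ ({n₀, -n₀} : Finset ℤ), (1 : ℝ≥0∞) :=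
            Finset.sum_le_sum fun n _ => by split_ifs <;> simp
        _ ≤ 2 := by
          rw [Finset.sum_const, nsmul_eq_mul, mul_one]
          exact_mod_cast Finset.card_le_two
    · intro n hn
      rw [if_neg]
      intro hn'
      simp only [Finset.mem_insert, Finset.mem_singleton, not_or] at hn
      rcases abs_eq_abs.1 (abs_eq_of_near hn' hn₀) with h | h
      · exact hn.1 h
      · exact hn.2 h
  · push Not at h
    simp [fun n => not_lt.2 (h n)]

/-- Returning from `η` to `ξ`, the sum becomes an integral of `|f|²` over bands of which at most
two, those of `n` and `-n`, contain a given `ξ`. The constant is `27² * 2 * 2π`. -/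
theorem tsum_lintegral_nearAmp_le {s : ℝ} (hs : s ∈ Icc (0 : ℝ) 4) {f : ℝ → ℂ}
    (hf : Measurable f) :
    ∑' n : ℤ, ∫⁻ η, ‖nearAmp s f n η‖ₑ ^ 2 ≤
      ENNReal.ofReal (2916 * Real.pi) * ∫⁻ ξ, ‖f ξ‖ₑ ^ 2 := by
  set g : ℤ → ℝ → ℝ≥0∞ := fun n ξ =>
    (729 * ‖f ξ‖ₑ ^ 2) * (if |2 * Real.pi * ξ - quart n| < |(n : ℝ)| ^ 3 then 1 else 0) with hg
  have hgm : ∀ n, Measurable (g n) := fun n =>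
    ((hf.enorm.pow_const 2).const_mul _).mul (Measurable.ite
      (measurableSet_lt (by fun_prop) (by fun_prop)) measurable_const measurable_const)
  have h1 : ∀ n, ∫⁻ η, ‖nearAmp s f n η‖ₑ ^ 2 ≤ ENNReal.ofReal (2 * Real.pi) * ∫⁻ ξ, g n ξ := by
    intro n
    rw [← lintegral_comp_affine (g n) (hgm n) (quart n) (by positivity)]
    refine lintegral_mono fun η => ?_
    have e : 2 * Real.pi * ((quart n + η) / (2 * Real.pi)) - quart n = η := by
      field_simp; ring
    have hb := norm_nearAmp_le hs f n η
    simp only [hg]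
    rw [e]
    split_ifs at hb ⊢ with hη
    · rw [mul_one]
      calc ‖nearAmp s f n η‖ₑ ^ 2
          ≤ (ENNReal.ofReal (27 * ‖f ((quart n + η) / (2 * Real.pi))‖)) ^ 2 := by
            gcongr
            rw [← ofReal_norm]
            exact ENNReal.ofReal_le_ofReal hb
        _ = _ := by
            rw [ENNReal.ofReal_mul (by norm_num), mul_pow, ofReal_norm]
            norm_num
    · rw [norm_le_zero_iff.1 hb]
      simp
  refine (ENNReal.tsum_le_tsum h1).trans ?_
  rw [ENNReal.tsum_mul_left, ← lintegral_tsum fun n => (hgm n).aemeasurable]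
  have h2 : ∫⁻ ξ, ∑' n, g n ξ ≤ ∫⁻ ξ, 1458 * ‖f ξ‖ₑ ^ 2 := by
    refine lintegral_mono fun ξ => ?_
    simp only [hg]
    rw [ENNReal.tsum_mul_left]
    calc _ ≤ (729 * ‖f ξ‖ₑ ^ 2) * 2 := by gcongr; exact tsum_near_le ξ
      _ = _ := by ring_nf
  calc _ ≤ ENNReal.ofReal (2 * Real.pi) * ∫⁻ ξ, 1458 * ‖f ξ‖ₑ ^ 2 := by gcongr
    _ = _ := by
      rw [lintegral_const_mul _ (hf.enorm.pow_const 2), ← mul_assoc,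
        show (1458 : ℝ≥0∞) = ENNReal.ofReal 1458 by simp, ← ENNReal.ofReal_mul (by positivity)]
      congr 2; ring

/-- The resonant part of the Duhamel coefficient. -/
def nearPart (s : ℝ) (f : ℝ → ℂ) (n : ℤ) (t : ℝ) : ℂ :=
  osc n t * ∫ η, nearAmp s f n η * oscInt η t

/-- The substitution `η = 2πξ - (nπ)⁴` makes the time factor under the integral independent of `n`,
so that all modes can be superposed at a common `η`. -/
theorem nearPart_eq (s : ℝ) (f : ℝ → ℂ) (n : ℤ) (t : ℝ) :
    nearPart s f n t = (|(n : ℝ)| ^ s : ℝ) * ((n * Real.pi : ℂ)⁻¹ *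
      ∫ ξ in {ξ | |2 * Real.pi * ξ - quart n| < |(n : ℝ)| ^ 3}, duhamelIntegrand s f n t ξ) := by
  set N : Set ℝ := {ξ | |2 * Real.pi * ξ - quart n| < |(n : ℝ)| ^ 3}
  have hN : MeasurableSet N := measurableSet_lt (by fun_prop) (by fun_prop)
  rw [← integral_indicator hN]
  set G := N.indicator (duhamelIntegrand s f n t) with hG
  have h1 : ∫ η, G ((quart n + η) / (2 * Real.pi)) = (2 * Real.pi : ℂ) * ∫ ξ, G ξ := by
    have e1 := integral_add_left_eq_self (μ := volume) (fun η : ℝ => G (η / (2 * Real.pi))) (quart n)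
    have e2 := Measure.integral_comp_div G (2 * Real.pi)
    rw [e1, e2, abs_of_pos (by positivity), Complex.real_smul]
    push_cast
    ring
  have h2 : ∫ ξ, G ξ = (2 * Real.pi : ℂ)⁻¹ * ∫ η, G ((quart n + η) / (2 * Real.pi)) := by
    rw [h1, ← mul_assoc, inv_mul_cancel₀ (by simp [Real.pi_ne_zero]), one_mul]
  rw [h2, nearPart, ← integral_const_mul, ← integral_const_mul, ← integral_const_mul,
    ← integral_const_mul]
  refine integral_congr_ae (.of_forall fun η => ?_)
  have e : 2 * Real.pi * ((quart n + η) / (2 * Real.pi)) = quart n + η := by field_simp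
  simp only [hG, nearAmp, Set.indicator_apply, N, mem_ofPred_eq, duhamelIntegrand]
  simp only [e, add_sub_cancel_left]
  split_ifs
  · ring
  · simp

/-- The difference is the integral over the non-resonant set. There the factor `|η|` allowed by
`far_weight_le` is cancelled by `|η| * ‖oscInt η t‖ ≤ 2`, and Cauchy–Schwarz pairs `f` with the
remaining square integrable weight. -/
theorem exists_norm_sub_nearPart_le {s : ℝ} (hs : s ∈ Icc (0 : ℝ) 4) :
    ∃ C : ℝ≥0, ∀ (f : ℝ → ℂ) (M : ℝ≥0), Measurable f → ∫⁻ ξ, ‖f ξ‖ₑ ^ 2 = (M : ℝ≥0∞) ^ 2 →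
      ∀ (n : ℤ) (t : ℝ), 0 ≤ t →
        ‖(|(n : ℝ)| ^ s : ℝ) * duhamel s f n t - nearPart s f n t‖ ≤
          C * M * |(n : ℝ)| ^ (-(4 / 5) : ℝ) := by
  have hfin := lintegral_rpow_weight_lt_top (r := 11 / 40) (by norm_num)
  set I := ∫⁻ ξ : ℝ, ENNReal.ofReal ((1 + ξ ^ 2) ^ (-(11 / 40) : ℝ)) ^ 2 with hI
  refine ⟨1024 * NNReal.sqrt I.toNNReal, fun f M hf hM n t ht => ?_⟩
  have hf2 : ∫⁻ ξ, ‖f ξ‖ₑ ^ 2 < ⊤ := by rw [hM]; exact ENNReal.pow_lt_top ENNReal.coe_lt_top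
  -- The bound holds at `n = 0` because the inverse of zero and a negative real power of zero are
  -- both zero.
  by_cases hn : n = 0
  · subst hn
    simp [duhamel, nearPart, nearAmp, fun η : ℝ => not_lt.2 (abs_nonneg η)]
  have hν := one_le_abs_intCast hn
  have hν0 : 0 < |(n : ℝ)| := by linarith
  set N : Set ℝ := {ξ | |2 * Real.pi * ξ - quart n| < |(n : ℝ)| ^ 3} with hNdef
  have hN : MeasurableSet N := measurableSet_lt (by fun_prop) (by fun_prop)
  have hint := integrable_duhamelIntegrand hs.1 hf hf2 n ht
  rw [nearPart_eq, duhamel, ← integral_add_compl hN hint]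
  rw [← mul_sub, ← mul_sub, add_sub_cancel_left, ← integral_const_mul, ← integral_const_mul]
  set c : ℝ := 1024 * |(n : ℝ)| ^ (-(4 / 5) : ℝ) with hc
  have hc0 : 0 ≤ c := by positivity
  have hpt : ∀ ξ ∈ Nᶜ, ‖(((|(n : ℝ)| ^ s : ℝ) : ℂ) * ((n * Real.pi : ℂ)⁻¹ *
      duhamelIntegrand s f n t ξ))‖ ≤ c * ((1 + ξ ^ 2) ^ (-(11 / 40) : ℝ) * ‖f ξ‖) := by
    intro ξ hξ
    have hξ' : |(n : ℝ)| ^ 3 ≤ |2 * Real.pi * ξ - quart n| := not_lt.1 hξ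
    have hD0 : 0 < |2 * Real.pi * ξ - quart n| := lt_of_lt_of_le (by positivity) hξ'
    have hw := far_weight_le hs hν (ξ := ξ) (by rw [← quart_eq_abs]; exact hξ')
    rw [← quart_eq_abs] at hw
    have ho := abs_mul_norm_oscInt_le (2 * Real.pi * ξ - quart n) t
    have e2 : |(n : ℝ)| ^ (s - 1) = |(n : ℝ)| ^ s * |(n : ℝ)|⁻¹ := by
      rw [Real.rpow_sub hν0, Real.rpow_one, div_eq_mul_inv]
    have hb : besselWeight s ξ = (1 + ξ ^ 2) ^ (-(3 + s) / 8) := rfl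
    have hnorm : ‖(((|(n : ℝ)| ^ s : ℝ) : ℂ) * ((n * Real.pi : ℂ)⁻¹ *
      duhamelIntegrand s f n t ξ))‖ = (|(n : ℝ)| ^ (s - 1) * |2 * Real.pi * ξ| *
        (1 + ξ ^ 2) ^ (-(3 + s) / 8)) * (Real.pi⁻¹ * ‖f ξ‖ *
          ‖oscInt (2 * Real.pi * ξ - quart n) t‖) := by
      have e3 : |2 * Real.pi * ξ| = 2 * Real.pi * |ξ| := by
        rw [abs_mul, abs_of_pos (by positivity : 0 < 2 * Real.pi)]
      rw [← hb, e3]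
      simp only [duhamelIntegrand, norm_mul, norm_inv, Complex.norm_real, Complex.norm_intCast,
        Real.norm_eq_abs, abs_of_nonneg (besselWeight_nonneg s ξ), norm_osc]
      rw [e2, abs_of_nonneg (by positivity : 0 ≤ |(n : ℝ)| ^ s), abs_of_pos Real.pi_pos, mul_inv]
      ring
    rw [hnorm]
    calc _ ≤ (512 * Real.pi * |2 * Real.pi * ξ - quart n| *
          (|(n : ℝ)| ^ (-(4 / 5) : ℝ) * (1 + ξ ^ 2) ^ (-(11 / 40) : ℝ))) * (Real.pi⁻¹ * ‖f ξ‖ *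
          ‖oscInt (2 * Real.pi * ξ - quart n) t‖) := by gcongr
      _ = 512 * (|(n : ℝ)| ^ (-(4 / 5) : ℝ)) * ((1 + ξ ^ 2) ^ (-(11 / 40) : ℝ) * ‖f ξ‖) *
          (|2 * Real.pi * ξ - quart n| * ‖oscInt (2 * Real.pi * ξ - quart n) t‖) := by
        field_simp
      _ ≤ 512 * (|(n : ℝ)| ^ (-(4 / 5) : ℝ)) * ((1 + ξ ^ 2) ^ (-(11 / 40) : ℝ) * ‖f ξ‖) * 2 := by
        gcongr
      _ = _ := by rw [hc]; ring
  have hcs : ∫⁻ ξ : ℝ, ENNReal.ofReal ((1 + ξ ^ 2) ^ (-(11 / 40) : ℝ)) * ‖f ξ‖ₑ ≤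
      ((NNReal.sqrt I.toNNReal * M : ℝ≥0) : ℝ≥0∞) := by
    have h := sq_lintegral_mul_le (μ := volume) (f := fun ξ : ℝ =>
      ENNReal.ofReal ((1 + ξ ^ 2) ^ (-(11 / 40) : ℝ))) (g := fun ξ => ‖f ξ‖ₑ)
      (continuous_rpow_weight _).measurable.ennreal_ofReal.aemeasurable hf.enorm.aemeasurable
    rw [← hI, hM] at h
    refine (ENNReal.pow_right_strictMono two_ne_zero).le_iff_le.1 (h.trans (le_of_eq ?_))
    rw [ENNReal.coe_mul, mul_pow, ← ENNReal.coe_pow (NNReal.sqrt _), NNReal.sq_sqrt,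
      ENNReal.coe_toNNReal hfin.ne]
  have hfinal : ‖∫ ξ in Nᶜ, (((|(n : ℝ)| ^ s : ℝ) : ℂ) * ((n * Real.pi : ℂ)⁻¹ *
      duhamelIntegrand s f n t ξ))‖ₑ ≤
      ENNReal.ofReal c * ((NNReal.sqrt I.toNNReal * M : ℝ≥0) : ℝ≥0∞) := by
    refine (enorm_integral_le_lintegral_enorm _).trans ?_
    calc _ ≤ ∫⁻ ξ in Nᶜ, ENNReal.ofReal c *
          (ENNReal.ofReal ((1 + ξ ^ 2) ^ (-(11 / 40) : ℝ)) * ‖f ξ‖ₑ) := by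
          refine setLIntegral_mono' hN.compl fun ξ hξ => ?_
          rw [← ofReal_norm, ← ofReal_norm, ← ENNReal.ofReal_mul (by positivity),
            ← ENNReal.ofReal_mul hc0]
          exact ENNReal.ofReal_le_ofReal (hpt ξ hξ)
      _ ≤ ∫⁻ ξ, ENNReal.ofReal c *
          (ENNReal.ofReal ((1 + ξ ^ 2) ^ (-(11 / 40) : ℝ)) * ‖f ξ‖ₑ) :=
          setLIntegral_le_lintegral _ _
      _ ≤ _ := by
          rw [lintegral_const_mul' _ _ ENNReal.ofReal_ne_top]
          gcongr
  rw [← ENNReal.ofReal_coe_nnreal, ← ENNReal.ofReal_mul hc0, ← ofReal_norm,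
    ENNReal.ofReal_le_ofReal_iff (by positivity)] at hfinal
  refine hfinal.trans (le_of_eq ?_)
  rw [hc]
  push_cast
  ring

/-! ### The main estimate for the Duhamel coefficients -/

/-- Lebesgue measure on `(0,2] × (0,T)`. -/
def cell (T : ℝ) : Measure (ℝ × ℝ) :=
  (volume.restrict (Ioc (0 : ℝ) 2)).prod (volume.restrict (Ioo 0 T))

instance sFinite_cell (T : ℝ) : SFinite (cell T) := by
  unfold cell; infer_instance

theorem ae_cell_snd_mem (T : ℝ) : ∀ᵐ z ∂(cell T), z.2 ∈ Ioo 0 T :=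
  Measure.quasiMeasurePreserving_snd.ae (ae_restrict_mem measurableSet_Ioo)

theorem lintegral_scaled_decay_sq {T : ℝ} (hT : 0 < T) :
    ∫⁻ η, ENNReal.ofReal ((T + 2) * decay η) ^ 2 = ENNReal.ofReal ((T + 2) ^ 2 * Real.pi) := by
  simp_rw [ENNReal.ofReal_mul (by linarith : 0 ≤ T + 2), mul_pow]
  rw [lintegral_const_mul' _ _ (by simp), lintegral_decay_sq,
    ENNReal.ofReal_mul (by positivity), ENNReal.ofReal_pow (by linarith)]

theorem enorm_oscInt_le_decay (η : ℝ) {t T : ℝ} (ht : 0 ≤ t) (htT : t ≤ T) :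
    ‖oscInt η t‖ₑ ≤ ENNReal.ofReal ((T + 2) * decay η) := by
  rw [← ofReal_norm]
  exact ENNReal.ofReal_le_ofReal (norm_oscInt_le_decay η ht htT)

theorem measurable_scaled_decay (T : ℝ) :
    Measurable fun η => ENNReal.ofReal ((T + 2) * decay η) :=
  (continuous_decay.measurable.const_mul _).ennreal_ofReal

theorem sq_lintegral_decay_nearAmp_le {T : ℝ} (hT : 0 < T) (s : ℝ) {f : ℝ → ℂ} (hf : Measurable f)
    (n : ℤ) : (∫⁻ η, ENNReal.ofReal ((T + 2) * decay η) * ‖nearAmp s f n η‖ₑ) ^ 2 ≤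
      ENNReal.ofReal ((T + 2) ^ 2 * Real.pi) * ∫⁻ η, ‖nearAmp s f n η‖ₑ ^ 2 := by
  rw [← lintegral_scaled_decay_sq hT]
  exact sq_lintegral_mul_le (measurable_scaled_decay T).aemeasurable
    (measurable_nearAmp s hf n).enorm.aemeasurable

theorem lintegral_nearAmp_mul_oscInt_le {T : ℝ} (s : ℝ) (f : ℝ → ℂ) (n : ℤ)
    {t : ℝ} (ht : t ∈ Icc 0 T) : ∫⁻ η, ‖nearAmp s f n η * oscInt η t‖ₑ ≤
      ∫⁻ η, ENNReal.ofReal ((T + 2) * decay η) * ‖nearAmp s f n η‖ₑ := by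
  refine lintegral_mono fun η => ?_
  rw [enorm_mul, mul_comm]
  gcongr
  exact enorm_oscInt_le_decay η ht.1 ht.2

theorem enorm_nearPart_sq_le {T : ℝ} (hT : 0 < T) (s : ℝ) {f : ℝ → ℂ} (hf : Measurable f)
    (n : ℤ) {t : ℝ} (ht : t ∈ Icc 0 T) : ‖nearPart s f n t‖ₑ ^ 2 ≤
      ENNReal.ofReal ((T + 2) ^ 2 * Real.pi) * ∫⁻ η, ‖nearAmp s f n η‖ₑ ^ 2 := by
  refine le_trans ?_ (sq_lintegral_decay_nearAmp_le hT s hf n)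
  gcongr
  rw [nearPart, enorm_mul, ← ofReal_norm, norm_osc, ENNReal.ofReal_one, one_mul]
  exact (enorm_integral_le_lintegral_enorm _).trans (lintegral_nearAmp_mul_oscInt_le s f n ht)

theorem integrable_nearAmp_mul_oscInt {T : ℝ} (hT : 0 < T) (s : ℝ) {f : ℝ → ℂ}
    (hf : Measurable f) (n : ℤ) (hfin : ∫⁻ η, ‖nearAmp s f n η‖ₑ ^ 2 < ⊤)
    {t : ℝ} (ht : t ∈ Icc 0 T) : Integrable fun η => nearAmp s f n η * oscInt η t := by
  have hc : Continuous fun η => oscInt η t :=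
    continuous_oscInt.comp (by fun_prop : Continuous fun η : ℝ => (η, t))
  refine ⟨((measurable_nearAmp s hf n).mul hc.measurable).aestronglyMeasurable, ?_⟩
  refine lt_of_le_of_lt (lintegral_nearAmp_mul_oscInt_le s f n ht) ?_
  have h := (sq_lintegral_decay_nearAmp_le hT s hf n).trans_lt
    (ENNReal.mul_lt_top ENNReal.ofReal_lt_top hfin)
  exact (ENNReal.pow_lt_top_iff.1 h).resolve_right two_ne_zero

/-- The sum is an integral over `η` of `oscInt η t` times a free solution with data `b n * nearAmp s
f n η`. Minkowski takes the `L⁴` norm inside, Strichartz bounds it for each `η` by an `ℓ²` norm in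
`n`, and Cauchy–Schwarz against the decay in `η` leaves the sum of the `L²` norms of the amplitudes.
-/
theorem exists_lintegral_nearPart_sum_le {T : ℝ} (hT : 0 < T) : ∃ C : ℝ≥0,
    ∀ (s : ℝ) (f : ℝ → ℂ), Measurable f → (∀ n, ∫⁻ η, ‖nearAmp s f n η‖ₑ ^ 2 < ⊤) →
      ∀ (S : Finset ℤ) (b : ℤ → ℂ), (∀ n, ‖b n‖ ≤ 1) →
        ∫⁻ z, ‖∑ n ∈ S, b n * nearPart s f n z.2 * expo n z.1‖ₑ ^ 4 ∂(cell T) ≤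
          C * (∑ n ∈ S, ∫⁻ η, ‖nearAmp s f n η‖ₑ ^ 2) ^ 2 := by
  obtain ⟨C, hC⟩ := exists_lintegral_strichartz_le T
  refine ⟨((T + 2) ^ 2 * Real.pi).toNNReal ^ 2 * C, fun s f hf hfin S b hb => ?_⟩
  have hbe : ∀ n, ‖b n‖ₑ ≤ 1 := fun n => by
    rw [← ofReal_norm, ← ENNReal.ofReal_one]
    exact ENNReal.ofReal_le_ofReal (hb n)
  set D : ℝ → ℝ≥0∞ := fun η => ENNReal.ofReal ((T + 2) * decay η) with hD
  have hDm : Measurable D := measurable_scaled_decay T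
  set F : ℝ → ℝ × ℝ → ℝ≥0∞ := fun η z =>
    D η * ‖∑ n ∈ S, (b n * nearAmp s f n η) * (expo n z.1 * osc n z.2)‖ₑ with hF
  -- `Q η` is the fourth root of the Strichartz bound at modulation `η`; its square is linear in the
  -- energy, which suits Cauchy–Schwarz.
  set Q : ℝ → ℝ≥0∞ := fun η =>
    (C : ℝ≥0∞) ^ (1 / 4 : ℝ) * (∑ n ∈ S, ‖nearAmp s f n η‖ₑ ^ 2) ^ (1 / 2 : ℝ) with hQ
  have hQm : Measurable Q := by
    refine Measurable.const_mul (Measurable.pow_const ?_ _) _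
    exact Finset.measurable_fun_sum _ fun n _ => (measurable_nearAmp s hf n).enorm.pow_const _
  have hQ2 : ∀ η, Q η ^ 2 = (C : ℝ≥0∞) ^ (1 / 2 : ℝ) * ∑ n ∈ S, ‖nearAmp s f n η‖ₑ ^ 2 := by
    intro η
    simp only [hQ, mul_pow]
    rw [← ENNReal.rpow_natCast, ← ENNReal.rpow_natCast, ← ENNReal.rpow_mul, ← ENNReal.rpow_mul]
    norm_num
  have hCsq : ((C : ℝ≥0∞) ^ (1 / 2 : ℝ)) ^ 2 = C := by
    rw [← ENNReal.rpow_natCast, ← ENNReal.rpow_mul]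
    norm_num
  have hQ4 : ∀ η, Q η ^ 4 = C * (∑ n ∈ S, ‖nearAmp s f n η‖ₑ ^ 2) ^ 2 := by
    intro η
    rw [show 4 = 2 * 2 by norm_num, pow_mul, hQ2, mul_pow, hCsq]
  have hFm : Measurable (Function.uncurry F) := by
    refine (hDm.comp measurable_fst).mul (Measurable.enorm ?_)
    refine Finset.measurable_fun_sum _ fun n _ => ?_
    refine (((measurable_nearAmp s hf n).comp measurable_fst).const_mul _).mul ?_
    exact Continuous.measurable (by fun_prop)
  have hmink := lintegral_lintegral_pow_le (μ := volume) (ν := cell T) 3 (by norm_num) hFm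
    (hDm.mul hQm) (A := fun η => D η * Q η) (fun η => by
      refine ENNReal.mul_ne_top ENNReal.ofReal_ne_top (ENNReal.mul_ne_top ?_ ?_)
      · exact ENNReal.rpow_ne_top_of_nonneg (by norm_num) ENNReal.coe_ne_top
      · refine ENNReal.rpow_ne_top_of_nonneg (by norm_num) ?_
        exact (ENNReal.sum_lt_top.2 fun n _ => ENNReal.pow_lt_top enorm_lt_top).ne) (fun η => by
      simp only [hF]
      simp_rw [mul_pow]
      rw [lintegral_const_mul' _ _ (ENNReal.pow_ne_top ENNReal.ofReal_ne_top)]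
      gcongr
      rw [hQ4]
      refine (hC S _).trans ?_
      gcongr with n hn
      rw [enorm_mul]
      exact mul_le_of_le_one_left' (hbe n))
  have hpt : ∀ᵐ z ∂(cell T), ‖∑ n ∈ S, b n * nearPart s f n z.2 * expo n z.1‖ₑ ^ 4 ≤
      (∫⁻ η, F η z) ^ (3 + 1) := by
    refine (ae_cell_snd_mem T).mono fun z hz => ?_
    have hz' : z.2 ∈ Icc 0 T := ⟨hz.1.le, hz.2.le⟩
    gcongr
    have e : ∑ n ∈ S, b n * nearPart s f n z.2 * expo n z.1 =
        ∫ η, oscInt η z.2 * ∑ n ∈ S, (b n * nearAmp s f n η) * (expo n z.1 * osc n z.2) := by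
      simp_rw [Finset.mul_sum]
      rw [integral_finsetSum]
      · refine Finset.sum_congr rfl fun n _ => ?_
        rw [nearPart, mul_assoc, mul_assoc, mul_comm _ (expo n z.1), ← mul_assoc, ← mul_assoc,
          ← integral_const_mul]
        refine integral_congr_ae (.of_forall fun η => ?_)
        ring
      · intro n _
        refine ((integrable_nearAmp_mul_oscInt hT s hf n (hfin n) hz').const_mul
          (b n * (expo n z.1 * osc n z.2))).congr (.of_forall fun η => ?_)
        ring
    rw [e]
    refine (enorm_integral_le_lintegral_enorm _).trans (lintegral_mono fun η => ?_)
    rw [enorm_mul]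
    simp only [hF]
    gcongr
    exact enorm_oscInt_le_decay η hz'.1 hz'.2
  refine (lintegral_mono_ae hpt).trans (hmink.trans ?_)
  have hcs := sq_lintegral_mul_le (μ := volume) hDm.aemeasurable hQm.aemeasurable
  rw [lintegral_scaled_decay_sq hT] at hcs
  simp_rw [hQ2] at hcs
  rw [lintegral_const_mul' _ _ (ENNReal.rpow_ne_top_of_nonneg (by norm_num) ENNReal.coe_ne_top),
    lintegral_finsetSum _ fun n _ => (measurable_nearAmp s hf n).enorm.pow_const _] at hcs
  have h4 := pow_le_pow_left' hcs 2
  rw [← pow_mul, mul_pow, mul_pow, hCsq] at h4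
  refine h4.trans (le_of_eq ?_)
  rw [ENNReal.ofReal]
  push_cast
  ring

/-- Hausdorff–Young in `x` at each fixed time, with no use of oscillation in `t`. With weights
`K^{1/3}|n|^{-4/15}` the cube is the assumed bound and the fourth power carries the summable
`|n|^{-16/15}`. -/
theorem lintegral_cell_le_of_norm_le {T : ℝ} (S : Finset ℤ) (c : ℤ → ℝ → ℂ)
    (hcm : ∀ n, AEStronglyMeasurable (c n) (volume.restrict (Ioo 0 T))) {K : ℝ} (hK : 0 ≤ K)
    (hc : ∀ n, ∀ t ∈ Ioo 0 T, ‖c n t‖ ≤ K * |(n : ℝ)| ^ (-(4 / 5) : ℝ)) :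
    ∫⁻ z, ‖∑ n ∈ S, c n z.2 * expo n z.1‖ₑ ^ 4 ∂(cell T) ≤
      ENNReal.ofReal (2 * T * K ^ 4 * (∑ n ∈ S, |(n : ℝ)| ^ (-(16 / 15) : ℝ)) ^ 3) := by
  have hm : AEStronglyMeasurable (fun z : ℝ × ℝ => ∑ n ∈ S, c n z.2 * expo n z.1) (cell T) := by
    refine Finset.aestronglyMeasurable_fun_sum _ fun n _ => ?_
    refine ((hcm n).comp_snd).mul ?_
    exact Continuous.aestronglyMeasurable (by fun_prop)
  rw [cell, lintegral_prod_symm _ (by exact hm.enorm.pow_const 4)]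
  have hw : ∀ t ∈ Ioo 0 T, ∫⁻ x in Ioc (0 : ℝ) 2, ‖∑ n ∈ S, c n t * expo n x‖ₑ ^ 4 ≤
      ENNReal.ofReal (2 * (K ^ (4 / 3 : ℝ) * ∑ n ∈ S, |(n : ℝ)| ^ (-(16 / 15) : ℝ)) ^ 3) := by
    intro t ht
    refine (lintegral_expo_sum_le S (fun n => c n t)
      (fun n => K ^ (1 / 3 : ℝ) * |(n : ℝ)| ^ (-(4 / 15) : ℝ)) (fun n => by positivity) ?_).trans
      (le_of_eq ?_)
    · intro n
      refine (hc n t ht).trans (le_of_eq ?_)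
      rw [mul_pow, ← Real.rpow_natCast, ← Real.rpow_natCast, ← Real.rpow_mul hK,
        ← Real.rpow_mul (abs_nonneg _)]
      norm_num
    · congr 3
      rw [Finset.mul_sum]
      refine Finset.sum_congr rfl fun n _ => ?_
      rw [mul_pow, ← Real.rpow_natCast, ← Real.rpow_natCast, ← Real.rpow_mul hK,
        ← Real.rpow_mul (abs_nonneg _)]
      norm_num
  refine (setLIntegral_mono' measurableSet_Ioo hw).trans (le_of_eq ?_)
  rw [lintegral_const, Measure.restrict_apply_univ, Real.volume_Ioo, sub_zero,
    ← ENNReal.ofReal_mul (by positivity)]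
  congr 1
  have : (K ^ (4 / 3 : ℝ)) ^ 3 = K ^ 4 := by
    rw [← Real.rpow_natCast, ← Real.rpow_mul hK, ← Real.rpow_natCast]
    norm_num
  rw [mul_pow, this]
  ring

/-! ### Coefficients with the boundary lift removed -/

/-- The coefficients of the solution after removal of the boundary lift. -/
def bdryCoeff (s : ℝ) (f : ℝ → ℂ) (n : ℤ) (t : ℝ) : ℂ :=
  duhamel s f n t +
    (Complex.I * (n * Real.pi))⁻¹ * (osc n t * ∫ ξ, (besselWeight s ξ : ℂ) * f ξ)

theorem continuousOn_bdryCoeff {s : ℝ} (hs : 0 ≤ s) {f : ℝ → ℂ} (hf : Measurable f)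
    (hf2 : ∫⁻ ξ, ‖f ξ‖ₑ ^ 2 < ⊤) (n : ℤ) (T : ℝ) :
    ContinuousOn (bdryCoeff s f n) (Icc 0 T) := by
  unfold bdryCoeff
  refine (continuousOn_duhamel hs hf hf2 n T).add (Continuous.continuousOn ?_)
  fun_prop

theorem stronglyMeasurable_nearPart (s : ℝ) {f : ℝ → ℂ} (hf : Measurable f) (n : ℤ) :
    StronglyMeasurable (nearPart s f n) := by
  unfold nearPart
  refine (continuous_osc n).stronglyMeasurable.mul ?_
  refine StronglyMeasurable.integral_prod_right
    (f := fun t η => nearAmp s f n η * oscInt η t) ?_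
  refine Measurable.stronglyMeasurable ?_
  exact ((measurable_nearAmp s hf n).comp measurable_snd).mul
    (continuous_oscInt.comp continuous_swap).measurable

/-- Cauchy–Schwarz against the square integrable weight. It controls `h(0)` and, through `traceFun`,
the supremum of the boundary datum. -/
theorem exists_norm_integral_besselWeight_le {s : ℝ} (hs : 0 ≤ s) :
    ∃ C : ℝ≥0, ∀ (f : ℝ → ℂ) (M : ℝ≥0), Measurable f → ∫⁻ ξ, ‖f ξ‖ₑ ^ 2 = (M : ℝ≥0∞) ^ 2 →
      ∫⁻ ξ, ‖(besselWeight s ξ : ℂ) * f ξ‖ₑ ≤ C * M := by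
  have hfin := lintegral_besselWeight_lt_top hs
  set I := ∫⁻ ξ : ℝ, ENNReal.ofReal (besselWeight s ξ) ^ 2 with hI
  refine ⟨NNReal.sqrt I.toNNReal, fun f M hf hM => ?_⟩
  have h := sq_lintegral_mul_le (μ := volume) (f := fun ξ : ℝ => ENNReal.ofReal (besselWeight s ξ))
    (g := fun ξ => ‖f ξ‖ₑ) (continuous_besselWeight s).measurable.ennreal_ofReal.aemeasurable
    hf.enorm.aemeasurable
  rw [← hI, hM] at h
  have e : ∀ ξ, ‖(besselWeight s ξ : ℂ) * f ξ‖ₑ = ENNReal.ofReal (besselWeight s ξ) * ‖f ξ‖ₑ := by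
    intro ξ
    rw [enorm_mul, ← ofReal_norm, Complex.norm_real, Real.norm_of_nonneg (besselWeight_nonneg s ξ)]
  simp_rw [e]
  refine (ENNReal.pow_right_strictMono two_ne_zero).le_iff_le.1 (h.trans (le_of_eq ?_))
  rw [mul_pow, ← ENNReal.coe_pow (NNReal.sqrt _), NNReal.sq_sqrt, ENNReal.coe_toNNReal hfin.ne]

theorem ENNReal.add_pow_le_two_pow_mul (a b : ℝ≥0∞) (k : ℕ) :
    (a + b) ^ k ≤ 2 ^ k * (a ^ k + b ^ k) := by
  have h : a + b ≤ 2 * max a b := by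
    rw [two_mul]; exact add_le_add (le_max_left _ _) (le_max_right _ _)
  refine (pow_le_pow_left' h k).trans ?_
  rw [mul_pow]
  gcongr
  rcases le_total a b with h | h
  · rw [max_eq_right h]; exact le_add_self
  · rw [max_eq_left h]; exact le_self_add

theorem abs_inv_le_rpow (n : ℤ) : |(n : ℝ)|⁻¹ ≤ |(n : ℝ)| ^ (-(4 / 5) : ℝ) := by
  by_cases hn : n = 0
  · subst hn; simp
  · rw [← Real.rpow_neg_one]
    exact Real.rpow_le_rpow_of_exponent_le (one_le_abs_intCast hn) (by norm_num)

/-- The same convergent sum of `|n|^{-16/15}` thus serves the `ℓ²` bound and the `ℓ^{4/3}` bound. -/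
theorem sq_rpow_le_rpow (n : ℤ) :
    (|(n : ℝ)| ^ (-(4 / 5) : ℝ)) ^ 2 ≤ |(n : ℝ)| ^ (-(16 / 15) : ℝ) := by
  by_cases hn : n = 0
  · subst hn
    rw [Int.cast_zero, abs_zero, Real.zero_rpow (by norm_num), Real.zero_rpow (by norm_num)]
    norm_num
  · rw [← Real.rpow_natCast, ← Real.rpow_mul (abs_nonneg _)]
    exact Real.rpow_le_rpow_of_exponent_le (one_le_abs_intCast hn) (by norm_num)

/-- This is where compatibility at time zero enters: the `h(0)` term has size `|n|^{s-1}`, which is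
dominated by `|n|^{-4/5}` when `s = 0`; for larger `s` it is removed by `h(0) = 0`. -/
theorem exists_norm_bdryCoeff_sub_le {s : ℝ} (hs : s ∈ Icc (0 : ℝ) 4) :
    ∃ C : ℝ≥0, ∀ (f : ℝ → ℂ) (M : ℝ≥0), Measurable f → ∫⁻ ξ, ‖f ξ‖ₑ ^ 2 = (M : ℝ≥0∞) ^ 2 →
      (∫ ξ, (besselWeight s ξ : ℂ) * f ξ = 0 ∨ s = 0) → ∀ (n : ℤ) (t : ℝ), 0 ≤ t →
        ‖(|(n : ℝ)| ^ s : ℝ) * bdryCoeff s f n t - nearPart s f n t‖ ≤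
          C * M * |(n : ℝ)| ^ (-(4 / 5) : ℝ) := by
  obtain ⟨C₁, hC₁⟩ := exists_norm_sub_nearPart_le hs
  obtain ⟨C₂, hC₂⟩ := exists_norm_integral_besselWeight_le hs.1
  refine ⟨C₁ + C₂, fun f M hf hM h0 n t ht => ?_⟩
  set H := ∫ ξ, (besselWeight s ξ : ℂ) * f ξ with hH
  have hHle : ‖H‖ ≤ C₂ * M := by
    have := (enorm_integral_le_lintegral_enorm _).trans (hC₂ f M hf hM)
    rw [← hH, ← ofReal_norm, ← ENNReal.coe_mul, ← ENNReal.ofReal_coe_nnreal,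
      ENNReal.ofReal_le_ofReal_iff (by positivity)] at this
    exact_mod_cast this
  have hextra : ‖((|(n : ℝ)| ^ s : ℝ) : ℂ) * ((Complex.I * (n * Real.pi))⁻¹ * (osc n t * H))‖ ≤
      C₂ * M * |(n : ℝ)| ^ (-(4 / 5) : ℝ) := by
    rcases h0 with h0 | h0
    · rw [h0]; simp; positivity
    · rw [h0, Real.rpow_zero]
      simp only [norm_mul, norm_inv, Complex.norm_real, Complex.norm_intCast, norm_osc,
        Complex.norm_I, norm_one, one_mul, Real.norm_eq_abs, abs_of_pos Real.pi_pos, mul_inv]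
      have hπ : Real.pi⁻¹ ≤ 1 := inv_le_one_of_one_le₀ (by linarith [Real.pi_gt_three])
      calc _ = |(n : ℝ)|⁻¹ * Real.pi⁻¹ * ‖H‖ := by norm_num
        _ ≤ |(n : ℝ)| ^ (-(4 / 5) : ℝ) * 1 * (C₂ * M) := by
            gcongr; exact abs_inv_le_rpow n
        _ = _ := by ring
  calc _ = ‖((|(n : ℝ)| ^ s : ℝ) * duhamel s f n t - nearPart s f n t) +
        ((|(n : ℝ)| ^ s : ℝ) : ℂ) * ((Complex.I * (n * Real.pi))⁻¹ * (osc n t * H))‖ := by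
        rw [bdryCoeff, ← hH]; congr 1; ring
    _ ≤ C₁ * M * |(n : ℝ)| ^ (-(4 / 5) : ℝ) + C₂ * M * |(n : ℝ)| ^ (-(4 / 5) : ℝ) :=
        (norm_add_le _ _).trans (add_le_add (hC₁ f M hf hM n t ht) hextra)
    _ = _ := by push_cast; ring

/-- The energy and Strichartz bounds for the coefficients. -/
theorem exists_bdryCoeff_bounds {T s : ℝ} (hT : 0 < T) (hs : s ∈ Icc (0 : ℝ) 4) :
    ∃ C : ℝ≥0, ∀ (f : ℝ → ℂ) (M : ℝ≥0), Measurable f → ∫⁻ ξ, ‖f ξ‖ₑ ^ 2 = (M : ℝ≥0∞) ^ 2 →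
      (∫ ξ, (besselWeight s ξ : ℂ) * f ξ = 0 ∨ s = 0) → ∃ e : ℤ → ℝ≥0∞,
        ∑' n, e n ≤ C * (M : ℝ≥0∞) ^ 2 ∧
        (∀ n : ℤ, ∀ t ∈ Icc 0 T, ‖((|(n : ℝ)| ^ s : ℝ) : ℂ) * bdryCoeff s f n t‖ₑ ^ 2 ≤ e n) ∧
        ∀ (S : Finset ℤ) (b : ℤ → ℂ), (∀ n, ‖b n‖ ≤ 1) →
          ∫⁻ z, ‖∑ n ∈ S, b n * (((|(n : ℝ)| ^ s : ℝ) : ℂ) * bdryCoeff s f n z.2) *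
            expo n z.1‖ₑ ^ 4 ∂(cell T) ≤ C * (∑ n ∈ S, e n) ^ 2 := by
  obtain ⟨C₁, hC₁⟩ := exists_norm_bdryCoeff_sub_le hs
  obtain ⟨C₂, hC₂⟩ := exists_lintegral_nearPart_sum_le hT
  have hsum : Summable fun n : ℤ => |(n : ℝ)| ^ (-(16 / 15) : ℝ) :=
    Real.summable_abs_int_rpow (by norm_num)
  set Z := ∑' n : ℤ, |(n : ℝ)| ^ (-(16 / 15) : ℝ) with hZ
  have hZ0 : 0 ≤ Z := tsum_nonneg fun n => by positivity
  set P : ℝ := (T + 2) ^ 2 * Real.pi with hP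
  have hP1 : 1 ≤ P := by nlinarith [Real.pi_gt_three]
  set A₁ : ℝ≥0∞ := 4 * (ENNReal.ofReal P * ENNReal.ofReal (2916 * Real.pi)) +
    4 * ENNReal.ofReal (C₁ ^ 2 * Z) with hA₁
  set A₂ : ℝ≥0∞ := 2 ^ 4 * (C₂ + ENNReal.ofReal (2 * T * Z)) with hA₂
  have hA₁t : A₁ ≠ ⊤ := by simp [hA₁, ENNReal.mul_eq_top]
  have hA₂t : A₂ ≠ ⊤ := by simp [hA₂, ENNReal.mul_eq_top]
  refine ⟨max A₁.toNNReal A₂.toNNReal, fun f M hf hM h0 => ?_⟩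
  have hM2 : ∫⁻ ξ, ‖f ξ‖ₑ ^ 2 < ⊤ := by rw [hM]; exact ENNReal.pow_lt_top ENNReal.coe_lt_top
  set d : ℤ → ℝ≥0∞ := fun n => ∫⁻ η, ‖nearAmp s f n η‖ₑ ^ 2 with hd
  have hdsum : ∑' n, d n ≤ ENNReal.ofReal (2916 * Real.pi) * (M : ℝ≥0∞) ^ 2 := by
    rw [← hM]; exact tsum_lintegral_nearAmp_le hs hf
  have hdfin : ∀ n, d n < ⊤ := fun n =>
    (ENNReal.le_tsum n).trans_lt (hdsum.trans_lt
      (ENNReal.mul_lt_top ENNReal.ofReal_lt_top (ENNReal.pow_lt_top ENNReal.coe_lt_top)))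
  set K : ℝ := C₁ * M with hK
  have hK0 : 0 ≤ K := by positivity
  set r : ℤ → ℝ → ℂ := fun n t =>
    ((|(n : ℝ)| ^ s : ℝ) : ℂ) * bdryCoeff s f n t - nearPart s f n t with hr
  have hrle : ∀ n t, 0 ≤ t → ‖r n t‖ ≤ K * |(n : ℝ)| ^ (-(4 / 5) : ℝ) := hC₁ f M hf hM h0
  set w : ℤ → ℝ := fun n => |(n : ℝ)| ^ (-(16 / 15) : ℝ) with hw
  have hw0 : ∀ n, 0 ≤ w n := fun n => by positivity
  -- The two summands majorise the squares of the resonant part and of the remainder, the factor 4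
  -- coming from the square of a sum. Both are summable in `n`, independently of `t`.
  refine ⟨fun n => 4 * (ENNReal.ofReal P * d n) + 4 * ENNReal.ofReal (K ^ 2 * w n), ?_, ?_, ?_⟩
  · calc _ ≤ A₁ * (M : ℝ≥0∞) ^ 2 := by
          rw [ENNReal.tsum_add, ENNReal.tsum_mul_left, ENNReal.tsum_mul_left,
            ENNReal.tsum_mul_left, ← ENNReal.ofReal_tsum_of_nonneg (fun n => by positivity)
              (hsum.mul_left _), tsum_mul_left, ← hZ, hA₁, add_mul]
          gcongr ?_ + ?_
          · rw [mul_assoc, mul_assoc]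
            gcongr
          · rw [mul_assoc]
            gcongr
            rw [hK, mul_pow, mul_right_comm, ENNReal.ofReal_mul (by positivity),
              ENNReal.ofReal_pow (by positivity), ENNReal.ofReal_coe_nnreal]
      _ ≤ _ := by
          gcongr
          rw [ENNReal.coe_max, ENNReal.coe_toNNReal hA₁t]
          exact le_max_left _ _
  · intro n t ht
    have e1 : ((|(n : ℝ)| ^ s : ℝ) : ℂ) * bdryCoeff s f n t = nearPart s f n t + r n t := by
      simp only [hr]; ring
    rw [e1]
    calc _ ≤ (‖nearPart s f n t‖ₑ + ‖r n t‖ₑ) ^ 2 := by gcongr; exact enorm_add_le _ _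
      _ ≤ 2 ^ 2 * (‖nearPart s f n t‖ₑ ^ 2 + ‖r n t‖ₑ ^ 2) := ENNReal.add_pow_le_two_pow_mul _ _ _
      _ ≤ 2 ^ 2 * (ENNReal.ofReal P * d n + ENNReal.ofReal (K ^ 2 * w n)) := by
          gcongr
          · exact enorm_nearPart_sq_le hT s hf n ht
          · rw [← ofReal_norm, ← ENNReal.ofReal_pow (norm_nonneg _)]
            refine ENNReal.ofReal_le_ofReal ?_
            calc ‖r n t‖ ^ 2 ≤ (K * |(n : ℝ)| ^ (-(4 / 5) : ℝ)) ^ 2 :=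
                  pow_le_pow_left₀ (norm_nonneg _) (hrle n t ht.1) 2
              _ ≤ _ := by
                  rw [mul_pow]; gcongr; exact sq_rpow_le_rpow n
      _ = _ := by ring
  · intro S b hb
    have hcont : ∀ n, AEStronglyMeasurable (r n) (volume.restrict (Ioo 0 T)) := by
      intro n
      refine AEStronglyMeasurable.sub ?_ (stronglyMeasurable_nearPart s hf n).aestronglyMeasurable
      refine (((continuousOn_bdryCoeff hs.1 hf hM2 n T).mono
        Ioo_subset_Icc_self).aestronglyMeasurable measurableSet_Ioo).const_mul _
    have hfar := lintegral_cell_le_of_norm_le (T := T) S (fun n t => b n * r n t)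
      (fun n => (hcont n).const_mul _) hK0 (fun n t ht => by
        rw [norm_mul]
        exact (mul_le_of_le_one_left (norm_nonneg _) (hb n)).trans (hrle n t ht.1.le))
    have hnear := hC₂ s f hf hdfin S b hb
    set g₁ : ℝ × ℝ → ℂ := fun z => ∑ n ∈ S, b n * nearPart s f n z.2 * expo n z.1 with hg₁
    set g₂ : ℝ × ℝ → ℂ := fun z => ∑ n ∈ S, b n * r n z.2 * expo n z.1 with hg₂
    have hg₂m : AEStronglyMeasurable g₂ (cell T) := by
      refine Finset.aestronglyMeasurable_fun_sum _ fun n _ => ?_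
      refine (((hcont n).const_mul _).comp_snd).mul ?_
      exact Continuous.aestronglyMeasurable (by fun_prop)
    have hSZ : ∑ n ∈ S, w n ≤ Z := hsum.sum_le_tsum S fun n _ => hw0 n
    have hS0 : 0 ≤ ∑ n ∈ S, w n := Finset.sum_nonneg fun n _ => hw0 n
    set E := ∑ n ∈ S, (4 * (ENNReal.ofReal P * d n) + 4 * ENNReal.ofReal (K ^ 2 * w n)) with hE
    have hE1 : ∑ n ∈ S, d n ≤ E := by
      rw [hE]
      gcongr with n hn
      have h1 : (1 : ℝ≥0∞) ≤ 4 * ENNReal.ofReal P := by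
        have : (1 : ℝ≥0∞) ≤ ENNReal.ofReal P := by
          rw [← ENNReal.ofReal_one]; exact ENNReal.ofReal_le_ofReal hP1
        calc (1 : ℝ≥0∞) = 1 * 1 := by simp
          _ ≤ 4 * ENNReal.ofReal P := by gcongr; norm_num
      calc d n ≤ (4 * ENNReal.ofReal P) * d n := le_mul_of_one_le_left' h1
        _ ≤ _ := by rw [mul_assoc]; exact le_self_add
    have hE2 : ENNReal.ofReal (K ^ 2 * ∑ n ∈ S, w n) ≤ E := by
      rw [Finset.mul_sum, ENNReal.ofReal_sum_of_nonneg (fun n _ => by positivity), hE]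
      gcongr with n hn
      calc ENNReal.ofReal (K ^ 2 * w n) ≤ 4 * ENNReal.ofReal (K ^ 2 * w n) :=
            le_mul_of_one_le_left' (by norm_num)
        _ ≤ _ := le_add_self
    calc _ = ∫⁻ z, ‖g₁ z + g₂ z‖ₑ ^ 4 ∂(cell T) := by
          refine lintegral_congr fun z => ?_
          simp only [hg₁, hg₂, ← Finset.sum_add_distrib, hr]
          congr 2
          refine Finset.sum_congr rfl fun n _ => ?_
          ring
      _ ≤ ∫⁻ z, 2 ^ 4 * (‖g₁ z‖ₑ ^ 4 + ‖g₂ z‖ₑ ^ 4) ∂(cell T) := by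
          refine lintegral_mono fun z => ?_
          exact (pow_le_pow_left' (enorm_add_le _ _) 4).trans (ENNReal.add_pow_le_two_pow_mul _ _ _)
      _ = 2 ^ 4 * (∫⁻ z, ‖g₁ z‖ₑ ^ 4 ∂(cell T) + ∫⁻ z, ‖g₂ z‖ₑ ^ 4 ∂(cell T)) := by
          rw [lintegral_const_mul' _ _ (by simp), lintegral_add_right' _ (hg₂m.enorm.pow_const 4)]
      _ ≤ 2 ^ 4 * (C₂ * E ^ 2 + ENNReal.ofReal (2 * T * Z) * E ^ 2) := by
          gcongr
          · exact hnear.trans (by gcongr)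
          · refine hfar.trans ?_
            calc _ ≤ ENNReal.ofReal ((2 * T * Z) * (K ^ 2 * ∑ n ∈ S, w n) ^ 2) := by
                  refine ENNReal.ofReal_le_ofReal ?_
                  -- The cubic expression is lowered to a quadratic one by bounding a single factor
                  -- `∑ w n` by `Z`; the other two, together with `K ^ 4`, are bounded by `E ^ 2`.
                  have : 2 * T * K ^ 4 * (∑ n ∈ S, w n) ^ 3 =
                    2 * T * (∑ n ∈ S, w n) * (K ^ 2 * ∑ n ∈ S, w n) ^ 2 := by ring
                  rw [this]
                  gcongr
              _ = ENNReal.ofReal (2 * T * Z) * ENNReal.ofReal (K ^ 2 * ∑ n ∈ S, w n) ^ 2 := by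
                  rw [ENNReal.ofReal_mul (by positivity), ENNReal.ofReal_pow (by positivity)]
              _ ≤ _ := by gcongr
      _ = A₂ * E ^ 2 := by rw [hA₂]; ring
      _ ≤ _ := by
          gcongr
          rw [ENNReal.coe_max, ENNReal.coe_toNNReal hA₂t]
          exact le_max_right _ _

/-! ### Bessel potentials of modulated cutoffs -/

/-- A smooth bump equal to one near `[0,1]`. -/
def cutoffBump : ContDiffBump (1 / 2 : ℝ) := ⟨1, 2, by norm_num, by norm_num⟩

/-- A smooth compactly supported cutoff equal to one near `[0,1]`. -/
def cutoff (x : ℝ) : ℂ := (cutoffBump x : ℂ)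

theorem contDiff_cutoff : ContDiff ℝ ∞ cutoff :=
  Complex.ofRealCLM.contDiff.comp cutoffBump.contDiff

theorem hasCompactSupport_cutoff : HasCompactSupport cutoff :=
  cutoffBump.hasCompactSupport.comp_left (g := Complex.ofReal) Complex.ofReal_zero

theorem cutoff_eq_one {x : ℝ} (hx : x ∈ Ioo (0 : ℝ) 1) : cutoff x = 1 := by
  rw [cutoff, cutoffBump.one_of_mem_closedBall, Complex.ofReal_one]
  rw [Metric.mem_closedBall, Real.dist_eq, abs_le]
  change -1 ≤ _ ∧ _ ≤ 1
  constructor <;> linarith [hx.1, hx.2]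

/-- The Schwartz function obtained by cutting off a smooth function. -/
def cutSchwartz (p : ℝ → ℂ) (hp : ContDiff ℝ ∞ p) : 𝓢(ℝ, ℂ) :=
  (HasCompactSupport.mul_left (f := p) hasCompactSupport_cutoff).toSchwartzMap
    (hp.mul contDiff_cutoff)

theorem cutSchwartz_apply (p : ℝ → ℂ) (hp : ContDiff ℝ ∞ p) (x : ℝ) :
    cutSchwartz p hp x = p x * cutoff x := rfl

theorem contDiff_expo (n : ℤ) : ContDiff ℝ ∞ (expo n) := by
  unfold expo
  have h : ContDiff ℝ ∞ fun x : ℝ => Complex.I * (n * Real.pi * x : ℝ) :=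
    contDiff_const.mul (Complex.ofRealCLM.contDiff.comp (contDiff_const.mul contDiff_id))
  exact h.cexp

/-- The cutoff of the character `e^{inπx}`. -/
def modSchwartz (n : ℤ) : 𝓢(ℝ, ℂ) := cutSchwartz (expo n) (contDiff_expo n)

/-- The symbol of the Bessel potential. -/
def besselSymbol (σ ζ : ℝ) : ℝ := (1 + ζ ^ 2) ^ (σ / 2)

/-- The Bessel potential on Schwartz functions. -/
def besselSchwartz (σ : ℝ) (g : 𝓢(ℝ, ℂ)) : 𝓢(ℝ, ℂ) :=
  SchwartzMap.fourierMultiplierCLM ℂ (fun x : ℝ => (((1 + ‖x‖ ^ 2) ^ (σ / 2) : ℝ) : ℂ)) g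

theorem besselPotential_toLp (σ : ℝ) (p : ℝ≥0∞) [Fact (1 ≤ p)] (g : 𝓢(ℝ, ℂ)) :
    TemperedDistribution.besselPotential ℝ ℂ σ
      ((g.toLp p : Lp ℂ p (volume : Measure ℝ)) : 𝓢'(ℝ, ℂ)) =
      (((besselSchwartz σ g).toLp p : Lp ℂ p (volume : Measure ℝ)) : 𝓢'(ℝ, ℂ)) := by
  rw [TemperedDistribution.besselPotential, Lp.toTemperedDistribution_toLp_eq,
    TemperedDistribution.fourierMultiplierCLM_toTemperedDistributionCLM_eq (by fun_prop),
    Lp.toTemperedDistribution_toLp_eq]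
  rfl

theorem besselSchwartz_apply (σ : ℝ) (g : 𝓢(ℝ, ℂ)) (x : ℝ) :
    besselSchwartz σ g x = FourierTransform.fourierInv
      (fun ζ : ℝ => (besselSymbol σ ζ : ℂ) * FourierTransform.fourier (g : ℝ → ℂ) ζ) x := by
  rw [besselSchwartz, SchwartzMap.fourierMultiplierCLM_apply, SchwartzMap.fourierInv_coe]
  refine congrArg (fun g : ℝ → ℂ => FourierTransform.fourierInv g x) (funext fun ζ => ?_)
  rw [SchwartzMap.smulLeftCLM_apply_apply (by fun_prop), SchwartzMap.fourier_coe, smul_eq_mul,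
    besselSymbol, Real.norm_eq_abs, sq_abs]

theorem fourierInv_eq_integral (f : ℝ → ℂ) (x : ℝ) : FourierTransform.fourierInv f x =
    ∫ ζ, Complex.exp (Complex.I * (2 * Real.pi * (ζ * x) : ℝ)) * f ζ := by
  rw [Real.fourierInv_eq']
  refine integral_congr_ae (.of_forall fun ζ => ?_)
  simp only [smul_eq_mul, RCLike.inner_apply, conj_trivial]
  congr 2
  push_cast
  ring

theorem fourier_eq_integral (f : ℝ → ℂ) (ζ : ℝ) : FourierTransform.fourier f ζ =
    ∫ x, Complex.exp (Complex.I * (-2 * Real.pi * (x * ζ) : ℝ)) * f x := by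
  rw [Real.fourier_eq']
  refine integral_congr_ae (.of_forall fun ζ => ?_)
  simp only [smul_eq_mul, RCLike.inner_apply, conj_trivial]
  congr 2
  push_cast
  ring

/-- The Fourier transform of the cutoff. -/
def cutoffHat : 𝓢(ℝ, ℂ) := FourierTransform.fourier (cutSchwartz (fun _ => 1) contDiff_const)

theorem fourier_modSchwartz (n : ℤ) (ζ : ℝ) :
    FourierTransform.fourier (modSchwartz n : ℝ → ℂ) ζ = cutoffHat (ζ - n / 2) := by
  rw [cutoffHat, SchwartzMap.fourier_coe, fourier_eq_integral, fourier_eq_integral]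
  refine integral_congr_ae (.of_forall fun x => ?_)
  simp only [modSchwartz, cutSchwartz_apply, expo, one_mul]
  rw [← mul_assoc, ← Complex.exp_add]
  congr 2
  push_cast
  ring

/-- The symbol of the Bessel potential shifted to the frequency `n/2`, times the Fourier transform
of the cutoff. -/
def shiftedSymbol (σ : ℝ) (n : ℤ) (ζ : ℝ) : ℂ :=
  (besselSymbol σ (ζ + n / 2) : ℂ) * cutoffHat ζ

/-- Conjugating a Fourier multiplier by a character translates its symbol; with kernel `e^{2πixζ}`
the character `e^{inπx}` is a shift by `n/2`. -/
theorem besselSchwartz_modSchwartz (σ : ℝ) (n : ℤ) (x : ℝ) :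
    besselSchwartz σ (modSchwartz n) x =
      expo n x * FourierTransform.fourierInv (shiftedSymbol σ n) x := by
  rw [besselSchwartz_apply]
  simp_rw [fourier_modSchwartz]
  rw [fourierInv_eq_integral, fourierInv_eq_integral,
    ← integral_add_right_eq_self _ ((n : ℝ) / 2), ← integral_const_mul]
  refine integral_congr_ae (.of_forall fun ζ => ?_)
  simp only [shiftedSymbol, add_sub_cancel_right, expo]
  rw [← mul_assoc (Complex.exp _) (Complex.exp _), ← Complex.exp_add]
  congr 2
  push_cast
  ring

theorem hasDerivAt_besselSymbol (σ y : ℝ) :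
    HasDerivAt (besselSymbol σ) (σ * y * (1 + y ^ 2) ^ (σ / 2 - 1)) y := by
  unfold besselSymbol
  have h : HasDerivAt (fun y : ℝ => 1 + y ^ 2) (2 * y) y := by
    simpa using (hasDerivAt_pow 2 y).const_add 1
  have := h.rpow_const (p := σ / 2) (Or.inl (by positivity))
  convert! this using 1
  ring

theorem besselSymbol_nonneg (σ y : ℝ) : 0 ≤ besselSymbol σ y := by
  unfold besselSymbol; positivity

theorem abs_deriv_besselSymbol_le {σ : ℝ} (hσ : σ ∈ Icc (0 : ℝ) 1) (y : ℝ) :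
    |σ * y * (1 + y ^ 2) ^ (σ / 2 - 1)| ≤ besselSymbol σ y := by
  have h1 : |y| ≤ 1 + y ^ 2 := by
    rw [← sq_abs]; nlinarith [sq_nonneg (|y| - 1)]
  rw [abs_mul, abs_mul, abs_of_nonneg hσ.1,
    abs_of_nonneg (by positivity : 0 ≤ (1 + y ^ 2) ^ (σ / 2 - 1)),
    Real.rpow_sub (by positivity), Real.rpow_one, besselSymbol]
  calc σ * |y| * ((1 + y ^ 2) ^ (σ / 2) / (1 + y ^ 2))
      ≤ 1 * (1 + y ^ 2) * ((1 + y ^ 2) ^ (σ / 2) / (1 + y ^ 2)) := by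
        gcongr; exact hσ.2
    _ = _ := by field_simp

/-- Peetre's inequality. -/
theorem besselSymbol_add_le {σ : ℝ} (hσ : σ ∈ Icc (0 : ℝ) 1) (ζ a : ℝ) :
    besselSymbol σ (ζ + a) ≤ besselSymbol σ a * (2 * (1 + ζ ^ 2)) := by
  have h1 : 1 + (ζ + a) ^ 2 ≤ (1 + a ^ 2) * (2 * (1 + ζ ^ 2)) := by
    nlinarith [sq_nonneg (ζ - a), sq_nonneg (ζ * a)]
  unfold besselSymbol
  calc _ ≤ ((1 + a ^ 2) * (2 * (1 + ζ ^ 2))) ^ (σ / 2) :=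
        Real.rpow_le_rpow (by positivity) h1 (by linarith [hσ.1])
    _ = (1 + a ^ 2) ^ (σ / 2) * (2 * (1 + ζ ^ 2)) ^ (σ / 2) :=
        Real.mul_rpow (by positivity) (by positivity)
    _ ≤ _ := by
        gcongr
        refine Real.rpow_le_self_of_one_le ?_ (by linarith [hσ.2])
        nlinarith [sq_nonneg ζ]

/-- An integrable weight dominating the shifted symbols. -/
def symbolWeight (ζ : ℝ) : ℝ :=
  2 * (1 + ζ ^ 2) * (2 * ‖cutoffHat ζ‖ + ‖deriv cutoffHat ζ‖) + (1 + ζ ^ 2)⁻¹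

/-- The summand `(1 + ζ²)⁻¹` is present in the weight for this positivity: multipliers are later
normalised by dividing by it. -/
theorem symbolWeight_pos (ζ : ℝ) : 0 < symbolWeight ζ := by
  unfold symbolWeight; positivity

theorem continuous_deriv_cutoffHat : Continuous (deriv cutoffHat) :=
  (cutoffHat.smooth 1).continuous_deriv le_rfl

theorem continuous_symbolWeight : Continuous symbolWeight := by
  unfold symbolWeight
  have h1 := continuous_deriv_cutoffHat
  have h2 := cutoffHat.continuous
  have h3 : Continuous fun ζ : ℝ => (1 + ζ ^ 2)⁻¹ :=
    Continuous.inv₀ (by fun_prop) fun x => by positivity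
  fun_prop

theorem integrable_symbolWeight : Integrable symbolWeight := by
  have key : ∀ g : 𝓢(ℝ, ℂ), Integrable fun ζ : ℝ => (1 + ζ ^ 2) * ‖g ζ‖ := by
    intro g
    have h1 := g.integrable_pow_mul (volume : Measure ℝ) 0
    have h2 := g.integrable_pow_mul (volume : Measure ℝ) 2
    refine (h1.add h2).congr (.of_forall fun ζ => ?_)
    simp only [Pi.add_apply, Real.norm_eq_abs, sq_abs, pow_zero]
    ring
  have h1 := key cutoffHat
  have h2 := key (SchwartzMap.derivCLM ℂ ℂ cutoffHat)
  simp only [SchwartzMap.derivCLM_apply] at h2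
  refine (((h1.const_mul 4).add (h2.const_mul 2)).add integrable_inv_one_add_sq).congr
    (.of_forall fun ζ => ?_)
  simp only [Pi.add_apply, symbolWeight]
  ring

theorem hasDerivAt_shiftedSymbol (σ : ℝ) (n : ℤ) (ζ : ℝ) :
    HasDerivAt (shiftedSymbol σ n)
      (((σ * (ζ + n / 2) * (1 + (ζ + n / 2) ^ 2) ^ (σ / 2 - 1) : ℝ) : ℂ) * cutoffHat ζ +
        (besselSymbol σ (ζ + n / 2) : ℂ) * deriv cutoffHat ζ) ζ := by
  have h1 := ((hasDerivAt_besselSymbol σ (ζ + n / 2)).comp_add_const ζ ((n : ℝ) / 2)).ofReal_comp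
  have h2 := (cutoffHat.differentiableAt (x := ζ)).hasDerivAt
  exact h1.mul h2

/-- The symbol whose inverse Fourier transform is `(1 + 2πix)` times that of `shiftedSymbol`. -/
def decayedSymbol (σ : ℝ) (n : ℤ) (ζ : ℝ) : ℂ :=
  shiftedSymbol σ n ζ - deriv (shiftedSymbol σ n) ζ

/-- Peetre's inequality isolates the dependence on `n` in `besselSymbol σ (n / 2)`. The growth in
`ζ` it leaves is absorbed by the rapid decay of `cutoffHat` and its derivative. -/
theorem norm_shiftedSymbol_add_norm_deriv_le {σ : ℝ} (hσ : σ ∈ Icc (0 : ℝ) 1) (n : ℤ) (ζ : ℝ) :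
    ‖shiftedSymbol σ n ζ‖ + ‖deriv (shiftedSymbol σ n) ζ‖ ≤
      besselSymbol σ (n / 2) * symbolWeight ζ := by
  have hp := besselSymbol_add_le hσ ζ (n / 2)
  have hd := abs_deriv_besselSymbol_le hσ (ζ + n / 2)
  have h0 := besselSymbol_nonneg σ (ζ + n / 2)
  rw [(hasDerivAt_shiftedSymbol σ n ζ).deriv]
  calc _ ≤ besselSymbol σ (ζ + n / 2) * ‖cutoffHat ζ‖ +
        (besselSymbol σ (ζ + n / 2) * ‖cutoffHat ζ‖ +
          besselSymbol σ (ζ + n / 2) * ‖deriv cutoffHat ζ‖) := by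
        gcongr
        · rw [shiftedSymbol, norm_mul, Complex.norm_real, Real.norm_of_nonneg h0]
        · refine (norm_add_le _ _).trans ?_
          rw [norm_mul, norm_mul, Complex.norm_real, Complex.norm_real, Real.norm_of_nonneg h0,
            Real.norm_eq_abs]
          gcongr
    _ = besselSymbol σ (ζ + n / 2) * (2 * ‖cutoffHat ζ‖ + ‖deriv cutoffHat ζ‖) := by ring
    _ ≤ besselSymbol σ (n / 2) * (2 * (1 + ζ ^ 2)) *
        (2 * ‖cutoffHat ζ‖ + ‖deriv cutoffHat ζ‖) := by gcongr
    _ = besselSymbol σ (n / 2) * (2 * (1 + ζ ^ 2) *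
        (2 * ‖cutoffHat ζ‖ + ‖deriv cutoffHat ζ‖)) := by ring
    _ ≤ _ := by
        have := besselSymbol_nonneg σ ((n : ℝ) / 2)
        gcongr
        rw [symbolWeight]
        have : 0 ≤ (1 + ζ ^ 2)⁻¹ := by positivity
        linarith

theorem continuous_deriv_shiftedSymbol (σ : ℝ) (n : ℤ) :
    Continuous (deriv (shiftedSymbol σ n)) := by
  have : deriv (shiftedSymbol σ n) = _ := funext fun ζ => (hasDerivAt_shiftedSymbol σ n ζ).deriv
  rw [this]
  have h1 := continuous_deriv_cutoffHat
  have h2 := cutoffHat.continuous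
  have h3 : Continuous (besselSymbol σ) := continuous_rpow_weight _
  have h4 : Continuous fun y : ℝ => (1 + y ^ 2) ^ (σ / 2 - 1) := continuous_rpow_weight _
  have h5 : Continuous fun ζ : ℝ => (1 + (ζ + n / 2) ^ 2) ^ (σ / 2 - 1) :=
    h4.comp (by fun_prop : Continuous fun ζ : ℝ => ζ + n / 2)
  fun_prop

theorem continuous_shiftedSymbol (σ : ℝ) (n : ℤ) : Continuous (shiftedSymbol σ n) := by
  have h2 := cutoffHat.continuous
  have h3 : Continuous (besselSymbol σ) := continuous_rpow_weight _
  unfold shiftedSymbol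
  fun_prop

theorem continuous_decayedSymbol (σ : ℝ) (n : ℤ) : Continuous (decayedSymbol σ n) :=
  (continuous_shiftedSymbol σ n).sub (continuous_deriv_shiftedSymbol σ n)

theorem norm_decayedSymbol_le {σ : ℝ} (hσ : σ ∈ Icc (0 : ℝ) 1) (n : ℤ) (ζ : ℝ) :
    ‖decayedSymbol σ n ζ‖ ≤ besselSymbol σ (n / 2) * symbolWeight ζ :=
  (norm_sub_le _ _).trans (norm_shiftedSymbol_add_norm_deriv_le hσ n ζ)

theorem integrable_decayedSymbol {σ : ℝ} (hσ : σ ∈ Icc (0 : ℝ) 1) (n : ℤ) :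
    Integrable (decayedSymbol σ n) :=
  (integrable_symbolWeight.const_mul _).mono' (continuous_decayedSymbol σ n).aestronglyMeasurable
    (.of_forall (norm_decayedSymbol_le hσ n))

/-- Multiplication by `-2πix` corresponds to differentiating the symbol, so the symbol minus its
derivative yields the factor `1 + 2πix`. Dividing by it later gives the decay in `x` needed for
integrability on the whole line. -/
theorem one_add_mul_besselSchwartz_modSchwartz {σ : ℝ} (hσ : σ ∈ Icc (0 : ℝ) 1) (n : ℤ) (x : ℝ) :
    (1 + 2 * Real.pi * Complex.I * x) * besselSchwartz σ (modSchwartz n) x =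
      ∫ ζ, Complex.exp (Complex.I * (2 * Real.pi * (ζ * x) : ℝ)) *
        (expo n x * decayedSymbol σ n ζ) := by
  have hi1 : Integrable (shiftedSymbol σ n) :=
    (integrable_symbolWeight.const_mul (besselSymbol σ (n / 2))).mono'
      (continuous_shiftedSymbol σ n).aestronglyMeasurable (.of_forall fun ζ =>
        (le_add_of_nonneg_right (norm_nonneg _)).trans
          (norm_shiftedSymbol_add_norm_deriv_le hσ n ζ))
  have hi2 : Integrable (deriv (shiftedSymbol σ n)) :=
    (integrable_symbolWeight.const_mul (besselSymbol σ (n / 2))).mono'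
      (continuous_deriv_shiftedSymbol σ n).aestronglyMeasurable (.of_forall fun ζ =>
        (le_add_of_nonneg_left (norm_nonneg _)).trans
          (norm_shiftedSymbol_add_norm_deriv_le hσ n ζ))
  have hd := congrFun (Real.fourier_deriv hi1
    (fun ζ => (hasDerivAt_shiftedSymbol σ n ζ).differentiableAt) hi2) (-x)
  rw [besselSchwartz_modSchwartz, Real.fourierInv_eq_fourier_neg]
  have e1 : FourierTransform.fourier (decayedSymbol σ n) (-x) =
      FourierTransform.fourier (shiftedSymbol σ n) (-x) -
        FourierTransform.fourier (deriv (shiftedSymbol σ n)) (-x) := by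
    simp only [fourier_eq_integral]
    rw [← integral_sub]
    · refine integral_congr_ae (.of_forall fun ζ => ?_)
      simp only [decayedSymbol]
      ring
    · exact hi1.bdd_mul (c := 1) (Continuous.aestronglyMeasurable (by fun_prop))
        (.of_forall fun ζ => (norm_exp_I_mul _).le)
    · exact hi2.bdd_mul (c := 1) (Continuous.aestronglyMeasurable (by fun_prop))
        (.of_forall fun ζ => (norm_exp_I_mul _).le)
  have e2 : ∫ ζ, Complex.exp (Complex.I * (2 * Real.pi * (ζ * x) : ℝ)) *
        (expo n x * decayedSymbol σ n ζ) =
      expo n x * FourierTransform.fourier (decayedSymbol σ n) (-x) := by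
    rw [fourier_eq_integral, ← integral_const_mul]
    refine integral_congr_ae (.of_forall fun ζ => ?_)
    simp only []
    rw [mul_left_comm]
    congr 4
    ring_nf
  rw [e2, e1, hd, smul_eq_mul]
  push_cast
  ring

/-! ### Norm bounds for sums of Bessel potentials -/

theorem expo_add_two (n : ℤ) : Function.Periodic (expo n) 2 := by
  intro x
  simp only [expo]
  have : Complex.I * (n * Real.pi * (x + 2) : ℝ) =
      Complex.I * (n * Real.pi * x : ℝ) + n * (2 * Real.pi * Complex.I) := by
    push_cast; ring
  rw [this, Complex.exp_add, Complex.exp_int_mul_two_pi_mul_I, mul_one]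

theorem one_add_sq_le_norm_sq (x : ℝ) :
    1 + x ^ 2 ≤ ‖(1 + 2 * Real.pi * Complex.I * x : ℂ)‖ ^ 2 := by
  have : (1 + 2 * Real.pi * Complex.I * x : ℂ) = ⟨1, 2 * Real.pi * x⟩ := by
    apply Complex.ext <;> simp
  rw [this, Complex.sq_norm, Complex.normSq_mk]
  have h : 1 ≤ (2 * Real.pi) ^ 2 := by nlinarith [Real.pi_gt_three]
  nlinarith [sq_nonneg x]

theorem one_add_sq_le_of_mem {x : ℝ} {j : ℤ} (hx : x ∈ Ioc (2 * (j : ℝ)) (2 * j + 2)) :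
    1 + (j : ℝ) ^ 2 ≤ 4 * (1 + x ^ 2) := by
  rcases le_or_gt 2 j with h | h
  · have : (2 : ℝ) ≤ j := by exact_mod_cast h
    nlinarith [hx.1]
  · rcases le_or_gt j (-2) with h' | h'
    · have : (j : ℝ) ≤ -2 := by exact_mod_cast h'
      nlinarith [hx.2]
    · have h1 : (j : ℝ) ≤ 1 := by exact_mod_cast (by omega : j ≤ 1)
      have h2 : (-1 : ℝ) ≤ j := by exact_mod_cast (by omega : -1 ≤ j)
      nlinarith [sq_nonneg x]

/-- The decaying weight `|1 + 2πix|⁻¹`. -/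
def spatialWeight (x : ℝ) : ℝ≥0∞ := ‖(1 + 2 * Real.pi * Complex.I * x : ℂ)‖ₑ⁻¹

theorem one_add_two_pi_ne_zero (x : ℝ) : (1 + 2 * Real.pi * Complex.I * x : ℂ) ≠ 0 := by
  intro h
  have := one_add_sq_le_norm_sq x
  rw [h, norm_zero] at this
  nlinarith [sq_nonneg x]

theorem measurable_spatialWeight : Measurable spatialWeight := by
  unfold spatialWeight
  have : Continuous fun x : ℝ => (1 + 2 * Real.pi * Complex.I * x : ℂ) := by fun_prop
  exact this.measurable.enorm.inv

theorem spatialWeight_le_one (x : ℝ) : spatialWeight x ≤ 1 := by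
  rw [spatialWeight, ENNReal.inv_le_one, ← ofReal_norm, ← ENNReal.ofReal_one]
  refine ENNReal.ofReal_le_ofReal ?_
  have := one_add_sq_le_norm_sq x
  nlinarith [norm_nonneg (1 + 2 * Real.pi * Complex.I * x : ℂ), sq_nonneg x]

theorem spatialWeight_pow_le {k : ℕ} (hk : 1 ≤ k) {x : ℝ} {j : ℤ}
    (hx : x ∈ Ioc (2 * (j : ℝ)) (2 * j + 2)) :
    spatialWeight x ^ (k + 1) ≤ ENNReal.ofReal (4 * (1 + (j : ℝ) ^ 2)⁻¹) := by
  have h1 : spatialWeight x ^ (k + 1) ≤ spatialWeight x ^ 2 :=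
    pow_le_pow_right_of_le_one' (spatialWeight_le_one x) (by omega)
  refine h1.trans ?_
  have hpos : 0 < ‖(1 + 2 * Real.pi * Complex.I * x : ℂ)‖ :=
    norm_pos_iff.2 (one_add_two_pi_ne_zero x)
  rw [spatialWeight, ← ofReal_norm, ← ENNReal.ofReal_inv_of_pos hpos,
    ← ENNReal.ofReal_pow (by positivity)]
  refine ENNReal.ofReal_le_ofReal ?_
  rw [inv_pow]
  have h2 := one_add_sq_le_norm_sq x
  have h3 := one_add_sq_le_of_mem hx
  rw [inv_le_comm₀ (by positivity) (by positivity), mul_inv, inv_inv]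
  linarith

/-- The line is cut into periods. On the `j`-th one the weight to any power `k + 1 ≥ 2` is at most
`4/(1 + j²)`, which is summable, and periodicity makes all the remaining integrals equal. -/
theorem exists_lintegral_spatialWeight_le : ∃ W : ℝ≥0, ∀ (k : ℕ), 1 ≤ k → ∀ φ : ℝ → ℝ≥0∞,
    Measurable φ → Function.Periodic φ 2 →
      ∫⁻ x, spatialWeight x ^ (k + 1) * φ x ≤ W * ∫⁻ x in Ioc (0 : ℝ) 2, φ x := by
  have hs : Summable fun j : ℤ => 4 * (1 + (j : ℝ) ^ 2)⁻¹ := by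
    refine Summable.mul_left _ ?_
    refine Summable.of_norm_bounded_eventually (g := fun j : ℤ => |(j : ℝ)| ^ (-2 : ℝ))
      (Real.summable_abs_int_rpow (by norm_num)) ?_
    rw [Filter.eventually_cofinite]
    refine (Set.finite_singleton (0 : ℤ)).subset fun j hj => ?_
    by_contra h0
    apply hj
    have hj0 : (j : ℝ) ≠ 0 := by exact_mod_cast h0
    rw [Real.norm_of_nonneg (by positivity), Real.rpow_neg (abs_nonneg _)]
    gcongr
    rw [show (2 : ℝ) = ((2 : ℕ) : ℝ) by norm_num, Real.rpow_natCast, sq_abs]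
    linarith
  refine ⟨(∑' j : ℤ, 4 * (1 + (j : ℝ) ^ 2)⁻¹).toNNReal, fun k hk φ hφ hp => ?_⟩
  have hU := iUnion_Ioc_add_zsmul (two_pos : (0 : ℝ) < 2) 0
  rw [← setLIntegral_univ, ← hU]
  refine (lintegral_iUnion_le _ _).trans ?_
  have hj : ∀ j : ℤ, ∫⁻ x in Ioc ((0 : ℝ) + j • (2 : ℝ)) (0 + (j + 1) • (2 : ℝ)),
      spatialWeight x ^ (k + 1) * φ x ≤
      ENNReal.ofReal (4 * (1 + (j : ℝ) ^ 2)⁻¹) * ∫⁻ x in Ioc (0 : ℝ) 2, φ x := by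
    intro j
    have hI : Ioc ((0 : ℝ) + j • (2 : ℝ)) (0 + (j + 1) • (2 : ℝ)) =
        Ioc (2 * (j : ℝ)) (2 * j + 2) := by
      congr 1 <;> simp <;> ring
    rw [hI]
    have hshift : ∫⁻ x in Ioc (2 * (j : ℝ)) (2 * j + 2), φ x = ∫⁻ x in Ioc (0 : ℝ) 2, φ x := by
      have h1 := (measurePreserving_add_right (volume : Measure ℝ) (2 * (j : ℝ))).setLIntegral_comp_preimage
        (s := Ioc (2 * (j : ℝ)) (2 * j + 2)) measurableSet_Ioc hφ
      rw [← h1]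
      have h2 : (fun x : ℝ => x + 2 * (j : ℝ)) ⁻¹' Ioc (2 * (j : ℝ)) (2 * j + 2) = Ioc 0 2 := by
        rw [Set.preimage_add_const_Ioc]; congr 1 <;> ring
      rw [h2]
      refine lintegral_congr fun x => ?_
      have := hp.int_mul j x
      rw [mul_comm (2 : ℝ)]
      exact this
    calc _ ≤ ∫⁻ x in Ioc (2 * (j : ℝ)) (2 * j + 2),
          ENNReal.ofReal (4 * (1 + (j : ℝ) ^ 2)⁻¹) * φ x := by
          refine setLIntegral_mono' measurableSet_Ioc fun x hx => ?_
          gcongr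
          exact spatialWeight_pow_le hk hx
      _ = _ := by rw [lintegral_const_mul' _ _ ENNReal.ofReal_ne_top, hshift]
  refine (ENNReal.tsum_le_tsum hj).trans (le_of_eq ?_)
  rw [ENNReal.tsum_mul_right, ← ENNReal.ofReal_tsum_of_nonneg (fun j => by positivity) hs]
  rfl

theorem besselSymbol_pos (σ y : ℝ) : 0 < besselSymbol σ y := by
  unfold besselSymbol; positivity

/-- The norm of a finite sum of Bessel potentials of modulated cutoffs is controlled by the norms
of the corresponding trigonometric sums over one period. -/
theorem exists_lintegral_besselSchwartz_sum_le {σ : ℝ} (hσ : σ ∈ Icc (0 : ℝ) 1) {k : ℕ}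
    (hk : 1 ≤ k) : ∃ C : ℝ≥0, ∀ {Y : Type} [MeasurableSpace Y] (ν : Measure Y) [SFinite ν]
      (a : ℤ → Y → ℂ), (∀ n, Measurable (a n)) → ∀ (S : Finset ℤ) (E : ℝ≥0∞),
      (∀ b : ℤ → ℂ, (∀ n, ‖b n‖ ≤ 1) →
        ∫⁻ z, ‖∑ n ∈ S, b n * ((besselSymbol σ (n / 2) : ℂ) * a n z.2) * expo n z.1‖ₑ ^ (k + 1)
          ∂((volume.restrict (Ioc (0 : ℝ) 2)).prod ν) ≤ E) →
      ∫⁻ z, ‖∑ n ∈ S, a n z.2 * besselSchwartz σ (modSchwartz n) z.1‖ₑ ^ (k + 1)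
        ∂((volume : Measure ℝ).prod ν) ≤ C * E := by
  obtain ⟨W, hW⟩ := exists_lintegral_spatialWeight_le
  set w : ℝ → ℝ≥0∞ := fun ζ => ENNReal.ofReal (symbolWeight ζ) with hw
  have hwm : Measurable w := continuous_symbolWeight.measurable.ennreal_ofReal
  have hwt : ∫⁻ ζ, w ζ ≠ ⊤ := (integrable_symbolWeight.lintegral_lt_top).ne
  set I := ∫⁻ ζ, w ζ with hI
  -- The added 1 makes the constant nonzero, so that the case `E = ⊤` is trivial.
  refine ⟨W * (I ^ (k + 1)).toNNReal + 1, ?_⟩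
  intro Y _ ν _ a ha S E hE
  by_cases hEt : E = ⊤
  · rw [hEt, ENNReal.mul_top (by simp)]
    exact le_top
  set G : ℝ → ℝ × Y → ℂ := fun ζ z =>
    ∑ n ∈ S, a n z.2 * (expo n z.1 * decayedSymbol σ n ζ) with hG
  have hGm : Measurable (Function.uncurry G) := by
    refine Finset.measurable_fun_sum _ fun n _ => ?_
    refine ((ha n).comp (measurable_snd.comp measurable_snd)).mul ?_
    exact ((continuous_expo n).measurable.comp (measurable_fst.comp measurable_snd)).mul
      ((continuous_decayedSymbol σ n).measurable.comp measurable_fst)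
  have hGz : ∀ ζ, Measurable (G ζ) := fun ζ => hGm.of_uncurry_left
  set F : ℝ → ℝ × Y → ℝ≥0∞ := fun ζ z => spatialWeight z.1 * ‖G ζ z‖ₑ with hF
  have hFm : Measurable (Function.uncurry F) :=
    (measurable_spatialWeight.comp (measurable_fst.comp measurable_snd)).mul hGm.enorm
  set R : ℝ≥0∞ := (W * E) ^ (1 / ((k + 1 : ℕ) : ℝ)) with hR
  have hRpow : R ^ (k + 1) = W * E := by
    rw [hR, ← ENNReal.rpow_natCast, ← ENNReal.rpow_mul, one_div,
      inv_mul_cancel₀ (by positivity), ENNReal.rpow_one]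
  have hRt : R ≠ ⊤ :=
    ENNReal.rpow_ne_top_of_nonneg (by positivity) (ENNReal.mul_ne_top ENNReal.coe_ne_top hEt)
  have hmain : ∀ ζ, ∫⁻ z, F ζ z ^ (k + 1) ∂((volume : Measure ℝ).prod ν) ≤
      (R * w ζ) ^ (k + 1) := by
    intro ζ
    have hper : ∀ y, Function.Periodic (fun x => ‖G ζ (x, y)‖ₑ ^ (k + 1)) 2 := by
      intro y x
      simp only [hG, expo_add_two _ x]
    calc _ = ∫⁻ y, (∫⁻ x, F ζ (x, y) ^ (k + 1)) ∂ν :=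
          lintegral_prod_symm _ ((hFm.of_uncurry_left).pow_const _).aemeasurable
      _ ≤ ∫⁻ y, W * (∫⁻ x in Ioc (0 : ℝ) 2, ‖G ζ (x, y)‖ₑ ^ (k + 1)) ∂ν := by
          refine lintegral_mono fun y => ?_
          simp only [hF, mul_pow]
          exact hW k hk _ (((hGz ζ).comp measurable_prodMk_right).enorm.pow_const _) (hper y)
      _ = W * ∫⁻ z, ‖G ζ z‖ₑ ^ (k + 1) ∂((volume.restrict (Ioc (0 : ℝ) 2)).prod ν) := by
          rw [lintegral_const_mul' _ _ ENNReal.coe_ne_top,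
            lintegral_prod_symm _ ((hGz ζ).enorm.pow_const _).aemeasurable]
      _ ≤ W * (w ζ ^ (k + 1) * E) := by
          gcongr
          have hwpos := symbolWeight_pos ζ
          have hβ := fun n : ℤ => besselSymbol_pos σ (n / 2)
          -- For fixed `ζ` the symbol divided by its majorant is an admissible multiplier of modulus
          -- at most one; the factor `symbolWeight ζ` is restored outside the integral.
          have hb := hE (fun n => decayedSymbol σ n ζ /
            ((besselSymbol σ (n / 2) : ℂ) * (symbolWeight ζ : ℂ))) (fun n => by
              rw [norm_div, norm_mul, Complex.norm_real, Complex.norm_real,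
                Real.norm_of_nonneg (hβ n).le, Real.norm_of_nonneg hwpos.le]
              exact div_le_one_of_le₀ (norm_decayedSymbol_le hσ n ζ)
                (mul_nonneg (hβ n).le hwpos.le))
          calc _ = ∫⁻ z, w ζ ^ (k + 1) * ‖∑ n ∈ S, decayedSymbol σ n ζ /
                ((besselSymbol σ (n / 2) : ℂ) * (symbolWeight ζ : ℂ)) *
                ((besselSymbol σ (n / 2) : ℂ) * a n z.2) * expo n z.1‖ₑ ^ (k + 1)
                  ∂((volume.restrict (Ioc (0 : ℝ) 2)).prod ν) := by
                refine lintegral_congr fun z => ?_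
                have e : w ζ = ‖(symbolWeight ζ : ℂ)‖ₑ := by
                  rw [hw, ← ofReal_norm, Complex.norm_real, Real.norm_of_nonneg hwpos.le]
                rw [e, ← mul_pow, ← enorm_mul, Finset.mul_sum]
                congr 2
                refine Finset.sum_congr rfl fun n _ => ?_
                have h1 : (besselSymbol σ (n / 2) : ℂ) ≠ 0 := by exact_mod_cast (hβ n).ne'
                have h2 : (symbolWeight ζ : ℂ) ≠ 0 := by exact_mod_cast hwpos.ne'
                field_simp
            _ ≤ _ := by
                rw [lintegral_const_mul' _ _ (ENNReal.pow_ne_top ENNReal.ofReal_ne_top)]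
                gcongr
      _ = _ := by rw [mul_pow, hRpow]; ring
  have hmink := lintegral_lintegral_pow_le (μ := volume) (ν := (volume : Measure ℝ).prod ν) k
    (by omega) hFm (hwm.const_mul R) (fun ζ => ENNReal.mul_ne_top hRt ENNReal.ofReal_ne_top) hmain
  have hpt : ∀ z : ℝ × Y, ‖∑ n ∈ S, a n z.2 * besselSchwartz σ (modSchwartz n) z.1‖ₑ ^ (k + 1) ≤
      (∫⁻ ζ, F ζ z) ^ (k + 1) := by
    intro z
    gcongr
    set x := z.1 with hx
    have hne := one_add_two_pi_ne_zero x
    -- After multiplication by `1 + 2πix` the sum is an integral over `ζ` of trigonometric sums, the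
    -- form to which Minkowski's inequality applies.
    have e : (1 + 2 * Real.pi * Complex.I * x) *
        ∑ n ∈ S, a n z.2 * besselSchwartz σ (modSchwartz n) x =
        ∫ ζ, Complex.exp (Complex.I * (2 * Real.pi * (ζ * x) : ℝ)) * G ζ z := by
      simp only [hG, Finset.mul_sum]
      rw [integral_finsetSum]
      · refine Finset.sum_congr rfl fun n _ => ?_
        rw [mul_left_comm, one_add_mul_besselSchwartz_modSchwartz hσ, ← integral_const_mul]
        refine integral_congr_ae (.of_forall fun ζ => ?_)
        simp only [← hx]
        ring
      · intro n _
        refine Integrable.bdd_mul (c := 1) ?_ (Continuous.aestronglyMeasurable (by fun_prop))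
          (.of_forall fun ζ => (norm_exp_I_mul _).le)
        exact ((integrable_decayedSymbol hσ n).const_mul _).const_mul _
    have h1 : ‖(1 + 2 * Real.pi * Complex.I * x : ℂ)‖ₑ *
        ‖∑ n ∈ S, a n z.2 * besselSchwartz σ (modSchwartz n) x‖ₑ ≤ ∫⁻ ζ, ‖G ζ z‖ₑ := by
      rw [← enorm_mul, e]
      refine (enorm_integral_le_lintegral_enorm _).trans (le_of_eq ?_)
      refine lintegral_congr fun ζ => ?_
      rw [enorm_mul, ← ofReal_norm, norm_exp_I_mul, ENNReal.ofReal_one, one_mul]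
    calc _ = spatialWeight x * (‖(1 + 2 * Real.pi * Complex.I * x : ℂ)‖ₑ *
        ‖∑ n ∈ S, a n z.2 * besselSchwartz σ (modSchwartz n) x‖ₑ) := by
          rw [← mul_assoc, spatialWeight, ENNReal.inv_mul_cancel (by simpa using hne) (by simp),
            one_mul]
      _ ≤ spatialWeight x * ∫⁻ ζ, ‖G ζ z‖ₑ := by gcongr
      _ = _ := by
          rw [← lintegral_const_mul' _ _ (ne_top_of_le_ne_top ENNReal.one_ne_top
            (spatialWeight_le_one x))]
  refine (lintegral_mono hpt).trans (hmink.trans ?_)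
  rw [lintegral_const_mul' _ _ hRt, mul_pow, hRpow, ← hI]
  calc _ = (W * I ^ (k + 1)) * E := by ring
    _ ≤ _ := by
        gcongr
        rw [ENNReal.coe_add, ENNReal.coe_mul, ENNReal.coe_toNNReal (ENNReal.pow_ne_top hwt)]
        exact le_self_add

/-- Parseval's identity for finite trigonometric sums. -/
theorem lintegral_expo_sum_sq (S : Finset ℤ) (c : ℤ → ℂ) :
    ∫⁻ x in Ioc (0 : ℝ) 2, ‖∑ n ∈ S, c n * expo n x‖ₑ ^ 2 = 2 * ∑ n ∈ S, ‖c n‖ₑ ^ 2 := by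
  set f : ℝ → ℂ := fun x => ∑ n ∈ S, c n * expo n x with hf
  have hfc : Continuous f := by fun_prop
  have hexp : ∀ x, ((‖f x‖ ^ 2 : ℝ) : ℂ) = ∑ p ∈ S ×ˢ S,
      (c p.1 * starRingEnd ℂ (c p.2)) * expo (p.1 - p.2) x := by
    intro x
    have h1 : ((‖f x‖ ^ 2 : ℝ) : ℂ) = f x * starRingEnd ℂ (f x) := by
      rw [Complex.mul_conj']; push_cast; rfl
    rw [h1, hf]
    simp only [map_sum, map_mul]
    rw [Finset.sum_mul_sum, ← Finset.sum_product']
    refine Finset.sum_congr rfl fun p _ => ?_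
    have : expo (p.1 - p.2) x = expo p.1 x * starRingEnd ℂ (expo p.2 x) := by
      simp only [expo, ← Complex.exp_conj, ← Complex.exp_add, map_mul, Complex.conj_I,
        Complex.conj_ofReal]
      congr 1; push_cast; ring
    rw [this]; ring
  have hint : ∀ g : ℝ → ℂ, Continuous g → IntegrableOn g (Ioc 0 2) := fun g hg =>
    (hg.integrableOn_Icc).mono_set Ioc_subset_Icc_self
  have e2 : ((∫ x in Ioc (0 : ℝ) 2, ‖f x‖ ^ 2 : ℝ) : ℂ) =
      ((2 * ∑ n ∈ S, ‖c n‖ ^ 2 : ℝ) : ℂ) := by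
    rw [← integral_complex_ofReal]
    simp_rw [hexp]
    rw [integral_finsetSum _ fun p _ => hint _ (by fun_prop)]
    simp_rw [integral_const_mul, integral_expo, sub_eq_zero]
    rw [Finset.sum_product]
    simp only [mul_ite, mul_zero, Finset.sum_ite_eq]
    push_cast
    rw [Finset.mul_sum]
    refine Finset.sum_congr rfl fun n hn => ?_
    rw [if_pos hn, Complex.mul_conj']; ring
  have e3 : ∫⁻ x in Ioc (0 : ℝ) 2, ‖f x‖ₑ ^ 2 =
      ENNReal.ofReal (∫ x in Ioc (0 : ℝ) 2, ‖f x‖ ^ 2) := by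
    rw [ofReal_integral_eq_lintegral_ofReal ?_ (.of_forall fun x => by positivity)]
    · refine lintegral_congr fun x => ?_
      rw [ENNReal.ofReal_pow (norm_nonneg _), ofReal_norm]
    · exact ((hfc.norm.pow 2).integrableOn_Icc).mono_set Ioc_subset_Icc_self
  rw [e3, Complex.ofReal_injective e2, ENNReal.ofReal_mul (by norm_num),
    ENNReal.ofReal_sum_of_nonneg fun n _ => by positivity]
  simp_rw [ENNReal.ofReal_pow (norm_nonneg _), ofReal_norm]
  norm_num

/-! ### Closedness of the Bessel potential and Sobolev norms of series -/

/-- `L^p` embeds continuously in the tempered distributions, the Bessel potential is continuous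
there, and limits are unique. -/
theorem besselPotential_eq_of_tendsto {ι : Type*} {l : Filter ι} [l.NeBot] {σ : ℝ} {p : ℝ≥0∞}
    [Fact (1 ≤ p)] {U F : ι → Lp ℂ p (volume : Measure ℝ)} {U₀ F₀ : Lp ℂ p (volume : Measure ℝ)}
    (hU : Tendsto U l (𝓝 U₀)) (hF : Tendsto F l (𝓝 F₀))
    (h : ∀ i, TemperedDistribution.besselPotential ℝ ℂ σ (U i : 𝓢'(ℝ, ℂ)) = (F i : 𝓢'(ℝ, ℂ))) :
    TemperedDistribution.besselPotential ℝ ℂ σ (U₀ : 𝓢'(ℝ, ℂ)) = (F₀ : 𝓢'(ℝ, ℂ)) := by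
  have h1 := ((TemperedDistribution.besselPotential ℝ ℂ σ).continuous.comp
    (Lp.toTemperedDistributionCLM ℂ volume p).continuous).tendsto U₀
  have h2 := (Lp.toTemperedDistributionCLM ℂ (volume : Measure ℝ) p).continuous.tendsto F₀
  have h3 := h1.comp hU
  have h4 := h2.comp hF
  refine tendsto_nhds_unique h3 (h4.congr fun i => ?_)
  exact (h i).symm

theorem IsSobolevExtension.add {σ : ℝ} {p : ℝ≥0∞} [Fact (1 ≤ p)] {I : Set ℝ} {g₁ g₂ g : ℝ → ℂ}
    {F₁ F₂ : Lp ℂ p (volume : Measure ℝ)} (h₁ : IsSobolevExtension σ p I g₁ F₁)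
    (h₂ : IsSobolevExtension σ p I g₂ F₂) (hg : g =ᵐ[volume.restrict I] g₁ + g₂) :
    IsSobolevExtension σ p I g (F₁ + F₂) := by
  obtain ⟨U₁, e₁, a₁⟩ := h₁
  obtain ⟨U₂, e₂, a₂⟩ := h₂
  refine ⟨U₁ + U₂, ?_, ?_⟩
  · rw [← Lp.toTemperedDistributionCLM_apply, ← Lp.toTemperedDistributionCLM_apply, map_add,
      map_add, map_add, Lp.toTemperedDistributionCLM_apply, Lp.toTemperedDistributionCLM_apply,
      Lp.toTemperedDistributionCLM_apply, Lp.toTemperedDistributionCLM_apply, e₁, e₂]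
  · filter_upwards [ae_restrict_of_ae (Lp.coeFn_add U₁ U₂), a₁, a₂, hg] with x h1 h2 h3 h4
    rw [h1, h4, Pi.add_apply, Pi.add_apply, h2, h3]

theorem IsSobolevExtension.const_smul {σ : ℝ} {p : ℝ≥0∞} [Fact (1 ≤ p)] {I : Set ℝ} {g₁ g : ℝ → ℂ}
    {F₁ : Lp ℂ p (volume : Measure ℝ)} (h₁ : IsSobolevExtension σ p I g₁ F₁) (c : ℂ)
    (hg : g =ᵐ[volume.restrict I] c • g₁) :
    IsSobolevExtension σ p I g (c • F₁) := by
  obtain ⟨U₁, e₁, a₁⟩ := h₁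
  refine ⟨c • U₁, ?_, ?_⟩
  · rw [← Lp.toTemperedDistributionCLM_apply, ← Lp.toTemperedDistributionCLM_apply, map_smul,
      map_smul, map_smul, Lp.toTemperedDistributionCLM_apply, Lp.toTemperedDistributionCLM_apply,
      e₁]
  · filter_upwards [ae_restrict_of_ae (Lp.coeFn_smul c U₁), a₁, hg] with x h1 h2 h4
    rw [h1, h4, Pi.smul_apply, Pi.smul_apply, h2]

theorem IsSobolevExtension.sobolevNorm_le {σ : ℝ} {p : ℝ≥0∞} [Fact (1 ≤ p)] {I : Set ℝ}
    {g : ℝ → ℂ} {F : Lp ℂ p (volume : Measure ℝ)} (h : IsSobolevExtension σ p I g F) :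
    sobolevNorm σ p I g ≤ ‖F‖ₑ := iInf₂_le F h

theorem sobolevNorm_add_le {σ : ℝ} {p : ℝ≥0∞} [Fact (1 ≤ p)] {I : Set ℝ} {g₁ g₂ g : ℝ → ℂ}
    (hg : g =ᵐ[volume.restrict I] g₁ + g₂) :
    sobolevNorm σ p I g ≤ sobolevNorm σ p I g₁ + sobolevNorm σ p I g₂ := by
  refine ENNReal.le_of_forall_pos_le_add fun ε hε hlt => ?_
  have h1 : sobolevNorm σ p I g₁ ≠ ⊤ := ne_top_of_le_ne_top hlt.ne le_self_add
  have h2 : sobolevNorm σ p I g₂ ≠ ⊤ := ne_top_of_le_ne_top hlt.ne le_add_self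
  have hε2 : ((ε / 2 : ℝ≥0) : ℝ≥0∞) ≠ 0 := by simpa using hε.ne'
  have l1 := ENNReal.lt_add_right h1 hε2
  have l2 := ENNReal.lt_add_right h2 hε2
  conv_lhs at l1 => rw [sobolevNorm]
  conv_lhs at l2 => rw [sobolevNorm]
  simp only [iInf_lt_iff] at l1 l2
  obtain ⟨F₁, hF₁, l1⟩ := l1
  obtain ⟨F₂, hF₂, l2⟩ := l2
  refine ((hF₁.add hF₂ hg).sobolevNorm_le.trans (enorm_add_le _ _)).trans
    ((add_le_add l1.le l2.le).trans (le_of_eq ?_))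
  have : (ε : ℝ≥0∞) = ((ε / 2 : ℝ≥0) : ℝ≥0∞) + ((ε / 2 : ℝ≥0) : ℝ≥0∞) := by
    rw [← ENNReal.coe_add, add_halves]
  rw [this]
  ring

/-- Cauchy criterion: a finite sum outside a large finite set is controlled by the tail of `e`,
which tends to zero. The norm bound then passes to the limit. -/
theorem summable_of_enorm_sum_pow_le {ι X : Type*} [NormedAddCommGroup X] [CompleteSpace X]
    {x : ι → X} {e : ι → ℝ≥0∞} (he : ∑' i, e i ≠ ⊤) {C : ℝ≥0} {k m : ℕ} (hm : m ≠ 0)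
    (h : ∀ S : Finset ι, ‖∑ i ∈ S, x i‖ₑ ^ k ≤ C * (∑ i ∈ S, e i) ^ m) :
    Summable x ∧ ‖∑' i, x i‖ₑ ^ k ≤ C * (∑' i, e i) ^ m := by
  have hs : Summable x := by
    rw [summable_iff_vanishing_norm]
    intro ε hε
    have hpos : (0 : ℝ≥0∞) < ENNReal.ofReal ε ^ k :=
      ENNReal.pow_pos (ENNReal.ofReal_pos.2 hε) k
    have ht : Tendsto (fun r : ℝ≥0∞ => (C : ℝ≥0∞) * r ^ m) (𝓝 0) (𝓝 0) := by
      have h1 : Continuous fun r : ℝ≥0∞ => (C : ℝ≥0∞) * r ^ m :=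
        (ENNReal.continuous_const_mul ENNReal.coe_ne_top).comp (ENNReal.continuous_pow m)
      have := h1.tendsto 0
      rwa [zero_pow hm, mul_zero] at this
    have h2 := (ENNReal.tendsto_tsum_compl_atTop_zero he)
    obtain ⟨s, hs⟩ := ((ht.comp h2).eventually_lt_const hpos).exists
    refine ⟨s, fun t hts => ?_⟩
    have h3 : ∑ i ∈ t, e i ≤ ∑' i : { i // i ∉ s }, e i := by
      classical
      have hsub : ∀ i ∈ t, i ∉ s := fun i hi his => (Finset.disjoint_left.1 hts) hi his
      calc ∑ i ∈ t, e i = ∑ i ∈ t.subtype (fun i => i ∉ s), e i := by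
            rw [Finset.sum_subtype_eq_sum_filter, Finset.filter_true_of_mem hsub]
        _ ≤ _ := ENNReal.sum_le_tsum (f := fun i : { i // i ∉ s } => e i) _
    have h4 : ‖∑ i ∈ t, x i‖ₑ ^ k < ENNReal.ofReal ε ^ k :=
      lt_of_le_of_lt ((h t).trans (mul_le_mul_right (pow_le_pow_left' h3 m) _)) hs
    have h5 : ‖∑ i ∈ t, x i‖ₑ < ENNReal.ofReal ε := lt_of_pow_lt_pow_left' k h4
    rwa [← ofReal_norm, ENNReal.ofReal_lt_ofReal_iff hε] at h5
  refine ⟨hs, ?_⟩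
  have h1 : Tendsto (fun S : Finset ι => ‖∑ i ∈ S, x i‖ₑ ^ k) atTop (𝓝 (‖∑' i, x i‖ₑ ^ k)) :=
    (ENNReal.continuous_pow k).tendsto _ |>.comp (hs.hasSum.enorm)
  refine le_of_tendsto h1 (.of_forall fun S => (h S).trans ?_)
  gcongr
  exact ENNReal.sum_le_tsum S

theorem eLpNorm_natCast_pow {Z : Type*} [MeasurableSpace Z] {μ : Measure Z} (f : Z → ℂ) {k : ℕ}
    (hk : k ≠ 0) : eLpNorm f k μ ^ k = ∫⁻ z, ‖f z‖ₑ ^ k ∂μ := by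
  rw [eLpNorm_eq_lintegral_rpow_enorm_toReal (by exact_mod_cast hk) (ENNReal.natCast_ne_top k),
    ENNReal.toReal_natCast, ← ENNReal.rpow_natCast, ← ENNReal.rpow_mul, one_div,
    inv_mul_cancel₀ (by exact_mod_cast hk), ENNReal.rpow_one]
  simp_rw [ENNReal.rpow_natCast]

theorem besselSchwartz_zero (g : 𝓢(ℝ, ℂ)) : besselSchwartz 0 g = g := by
  simp [besselSchwartz]

theorem besselSymbol_zero (y : ℝ) : besselSymbol 0 y = 1 := by
  simp [besselSymbol]

theorem one_le_besselSymbol {σ : ℝ} (hσ : 0 ≤ σ) (y : ℝ) : 1 ≤ besselSymbol σ y :=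
  Real.one_le_rpow (by nlinarith [sq_nonneg y]) (by linarith)

/-- The square case of the transfer to the line, with a one-point parameter space in place of time;
its hypothesis is Parseval's identity. -/
theorem exists_enorm_sum_bessel_sq_le {σ : ℝ} (hσ : σ ∈ Icc (0 : ℝ) 1) :
    ∃ C : ℝ≥0, ∀ (c : ℤ → ℂ) (S : Finset ℤ),
      ‖∑ n ∈ S, c n • (besselSchwartz σ (modSchwartz n)).toLp 2 (volume : Measure ℝ)‖ₑ ^ 2 ≤
        C * (∑ n ∈ S, ‖(besselSymbol σ (n / 2) : ℂ) * c n‖ₑ ^ 2) ^ 1 := by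
  obtain ⟨C, hC⟩ := exists_lintegral_besselSchwartz_sum_le hσ (le_refl 1)
  refine ⟨C * 2, fun c S => ?_⟩
  have h := hC (Measure.dirac ()) (fun n _ => c n) (fun n => measurable_const) S
    (2 * ∑ n ∈ S, ‖(besselSymbol σ (n / 2) : ℂ) * c n‖ₑ ^ 2) (fun b hb => by
      rw [lintegral_prod _ (by
        refine Measurable.aemeasurable (Measurable.pow_const (Measurable.enorm ?_) _)
        refine Finset.measurable_fun_sum _ fun n _ => ?_
        exact ((continuous_expo n).measurable.comp measurable_fst).const_mul _)]
      simp only [lintegral_dirac]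
      rw [lintegral_expo_sum_sq]
      gcongr with n hn
      rw [enorm_mul]
      refine mul_le_of_le_one_left zero_le ?_
      rw [← ofReal_norm]
      exact ENNReal.ofReal_le_one.2 (hb n))
  rw [lintegral_prod _ (by
        refine Measurable.aemeasurable (Measurable.pow_const (Measurable.enorm ?_) _)
        refine Finset.measurable_fun_sum _ fun n _ => ?_
        exact ((besselSchwartz σ (modSchwartz n)).continuous.measurable.comp
          measurable_fst).const_mul _)] at h
  simp only [lintegral_dirac] at h
  have e1 : ∑ n ∈ S, c n • (besselSchwartz σ (modSchwartz n)).toLp 2 (volume : Measure ℝ) =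
      (∑ n ∈ S, c n • besselSchwartz σ (modSchwartz n)).toLp 2 volume := by
    have := map_sum (SchwartzMap.toLpCLM ℂ ℂ 2 (volume : Measure ℝ))
      (fun n => c n • besselSchwartz σ (modSchwartz n)) S
    simp only [map_smul, SchwartzMap.toLpCLM_apply] at this
    exact this.symm
  rw [e1, Lp.enorm_def, eLpNorm_congr_ae (SchwartzMap.coeFn_toLp _ _ _), pow_one, ENNReal.coe_mul]
  have e2 := eLpNorm_natCast_pow (μ := (volume : Measure ℝ))
    (∑ n ∈ S, c n • besselSchwartz σ (modSchwartz n) : 𝓢(ℝ, ℂ)) two_ne_zero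
  rw [Nat.cast_ofNat] at e2
  rw [e2]
  refine le_trans (le_of_eq (lintegral_congr fun x => ?_)) (h.trans (le_of_eq ?_))
  · congr 2
    simp
  · push_cast; ring

/-- The sum of a series of modulated cutoffs and of its Bessel potential. -/
theorem exists_hasSum_bessel {σ : ℝ} (hσ : σ ∈ Icc (0 : ℝ) 1) :
    ∃ C : ℝ≥0, ∀ c : ℤ → ℂ, ∑' n : ℤ, ‖(besselSymbol σ (n / 2) : ℂ) * c n‖ₑ ^ 2 ≠ ⊤ →
      ∃ U F : Lp ℂ 2 (volume : Measure ℝ),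
        HasSum (fun n => c n • (modSchwartz n).toLp 2 (volume : Measure ℝ)) U ∧
        TemperedDistribution.besselPotential ℝ ℂ σ (U : 𝓢'(ℝ, ℂ)) = (F : 𝓢'(ℝ, ℂ)) ∧
        ‖F‖ₑ ^ 2 ≤ C * ∑' n : ℤ, ‖(besselSymbol σ (n / 2) : ℂ) * c n‖ₑ ^ 2 := by
  obtain ⟨C, hC⟩ := exists_enorm_sum_bessel_sq_le hσ
  obtain ⟨C₀, hC₀⟩ := exists_enorm_sum_bessel_sq_le (σ := 0) (by simp)
  refine ⟨C, fun c hc => ?_⟩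
  have h1 := summable_of_enorm_sum_pow_le hc one_ne_zero (hC c)
  have hc0 : ∑' n : ℤ, ‖c n‖ₑ ^ 2 ≠ ⊤ := by
    refine ne_top_of_le_ne_top hc (ENNReal.tsum_le_tsum fun n => ?_)
    gcongr
    rw [enorm_mul]
    refine le_mul_of_one_le_left zero_le ?_
    rw [← ofReal_norm, Complex.norm_real, Real.norm_of_nonneg (besselSymbol_nonneg _ _)]
    exact ENNReal.one_le_ofReal.2 (one_le_besselSymbol hσ.1 _)
  have h2 := summable_of_enorm_sum_pow_le (x := fun n =>
    c n • (modSchwartz n).toLp 2 (volume : Measure ℝ)) hc0 one_ne_zero (fun S => by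
      simpa only [besselSchwartz_zero, besselSymbol_zero, Complex.ofReal_one, one_mul]
        using hC₀ c S)
  refine ⟨_, _, h2.1.hasSum, ?_, by simpa only [pow_one] using h1.2⟩
  -- The series of cut modes and the series of their potentials converge along the same finite sets,
  -- so closedness relates their sums.
  refine besselPotential_eq_of_tendsto h2.1.hasSum h1.1.hasSum fun S => ?_
  rw [← Lp.toTemperedDistributionCLM_apply, ← Lp.toTemperedDistributionCLM_apply, map_sum, map_sum,
    map_sum]
  refine Finset.sum_congr rfl fun n _ => ?_
  rw [map_smul, map_smul, map_smul, Lp.toTemperedDistributionCLM_apply,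
    Lp.toTemperedDistributionCLM_apply, besselPotential_toLp]

/-! ### Trigonometric modes on the unit interval -/

/-- Restriction to the unit interval. -/
def restrictUnit : Lp ℂ 2 (volume : Measure ℝ) →L[ℂ] LTwo :=
  LpToLpRestrictCLM ℝ ℂ ℂ volume 2 (Ioo 0 1)

theorem restrictUnit_coeFn (U : Lp ℂ 2 (volume : Measure ℝ)) :
    restrictUnit U =ᵐ[volume.restrict (Ioo 0 1)] U := LpToLpRestrictCLM_coeFn ℂ _ U

/-- The class in `L²(0,1)` of a smooth function on the line. -/
def smoothUnit (p : ℝ → ℂ) (hp : ContDiff ℝ ∞ p) : LTwo :=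
  restrictUnit ((cutSchwartz p hp).toLp 2)

theorem smoothUnit_coeFn (p : ℝ → ℂ) (hp : ContDiff ℝ ∞ p) :
    smoothUnit p hp =ᵐ[volume.restrict (Ioo 0 1)] p := by
  filter_upwards [restrictUnit_coeFn ((cutSchwartz p hp).toLp 2),
    ae_restrict_of_ae ((cutSchwartz p hp).coeFn_toLp 2 volume),
    ae_restrict_mem measurableSet_Ioo] with x h1 h2 hx
  rw [smoothUnit, h1, h2, cutSchwartz_apply, cutoff_eq_one hx, mul_one]

theorem isSobolevExtension_smoothUnit (σ : ℝ) (q : ℝ≥0∞) [Fact (1 ≤ q)] (p : ℝ → ℂ)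
    (hp : ContDiff ℝ ∞ p) : IsSobolevExtension σ q (Ioo 0 1) (smoothUnit p hp)
      ((besselSchwartz σ (cutSchwartz p hp)).toLp q) := by
  refine ⟨(cutSchwartz p hp).toLp q, by rw [besselPotential_toLp], ?_⟩
  filter_upwards [smoothUnit_coeFn p hp,
    ae_restrict_of_ae ((cutSchwartz p hp).coeFn_toLp q volume),
    ae_restrict_mem measurableSet_Ioo] with x h1 h2 hx
  rw [h1, h2, cutSchwartz_apply, cutoff_eq_one hx, mul_one]

/-- The character `e^{inπx}` in `L²(0,1)`. -/
def mode (n : ℤ) : LTwo := smoothUnit (expo n) (contDiff_expo n)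

theorem mode_coeFn (n : ℤ) : mode n =ᵐ[volume.restrict (Ioo 0 1)] expo n :=
  smoothUnit_coeFn _ _

/-- Trigonometric series with square summable weighted coefficients in Sobolev spaces on the unit
interval. -/
theorem exists_hasSum_mode {σ : ℝ} (hσ : σ ∈ Icc (0 : ℝ) 1) :
    ∃ C : ℝ≥0, ∀ c : ℤ → ℂ, ∑' n : ℤ, ‖(besselSymbol σ (n / 2) : ℂ) * c n‖ₑ ^ 2 ≠ ⊤ →
      Summable (fun n => c n • mode n) ∧
        sobolevNorm σ 2 (Ioo 0 1) (∑' n, c n • mode n : LTwo) ^ 2 ≤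
          C * ∑' n : ℤ, ‖(besselSymbol σ (n / 2) : ℂ) * c n‖ₑ ^ 2 := by
  obtain ⟨C, hC⟩ := exists_hasSum_bessel hσ
  refine ⟨C, fun c hc => ?_⟩
  obtain ⟨U, F, hU, hJ, hF⟩ := hC c hc
  have h1 : HasSum (fun n => c n • mode n) (restrictUnit U) := by
    have := hU.mapL restrictUnit
    simpa only [map_smul, mode, smoothUnit, modSchwartz] using this
  refine ⟨h1.summable, le_trans ?_ hF⟩
  rw [h1.tsum_eq]
  gcongr
  exact IsSobolevExtension.sobolevNorm_le ⟨U, hJ, (restrictUnit_coeFn U).symm⟩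

/-! ### Trigonometric series in `L⁴(0,T; H^{σ,4}(0,1))` -/

theorem besselSchwartz_sum_smul (σ : ℝ) (S : Finset ℤ) (c : ℤ → ℂ) (g : ℤ → 𝓢(ℝ, ℂ)) :
    besselSchwartz σ (∑ n ∈ S, c n • g n) = ∑ n ∈ S, c n • besselSchwartz σ (g n) := by
  simp only [besselSchwartz, map_sum, map_smul]

theorem schwartz_sum_smul_apply (S : Finset ℤ) (c : ℤ → ℂ) (g : ℤ → 𝓢(ℝ, ℂ)) (x : ℝ) :
    (∑ n ∈ S, c n • g n) x = ∑ n ∈ S, c n * g n x := by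
  simp

/-- The measure on the strip `ℝ × (0,T)`. -/
def strip (T : ℝ) : Measure (ℝ × ℝ) := (volume : Measure ℝ).prod (volume.restrict (Ioo 0 T))

theorem strip_eq (T : ℝ) : strip T = volume.restrict (univ ×ˢ Ioo 0 T) := by
  rw [strip, Measure.volume_eq_prod, ← Measure.prod_restrict, Measure.restrict_univ]

/-- The bound on finite sums gives unconditional convergence in the complete space `L⁴` of the
strip. The limit is kept as an actual strongly measurable function, since its time slices are
needed. -/
theorem exists_lFour_sum {T : ℝ} {a : ℤ → ℝ → ℂ} (ha : ∀ n, Measurable (a n)) (g : ℤ → 𝓢(ℝ, ℂ))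
    {e : ℤ → ℝ≥0∞} (he : ∑' n, e n ≠ ⊤) {K : ℝ≥0}
    (h : ∀ S : Finset ℤ, ∫⁻ z, ‖∑ n ∈ S, a n z.2 * g n z.1‖ₑ ^ 4 ∂(strip T) ≤
      K * (∑ n ∈ S, e n) ^ 2) :
    ∃ G : ℝ × ℝ → ℂ, StronglyMeasurable G ∧ MemLp G 4 (strip T) ∧
      ∫⁻ z, ‖G z‖ₑ ^ 4 ∂(strip T) ≤ K * (∑' n, e n) ^ 2 ∧
      Tendsto (fun S : Finset ℤ => ∫⁻ z, ‖∑ n ∈ S, a n z.2 * g n z.1 - G z‖ₑ ^ 4 ∂(strip T))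
        atTop (𝓝 0) := by
  have hpow := fun f : ℝ × ℝ → ℂ => eLpNorm_natCast_pow (μ := strip T) f four_ne_zero
  simp only [Nat.cast_ofNat] at hpow
  have hm : ∀ n, Measurable fun z : ℝ × ℝ => a n z.2 * g n z.1 := fun n =>
    ((ha n).comp measurable_snd).mul ((g n).continuous.measurable.comp measurable_fst)
  have hmem : ∀ n, MemLp (fun z : ℝ × ℝ => a n z.2 * g n z.1) 4 (strip T) := by
    intro n
    refine ⟨(hm n).aestronglyMeasurable, ?_⟩
    have h1 := h {n}
    simp only [Finset.sum_singleton] at h1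
    rw [← hpow] at h1
    have h2 : (K : ℝ≥0∞) * e n ^ 2 < ⊤ := ENNReal.mul_lt_top ENNReal.coe_lt_top
      (ENNReal.pow_lt_top (lt_of_le_of_lt (ENNReal.le_tsum n) he.lt_top))
    exact (ENNReal.pow_lt_top_iff.1 (h1.trans_lt h2)).resolve_right four_ne_zero
  set x : ℤ → Lp ℂ 4 (strip T) := fun n => (hmem n).toLp _ with hx
  have hxS : ∀ S : Finset ℤ, (∑ n ∈ S, x n : Lp ℂ 4 (strip T)) =ᵐ[strip T]
      fun z => ∑ n ∈ S, a n z.2 * g n z.1 := by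
    intro S
    have h1 : (∑ n ∈ S, x n : Lp ℂ 4 (strip T)) = (memLp_finsetSum S fun n _ => hmem n).toLp _ := by
      classical
      induction S using Finset.induction_on with
      | empty => simp only [Finset.sum_empty]; rfl
      | insert n S hn ih =>
        simp only [Finset.sum_insert hn]
        rw [ih]
        rfl
    rw [h1]
    exact MemLp.coeFn_toLp _
  obtain ⟨h1, h2⟩ := summable_of_enorm_sum_pow_le (x := x) he (C := K) (k := 4) (m := 2)
    two_ne_zero (fun S => by
      rw [Lp.enorm_def, eLpNorm_congr_ae (hxS S), hpow]; exact h S)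
  set G := ∑' n, x n with hG
  refine ⟨G, Lp.stronglyMeasurable G, Lp.memLp G, ?_, ?_⟩
  · rw [← hpow, ← Lp.enorm_def]; exact h2
  · have h3 : Tendsto (fun S : Finset ℤ => ‖∑ n ∈ S, x n - G‖ₑ ^ 4) atTop (𝓝 0) := by
      have := (h1.hasSum.sub_const G).enorm
      rw [sub_self, enorm_zero] at this
      have h4 := ((ENNReal.continuous_pow 4).tendsto 0).comp this
      rw [zero_pow four_ne_zero] at h4
      exact h4
    refine h3.congr fun S => ?_
    rw [Lp.enorm_def, hpow]
    refine lintegral_congr_ae ?_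
    filter_upwards [Lp.coeFn_sub (∑ n ∈ S, x n) G, hxS S] with z e1 e2
    rw [e1, Pi.sub_apply, e2]

/-- Along a subsequence the integrals are below `2^{-j}`, so the sum of the slices is integrable,
hence finite almost everywhere, and its terms tend to zero. -/
theorem exists_subseq_slice_tendsto {T : ℝ} {D : ℕ → ℝ → ℝ≥0∞} (hD : ∀ j, Measurable (D j))
    (h : Tendsto (fun j => ∫⁻ t in Ioo 0 T, D j t) atTop (𝓝 0)) :
    ∃ φ : ℕ → ℕ, StrictMono φ ∧
      ∀ᵐ t ∂(volume.restrict (Ioo 0 T)), Tendsto (fun j => D (φ j) t) atTop (𝓝 0) := by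
  obtain ⟨φ, hφ, hle⟩ := extraction_forall_of_eventually
    (P := fun j k => ∫⁻ t in Ioo 0 T, D k t < 2⁻¹ ^ j) (fun j => by
      exact h.eventually_lt_const (ENNReal.pow_pos (by simp) j))
  refine ⟨φ, hφ, ?_⟩
  have h1 : ∫⁻ t in Ioo 0 T, ∑' j, D (φ j) t ≠ ⊤ := by
    rw [lintegral_tsum fun j => (hD _).aemeasurable]
    refine ne_top_of_le_ne_top ?_ (ENNReal.tsum_le_tsum fun j => (hle j).le)
    rw [ENNReal.tsum_geometric]
    simp
  filter_upwards [ae_lt_top (Measurable.tsum fun j => hD _) h1] with t ht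
  exact ENNReal.tendsto_atTop_zero_of_tsum_ne_top ht.ne

theorem tendsto_toLp_of_lintegral {ι : Type*} {l : Filter ι} {P : ι → 𝓢(ℝ, ℂ)} {G : ℝ → ℂ}
    (hG : MemLp G 4 (volume : Measure ℝ))
    (h : Tendsto (fun i => ∫⁻ x, ‖P i x - G x‖ₑ ^ 4) l (𝓝 0)) :
    Tendsto (fun i => (P i).toLp 4 (volume : Measure ℝ)) l (𝓝 (hG.toLp G)) := by
  have hpow := fun f : ℝ → ℂ => eLpNorm_natCast_pow (μ := (volume : Measure ℝ)) f four_ne_zero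
  simp only [Nat.cast_ofNat] at hpow
  rw [tendsto_iff_edist_tendsto_0]
  have h1 : Tendsto (fun i => (∫⁻ x, ‖P i x - G x‖ₑ ^ 4) ^ (1 / 4 : ℝ)) l (𝓝 0) := by
    have := (ENNReal.continuous_rpow_const (y := (1 / 4 : ℝ))).tendsto 0 |>.comp h
    rwa [ENNReal.zero_rpow_of_pos (by norm_num)] at this
  refine h1.congr fun i => ?_
  rw [SchwartzMap.toLp, Lp.edist_toLp_toLp, ← show ∀ f : ℝ → ℂ, (∫⁻ x, ‖f x‖ₑ ^ 4) ^ (1 / 4 : ℝ) =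
    eLpNorm f 4 volume from fun f => by
      rw [← hpow, ← ENNReal.rpow_natCast, ← ENNReal.rpow_mul]; norm_num]
  rfl

/-- The cut modes and their potentials are summed separately in `L⁴` of the strip, to `U` and `F`.
For almost every `t` a common subsequence of symmetric partial sums converges in both slices:
closedness of the Bessel potential links `U(·,t)` to `F(·,t)`, and the limit on `(0,1)` identifies
`U(·,t)` with `w t`. -/
theorem exists_lFourSobolevBound {σ : ℝ} (hσ : σ ∈ Icc (0 : ℝ) 1) :
    ∃ K : ℝ≥0, ∀ (T : ℝ) (a : ℤ → ℝ → ℂ), (∀ n, Measurable (a n)) → ∀ (e : ℤ → ℝ≥0∞),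
      ∑' n, e n ≠ ⊤ → ∀ C : ℝ≥0,
      (∀ (S : Finset ℤ) (b : ℤ → ℂ), (∀ n, ‖b n‖ ≤ 1) →
        ∫⁻ z, ‖∑ n ∈ S, b n * ((besselSymbol σ (n / 2) : ℂ) * a n z.2) * expo n z.1‖ₑ ^ 4
          ∂(cell T) ≤ C * (∑ n ∈ S, e n) ^ 2) → ∀ w : ℝ → LTwo,
      (∀ᵐ t ∂(volume.restrict (Ioo 0 T)), HasSum (fun n => a n t • mode n) (w t)) →
      ∀ B : ℝ≥0∞, K * C * (∑' n, e n) ^ 2 ≤ B ^ 4 → LFourSobolevBound σ T w B := by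
  obtain ⟨C₁, hC₁⟩ := exists_lintegral_besselSchwartz_sum_le hσ (k := 3) (by norm_num)
  obtain ⟨C₀, hC₀⟩ := exists_lintegral_besselSchwartz_sum_le (σ := 0) (by simp) (k := 3)
    (by norm_num)
  refine ⟨C₁, fun T a ha e he C h w hw B hB => ?_⟩
  have hpow := fun f : ℝ × ℝ → ℂ => eLpNorm_natCast_pow (μ := strip T) f four_ne_zero
  have hpow1 := fun f : ℝ → ℂ => eLpNorm_natCast_pow (μ := (volume : Measure ℝ)) f four_ne_zero
  simp only [Nat.cast_ofNat] at hpow hpow1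
  obtain ⟨F, hFm, hF, hFle, hFt⟩ := exists_lFour_sum (T := T) ha
    (fun n => besselSchwartz σ (modSchwartz n)) he (K := C₁ * C) (fun S => by
      have := hC₁ (volume.restrict (Ioo 0 T)) a ha S _ (h S)
      rw [ENNReal.coe_mul, mul_assoc]
      exact this)
  obtain ⟨U, hUm, hU, -, hUt⟩ := exists_lFour_sum (T := T) ha
    modSchwartz he (K := C₀ * C) (fun S => by
      have := hC₀ (volume.restrict (Ioo 0 T)) a ha S (C * (∑ n ∈ S, e n) ^ 2) (fun b hb => by
        refine le_trans (le_of_eq (lintegral_congr fun z => ?_))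
          -- The order-zero bound needed for `U` follows from the given one by dividing the
          -- multipliers by `besselSymbol`, which is at least one.
          (h S (fun n => b n / (besselSymbol σ (n / 2) : ℂ)) fun n => ?_)
        · congr 2
          refine Finset.sum_congr rfl fun n _ => ?_
          have h1 : (besselSymbol σ (n / 2) : ℂ) ≠ 0 := by
            exact_mod_cast (besselSymbol_pos σ (n / 2)).ne'
          rw [besselSymbol_zero]
          field_simp
          simp
        · rw [norm_div, Complex.norm_real, Real.norm_of_nonneg (besselSymbol_nonneg _ _)]
          exact div_le_one_of_le₀ ((hb n).trans (one_le_besselSymbol hσ.1 _))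
            (besselSymbol_nonneg _ _))
      simp only [besselSchwartz_zero] at this
      rw [ENNReal.coe_mul, mul_assoc]
      exact this)
  refine ⟨F, strip_eq T ▸ hF, ?_, ?_⟩
  · rw [← strip_eq]
    refine (ENNReal.pow_right_strictMono four_ne_zero).le_iff_le.1 ?_
    rw [hpow]
    exact hFle.trans (by rwa [ENNReal.coe_mul])
  have hm : ∀ g : ℤ → 𝓢(ℝ, ℂ), ∀ S : Finset ℤ,
      Measurable fun z : ℝ × ℝ => ∑ n ∈ S, a n z.2 * g n z.1 := fun g S =>
    Finset.measurable_fun_sum _ fun n _ =>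
      ((ha n).comp measurable_snd).mul ((g n).continuous.measurable.comp measurable_fst)
  -- Both errors are added so that a single subsequence serves both.
  set d : ℕ → ℝ × ℝ → ℝ≥0∞ := fun j z =>
    ‖∑ n ∈ Finset.Icc (-(j : ℤ)) j, a n z.2 * modSchwartz n z.1 - U z‖ₑ ^ 4 +
    ‖∑ n ∈ Finset.Icc (-(j : ℤ)) j, a n z.2 * besselSchwartz σ (modSchwartz n) z.1 - F z‖ₑ ^ 4
    with hd
  have hdm1 : ∀ j : ℕ, Measurable fun z : ℝ × ℝ =>
      ‖∑ n ∈ Finset.Icc (-(j : ℤ)) j, a n z.2 * modSchwartz n z.1 - U z‖ₑ ^ 4 := fun j =>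
    (((hm _ _).sub hUm.measurable).enorm.pow_const 4)
  have hdm2 : ∀ j : ℕ, Measurable fun z : ℝ × ℝ =>
      ‖∑ n ∈ Finset.Icc (-(j : ℤ)) j, a n z.2 * besselSchwartz σ (modSchwartz n) z.1 -
        F z‖ₑ ^ 4 := fun j =>
    (((hm _ _).sub hFm.measurable).enorm.pow_const 4)
  have hdm : ∀ j, Measurable (d j) := fun j => (hdm1 j).add (hdm2 j)
  have hIcc : Tendsto (fun j : ℕ => Finset.Icc (-(j : ℤ)) j) atTop atTop :=
    Finset.tendsto_Icc_neg.comp tendsto_natCast_atTop_atTop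
  obtain ⟨φ, hφ, hae⟩ := exists_subseq_slice_tendsto (T := T) (D := fun j t => ∫⁻ x, d j (x, t))
    (fun j => (hdm j).lintegral_prod_left') (by
      have h1 := (hUt.comp hIcc).add (hFt.comp hIcc)
      rw [add_zero] at h1
      refine h1.congr fun j => ?_
      simp only [Function.comp]
      rw [← lintegral_add_left (hdm1 j), strip, lintegral_prod_symm _ (hdm j).aemeasurable])
  have hslice : ∀ G : ℝ × ℝ → ℂ, StronglyMeasurable G → MemLp G 4 (strip T) →
      ∀ᵐ t ∂(volume.restrict (Ioo 0 T)), MemLp (fun x => G (x, t)) 4 (volume : Measure ℝ) := by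
    intro G hGm hG
    have h1 : ∫⁻ z, ‖G z‖ₑ ^ 4 ∂(strip T) ≠ ⊤ := by
      rw [← hpow]
      exact ENNReal.pow_ne_top hG.2.ne
    have hGm4 : Measurable fun z => ‖G z‖ₑ ^ 4 := hGm.measurable.enorm.pow_const 4
    rw [strip, lintegral_prod_symm _ hGm4.aemeasurable] at h1
    filter_upwards [ae_lt_top hGm4.lintegral_prod_left' h1] with t ht
    refine ⟨(hGm.comp_measurable measurable_prodMk_right).aestronglyMeasurable, ?_⟩
    rw [← hpow1] at ht
    exact (ENNReal.pow_lt_top_iff.1 ht).resolve_right four_ne_zero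
  filter_upwards [hae, hslice U hUm hU, hslice F hFm hF, hw] with t ht hUt' hFt' hwt
  refine ⟨hFt', hUt'.toLp _, ?_, ?_⟩
  · set P : ℕ → 𝓢(ℝ, ℂ) := fun j =>
      ∑ n ∈ Finset.Icc (-(φ j : ℤ)) (φ j), a n t • modSchwartz n with hP
    have hPt : Tendsto (fun j => (P j).toLp 4 (volume : Measure ℝ)) atTop (𝓝 (hUt'.toLp _)) := by
      refine tendsto_toLp_of_lintegral hUt' (tendsto_of_tendsto_of_tendsto_of_le_of_le
        tendsto_const_nhds ht (fun _ => zero_le) fun j => ?_)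
      refine lintegral_mono fun x => ?_
      simp only [hd, hP, schwartz_sum_smul_apply]
      exact le_self_add
    have hQt : Tendsto (fun j => (besselSchwartz σ (P j)).toLp 4 (volume : Measure ℝ)) atTop
        (𝓝 (hFt'.toLp _)) := by
      refine tendsto_toLp_of_lintegral hFt' (tendsto_of_tendsto_of_tendsto_of_le_of_le
        tendsto_const_nhds ht (fun _ => zero_le) fun j => ?_)
      refine lintegral_mono fun x => ?_
      simp only [hd, hP, besselSchwartz_sum_smul, schwartz_sum_smul_apply]
      exact le_add_self
    exact besselPotential_eq_of_tendsto hPt hQt fun j => by rw [besselPotential_toLp]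
  · set P : ℕ → 𝓢(ℝ, ℂ) := fun j =>
      ∑ n ∈ Finset.Icc (-(φ j : ℤ)) (φ j), a n t • modSchwartz n with hP
    have hPt : Tendsto (fun j => (P j).toLp 4 (volume : Measure ℝ)) atTop (𝓝 (hUt'.toLp _)) := by
      refine tendsto_toLp_of_lintegral hUt' (tendsto_of_tendsto_of_tendsto_of_le_of_le
        tendsto_const_nhds ht (fun _ => zero_le) fun j => ?_)
      refine lintegral_mono fun x => ?_
      simp only [hd, hP, schwartz_sum_smul_apply]
      exact le_self_add
    -- The partial sums converge in `L⁴` to the slice of `U` and in `L²(0,1)` to `w t`. Convergence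
    -- in measure is the common weaker notion, and its limit is unique.
    have m1 : TendstoInMeasure (volume.restrict (Ioo (0 : ℝ) 1)) (fun j x => P j x) atTop
        (hUt'.toLp _) := by
      have := tendstoInMeasure_of_tendsto_Lp (((LpToLpRestrictCLM ℝ ℂ ℂ volume 4
        (Ioo (0 : ℝ) 1)).continuous.tendsto _).comp hPt)
      refine (this.congr_left fun j => ?_).congr_right (LpToLpRestrictCLM_coeFn ℂ _ _)
      filter_upwards [LpToLpRestrictCLM_coeFn ℂ (Ioo (0 : ℝ) 1) ((P j).toLp 4 volume),
        ae_restrict_of_ae ((P j).coeFn_toLp 4 volume)] with x h1 h2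
      rw [Function.comp_apply, h1, h2]
    have m2 : TendstoInMeasure (volume.restrict (Ioo (0 : ℝ) 1)) (fun j x => P j x) atTop
        (w t) := by
      have := tendstoInMeasure_of_tendsto_Lp ((hwt.comp hIcc).comp hφ.tendsto_atTop)
      refine this.congr_left fun j => ?_
      have e1 : (∑ n ∈ Finset.Icc (-(φ j : ℤ)) (φ j), a n t • mode n) =
          restrictUnit ((P j).toLp 2 volume) := by
        have := map_sum (restrictUnit.comp (SchwartzMap.toLpCLM ℂ ℂ 2 (volume : Measure ℝ)))
          (fun n => a n t • modSchwartz n) (Finset.Icc (-(φ j : ℤ)) (φ j))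
        simp only [map_smul] at this
        exact this.symm
      simp only [Function.comp_apply]
      rw [e1]
      filter_upwards [restrictUnit_coeFn ((P j).toLp 2 volume),
        ae_restrict_of_ae ((P j).coeFn_toLp 2 volume)] with x h1 h2
      rw [h1, h2]
    exact tendstoInMeasure_ae_unique m1 m2

/-! ### Weak derivatives of series and the Fourier series of the sawtooth -/

/-- Smooth functions with compact support in `(0,1)`. -/
structure IsTest (φ : ℝ → ℂ) : Prop where
  contDiff : ContDiff ℝ ∞ φ
  compact : HasCompactSupport φ
  supp : tsupport φ ⊆ Ioo 0 1

theorem IsTest.deriv {φ : ℝ → ℂ} (h : IsTest φ) : IsTest (deriv φ) :=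
  ⟨(contDiff_infty_iff_deriv.1 h.contDiff).2, h.compact.deriv,
    (tsupport_deriv_subset).trans h.supp⟩

theorem IsTest.iteratedDeriv {φ : ℝ → ℂ} (h : IsTest φ) (m : ℕ) : IsTest (iteratedDeriv m φ) := by
  induction m with
  | zero => rwa [iteratedDeriv_zero]
  | succ m ih => rw [iteratedDeriv_succ]; exact ih.deriv

theorem contDiff_iteratedDeriv {f : ℝ → ℂ} (h : ContDiff ℝ ∞ f) (m : ℕ) :
    ContDiff ℝ ∞ (iteratedDeriv m f) := by
  induction m with
  | zero => rwa [iteratedDeriv_zero]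
  | succ m ih => rw [iteratedDeriv_succ]; exact (contDiff_infty_iff_deriv.1 ih).2

theorem IsTest.memLp_conj {φ : ℝ → ℂ} (h : IsTest φ) :
    MemLp (fun x => starRingEnd ℂ (φ x)) 2 (volume.restrict (Ioo (0 : ℝ) 1)) := by
  have h1 : MemLp φ 2 (volume : Measure ℝ) :=
    h.contDiff.continuous.memLp_of_hasCompactSupport h.compact
  exact (h1.restrict _).star

/-- Integration against a test function as a functional on `L²(0,1)`. -/
def IsTest.pairing {φ : ℝ → ℂ} (h : IsTest φ) : LTwo →L[ℂ] ℂ := innerSL ℂ (h.memLp_conj.toLp _)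

theorem IsTest.pairing_apply {φ : ℝ → ℂ} (h : IsTest φ) (u : LTwo) :
    h.pairing u = ∫ x in Ioo (0 : ℝ) 1, u x * φ x := by
  rw [IsTest.pairing, innerSL_apply_apply, L2.inner_def]
  refine integral_congr_ae ?_
  filter_upwards [h.memLp_conj.coeFn_toLp] with x hx
  rw [hx, RCLike.inner_apply, Complex.conj_conj]

/-- Expressing the weak derivative through continuous functionals on `L²(0,1)` makes it a closed
linear relation, so it can be taken term by term in convergent series. -/
theorem isWeakDeriv_iff {m : ℕ} {u w : LTwo} : IsWeakDeriv m (Ioo 0 1) u w ↔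
    ∀ (φ : ℝ → ℂ) (h : IsTest φ), (h.iteratedDeriv m).pairing u = (-1) ^ m * h.pairing w := by
  have hloc : ∀ g : LTwo, LocallyIntegrableOn g (Ioo (0 : ℝ) 1) := fun g =>
    IntegrableOn.locallyIntegrableOn ((Lp.memLp g).integrable (by norm_num))
  constructor
  · rintro ⟨-, -, h⟩ φ hφ
    rw [IsTest.pairing_apply, IsTest.pairing_apply]
    exact h φ hφ.contDiff hφ.compact hφ.supp
  · intro h
    refine ⟨hloc u, hloc w, fun φ h1 h2 h3 => ?_⟩
    have := h φ ⟨h1, h2, h3⟩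
    rwa [IsTest.pairing_apply, IsTest.pairing_apply] at this

theorem IsWeakDeriv.add_lTwo {m : ℕ} {u₁ w₁ u₂ w₂ : LTwo} (h₁ : IsWeakDeriv m (Ioo 0 1) u₁ w₁)
    (h₂ : IsWeakDeriv m (Ioo 0 1) u₂ w₂) :
    IsWeakDeriv m (Ioo 0 1) (u₁ + u₂ : LTwo) (w₁ + w₂ : LTwo) := by
  rw [isWeakDeriv_iff] at *
  intro φ h
  rw [map_add, map_add, h₁ φ h, h₂ φ h, mul_add]

theorem IsWeakDeriv.smul_lTwo {m : ℕ} {u w : LTwo} (h₁ : IsWeakDeriv m (Ioo 0 1) u w) (c : ℂ) :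
    IsWeakDeriv m (Ioo 0 1) (c • u : LTwo) (c • w : LTwo) := by
  rw [isWeakDeriv_iff] at *
  intro φ h
  rw [map_smul, map_smul, h₁ φ h, smul_eq_mul, smul_eq_mul, mul_left_comm]

theorem IsWeakDeriv.hasSum {ι : Type*} {m : ℕ} {u w : ι → LTwo} {u₀ w₀ : LTwo}
    (h : ∀ i, IsWeakDeriv m (Ioo 0 1) (u i) (w i)) (hu : HasSum u u₀) (hw : HasSum w w₀) :
    IsWeakDeriv m (Ioo 0 1) u₀ w₀ := by
  simp only [isWeakDeriv_iff] at *
  intro φ hφ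
  refine (hu.mapL (hφ.iteratedDeriv m).pairing).unique ?_
  have := (hw.mapL hφ.pairing).mul_left ((-1) ^ m)
  convert! this using 2
  exact h _ φ hφ

theorem IsTest.integral_mul_iteratedDeriv {φ : ℝ → ℂ} (h : IsTest φ) (m : ℕ) :
    ∀ f : ℝ → ℂ, ContDiff ℝ ∞ f →
      ∫ x, f x * _root_.iteratedDeriv m φ x = (-1) ^ m * ∫ x, _root_.iteratedDeriv m f x * φ x := by
  have hi : ∀ f ψ : ℝ → ℂ, ContDiff ℝ ∞ f → IsTest ψ → Integrable (f * ψ) := fun f ψ hf hψ =>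
    (hf.continuous.mul hψ.contDiff.continuous).integrable_of_hasCompactSupport hψ.compact.mul_left
  induction m with
  | zero => intro f _; simp
  | succ m ih =>
    intro f hf
    have h1 := integral_mul_deriv_eq_deriv_mul_of_integrable (u := f)
      (v := _root_.iteratedDeriv m φ) (u' := _root_.deriv f)
      (v' := _root_.deriv (_root_.iteratedDeriv m φ))
      (fun x _ => ((contDiff_infty_iff_deriv.1 hf).1 x).hasDerivAt)
      (fun x _ => ((contDiff_infty_iff_deriv.1 (h.iteratedDeriv m).contDiff).1 x).hasDerivAt)
      (hi _ _ hf (h.iteratedDeriv m).deriv)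
      (hi _ _ (contDiff_infty_iff_deriv.1 hf).2 (h.iteratedDeriv m))
      (hi _ _ hf (h.iteratedDeriv m))
    rw [iteratedDeriv_succ, h1, ih _ (contDiff_infty_iff_deriv.1 hf).2, iteratedDeriv_succ', pow_succ]
    ring

theorem IsTest.pairing_smoothUnit {φ : ℝ → ℂ} (h : IsTest φ) (p : ℝ → ℂ) (hp : ContDiff ℝ ∞ p) :
    h.pairing (smoothUnit p hp) = ∫ x, p x * φ x := by
  rw [h.pairing_apply, ← setIntegral_eq_integral_of_forall_compl_eq_zero (s := Ioo (0 : ℝ) 1)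
    (f := fun x => p x * φ x)]
  · refine integral_congr_ae ?_
    filter_upwards [smoothUnit_coeFn p hp] with x hx
    rw [hx]
  · intro x hx
    rw [image_eq_zero_of_notMem_tsupport fun hx' => hx (h.supp hx'), mul_zero]

theorem isWeakDeriv_smoothUnit (m : ℕ) (p : ℝ → ℂ) (hp : ContDiff ℝ ∞ p) :
    IsWeakDeriv m (Ioo 0 1) (smoothUnit p hp)
      (smoothUnit (iteratedDeriv m p) (contDiff_iteratedDeriv hp m)) := by
  rw [isWeakDeriv_iff]
  intro φ h
  rw [IsTest.pairing_smoothUnit, IsTest.pairing_smoothUnit, h.integral_mul_iteratedDeriv m p hp]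

theorem deriv_expo (n : ℤ) : deriv (expo n) = fun x => (Complex.I * (n * Real.pi)) * expo n x := by
  funext x
  have h : HasDerivAt (fun x : ℝ => Complex.I * (n * Real.pi * x : ℝ))
      (Complex.I * (n * Real.pi)) x := by
    have := (((hasDerivAt_id x).const_mul ((n : ℝ) * Real.pi)).ofReal_comp).const_mul Complex.I
    simpa using this
  have := h.cexp.deriv
  rw [show (expo n) = fun x : ℝ => Complex.exp (Complex.I * (n * Real.pi * x : ℝ)) from rfl, this,
    mul_comm]

theorem iteratedDeriv_expo (n : ℤ) (m : ℕ) :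
    iteratedDeriv m (expo n) = fun x => (Complex.I * (n * Real.pi)) ^ m * expo n x := by
  induction m with
  | zero => simp
  | succ m ih =>
    rw [iteratedDeriv_succ, ih]
    funext x
    rw [deriv_const_mul _ ((contDiff_infty_iff_deriv.1 (contDiff_expo n)).1 x), deriv_expo]
    ring

theorem isWeakDeriv_mode (m : ℕ) (n : ℤ) :
    IsWeakDeriv m (Ioo 0 1) (mode n) ((Complex.I * (n * Real.pi)) ^ m • mode n : LTwo) := by
  have h := isWeakDeriv_smoothUnit m (expo n) (contDiff_expo n)
  have e : smoothUnit (iteratedDeriv m (expo n)) (contDiff_iteratedDeriv (contDiff_expo n) m) =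
      (Complex.I * (n * Real.pi)) ^ m • mode n := by
    refine Lp.ext ?_
    filter_upwards [smoothUnit_coeFn (iteratedDeriv m (expo n))
      (contDiff_iteratedDeriv (contDiff_expo n) m), mode_coeFn n,
      Lp.coeFn_smul ((Complex.I * (n * Real.pi)) ^ m) (mode n)] with x h1 h2 h3
    rw [h1, h3, Pi.smul_apply, h2, iteratedDeriv_expo, smul_eq_mul]
  rw [e] at h
  exact h

theorem IsWeakDeriv.unique_lTwo {m : ℕ} {u w₁ w₂ : LTwo} (h₁ : IsWeakDeriv m (Ioo 0 1) u w₁)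
    (h₂ : IsWeakDeriv m (Ioo 0 1) u w₂) : w₁ = w₂ := by
  rw [isWeakDeriv_iff] at h₁ h₂
  rw [← sub_eq_zero, Lp.eq_zero_iff_ae_eq_zero]
  have hint : IntegrableOn (w₁ - w₂ : LTwo) (Ioo (0 : ℝ) 1) :=
    (Lp.memLp (w₁ - w₂)).integrable (by norm_num)
  have h := isOpen_Ioo.ae_eq_zero_of_integral_contDiff_smul_eq_zero (μ := volume)
    hint.locallyIntegrableOn (fun g hg hc hs => by
      have ht : IsTest fun x => (g x : ℂ) :=
        ⟨Complex.ofRealCLM.contDiff.comp hg, hc.comp_left (g := Complex.ofReal) Complex.ofReal_zero,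
          (closure_mono fun x hx => by
            rw [Function.mem_support] at hx ⊢
            exact_mod_cast hx).trans hs⟩
      have h3 : ht.pairing (w₁ - w₂) = 0 := by
        have := (h₁ _ ht).symm.trans (h₂ _ ht)
        rw [map_sub, sub_eq_zero]
        exact mul_left_cancel₀ (pow_ne_zero m (by norm_num)) this
      rw [ht.pairing_apply] at h3
      rw [← setIntegral_eq_integral_of_forall_compl_eq_zero (s := Ioo (0 : ℝ) 1), ← h3]
      · refine integral_congr_ae (.of_forall fun x => ?_)
        simp only [Complex.real_smul]
        ring
      · intro x hx
        rw [image_eq_zero_of_notMem_tsupport fun hx' => hx (hs hx'), zero_smul])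
  exact (ae_restrict_iff' measurableSet_Ioo).2 h

/-! ### Fourier series in `L²(0,1)` and the sawtooth -/

theorem tsum_enorm_sq_ne_top {c : ℤ → ℂ} (h : Summable fun n => ‖c n‖ ^ 2) :
    ∑' n : ℤ, ‖c n‖ₑ ^ 2 ≠ ⊤ := by
  have : ∀ n, ‖c n‖ₑ ^ 2 = ENNReal.ofReal (‖c n‖ ^ 2) := fun n => by
    rw [ENNReal.ofReal_pow (norm_nonneg _), ofReal_norm]
  simp_rw [this]
  rw [← ENNReal.ofReal_tsum_of_nonneg (fun n => by positivity) h]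
  exact ENNReal.ofReal_ne_top

theorem summable_smul_mode {c : ℤ → ℂ} (h : Summable fun n => ‖c n‖ ^ 2) :
    Summable fun n => c n • mode n := by
  obtain ⟨C, hC⟩ := exists_hasSum_mode (σ := 0) (by simp)
  refine (hC c ?_).1
  simpa only [besselSymbol_zero, Complex.ofReal_one, one_mul] using tsum_enorm_sq_ne_top h

/-- A trigonometric series converging both in `L²(0,1)` and pointwise has the same sum. -/
theorem hasSum_mode_of_hasSum {c : ℤ → ℂ} (h : Summable fun n => c n • mode n) (p : ℝ → ℂ)
    (hp : ContDiff ℝ ∞ p) (hs : ∀ x ∈ Ioo (0 : ℝ) 1, HasSum (fun n => c n * expo n x) (p x)) :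
    HasSum (fun n => c n • mode n) (smoothUnit p hp) := by
  have hIcc : Tendsto (fun j : ℕ => Finset.Icc (-(j : ℤ)) j) atTop atTop :=
    Finset.tendsto_Icc_neg.comp tendsto_natCast_atTop_atTop
  set P : ℕ → ℝ → ℂ := fun j x => ∑ n ∈ Finset.Icc (-(j : ℤ)) j, c n * expo n x with hP
  have m1 : TendstoInMeasure (volume.restrict (Ioo (0 : ℝ) 1)) P atTop (∑' n, c n • mode n : LTwo) := by
    have := tendstoInMeasure_of_tendsto_Lp (h.hasSum.comp hIcc)
    refine this.congr_left fun j => ?_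
    simp only [Function.comp_apply]
    have e1 : (∑ n ∈ Finset.Icc (-(j : ℤ)) j, c n • mode n) = smoothUnit (P j)
        (ContDiff.sum fun n _ => contDiff_const.mul (contDiff_expo n)) := by
      refine Lp.ext ?_
      have h1 : ∀ᵐ x ∂(volume.restrict (Ioo (0 : ℝ) 1)), ∀ n, (c n • mode n : LTwo) x =
          c n * expo n x := by
        rw [ae_all_iff]
        intro n
        filter_upwards [Lp.coeFn_smul (c n) (mode n), mode_coeFn n] with x a1 a2
        rw [a1, Pi.smul_apply, a2, smul_eq_mul]
      filter_upwards [Lp.coeFn_finsetSum (Finset.Icc (-(j : ℤ)) j) fun n => c n • mode n, h1,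
        smoothUnit_coeFn (P j) (ContDiff.sum fun n _ => contDiff_const.mul (contDiff_expo n))]
        with x a1 a2 a3
      rw [a1, a3, Finset.sum_apply]
      exact Finset.sum_congr rfl fun n _ => a2 n
    rw [e1]
    exact smoothUnit_coeFn _ _
  have m2 : TendstoInMeasure (volume.restrict (Ioo (0 : ℝ) 1)) P atTop (smoothUnit p hp) := by
    refine tendstoInMeasure_of_tendsto_ae (fun j => ?_) ?_
    · exact (Continuous.aestronglyMeasurable (by fun_prop))
    · filter_upwards [smoothUnit_coeFn p hp, ae_restrict_mem measurableSet_Ioo] with x h1 hx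
      rw [h1]
      exact (hs x hx).comp hIcc
  rw [← Lp.ext (tendstoInMeasure_ae_unique m1 m2)]
  exact h.hasSum

theorem contDiff_ofReal_sub_one : ContDiff ℝ ∞ fun x : ℝ => (x : ℂ) - 1 :=
  Complex.ofRealCLM.contDiff.sub contDiff_const

theorem summable_one_div_int_sq : Summable fun n : ℤ => |(n : ℝ)| ^ (-2 : ℝ) :=
  Real.summable_abs_int_rpow (by norm_num)

theorem norm_inv_int_sq (n : ℤ) (k : ℕ) (hk : 1 ≤ k) :
    ‖(1 : ℂ) / (n : ℂ) ^ k‖ ^ 2 ≤ |(n : ℝ)| ^ (-2 : ℝ) := by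
  rw [norm_div, norm_one, norm_pow, Complex.norm_intCast, one_div, inv_pow, ← pow_mul,
    Real.rpow_neg (abs_nonneg _), show (2 : ℝ) = ((2 : ℕ) : ℝ) by norm_num, Real.rpow_natCast]
  by_cases hn : n = 0
  · subst hn
    have : k * 2 ≠ 0 := by omega
    simp [this]
  · have := one_le_abs_intCast hn
    exact inv_anti₀ (by positivity) (pow_le_pow_right₀ this (by omega))

/-- The Fourier series of the sawtooth function. -/
theorem hasSum_sawtooth : HasSum (fun n : ℤ => (Complex.I * (n * Real.pi))⁻¹ • mode n)
    (-smoothUnit (fun x : ℝ => (x : ℂ) - 1) contDiff_ofReal_sub_one) := by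
  have hk : ∀ k : ℕ, 1 ≤ k → Summable fun n : ℤ => ((1 : ℂ) / (n : ℂ) ^ k) • mode n := fun k hk =>
    summable_smul_mode (summable_one_div_int_sq.of_nonneg_of_le (fun n => by positivity)
      fun n => norm_inv_int_sq n k hk)
  have hpi : (Real.pi : ℂ) ≠ 0 := by exact_mod_cast Real.pi_ne_zero
  -- The sawtooth series converges only conditionally at a point. The second Bernoulli polynomial,
  -- rescaled to period 2, has the absolutely convergent series with coefficients `1/n²`; weak
  -- termwise differentiation and uniqueness of weak derivatives give the claim from `p' = π²(x -
  -- 1)`.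
  set p : ℝ → ℂ := fun x => 2 * (Real.pi : ℂ) ^ 2 * ((x : ℂ) ^ 2 / 4 - (x : ℂ) / 2 + 6⁻¹) with hp
  have hpc : ContDiff ℝ ∞ p := by
    have h1 : ContDiff ℝ ∞ fun x : ℝ => (x : ℂ) := Complex.ofRealCLM.contDiff
    fun_prop
  have h2 := hasSum_mode_of_hasSum (hk 2 (by norm_num)) p hpc (fun x hx => by
    have h := hasSum_one_div_pow_mul_fourier_mul_bernoulliFun (k := 2) le_rfl (x := x / 2)
      ⟨by linarith [hx.1], by linarith [hx.2]⟩
    rw [bernoulliFun_two] at h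
    convert! h using 1
    · funext n
      congr 1
      rw [fourier_coe_apply, expo]
      congr 1
      push_cast
      ring
    · simp only [hp, Nat.factorial]
      push_cast
      rw [mul_pow, mul_pow, Complex.I_sq]
      ring)
  have h1 := (hk 1 le_rfl).hasSum
  have h3 : HasSum (fun n : ℤ => (Complex.I * (n * Real.pi)) ^ 1 • ((1 : ℂ) / (n : ℂ) ^ 2) • mode n)
      ((Complex.I * Real.pi) • ∑' n : ℤ, ((1 : ℂ) / (n : ℂ) ^ 1) • mode n) := by
    convert! h1.const_smul (Complex.I * Real.pi) using 1
    funext n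
    rw [smul_smul, smul_smul]
    congr 1
    by_cases hn : (n : ℂ) = 0
    · simp [hn]
    · field_simp
  have w1 := IsWeakDeriv.hasSum (m := 1) (fun n => by
    have := (isWeakDeriv_mode 1 n).smul_lTwo ((1 : ℂ) / (n : ℂ) ^ 2)
    rw [smul_comm] at this
    exact this) h2 h3
  have w2 := isWeakDeriv_smoothUnit 1 p hpc
  have w3 := w1.unique_lTwo w2
  have e1 : smoothUnit (iteratedDeriv 1 p) (contDiff_iteratedDeriv hpc 1) =
      ((Real.pi : ℂ) ^ 2) • smoothUnit (fun x : ℝ => (x : ℂ) - 1) contDiff_ofReal_sub_one := by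
    refine Lp.ext ?_
    filter_upwards [smoothUnit_coeFn (iteratedDeriv 1 p) (contDiff_iteratedDeriv hpc 1),
      smoothUnit_coeFn _ contDiff_ofReal_sub_one, Lp.coeFn_smul ((Real.pi : ℂ) ^ 2)
        (smoothUnit (fun x : ℝ => (x : ℂ) - 1) contDiff_ofReal_sub_one)] with x a1 a2 a3
    rw [a1, a3, Pi.smul_apply, a2, iteratedDeriv_one, smul_eq_mul]
    have hx : HasDerivAt (fun y : ℝ => (y : ℂ)) 1 x := (hasDerivAt_id x).ofReal_comp
    have := ((((hx.pow 2).div_const 4).sub (hx.div_const 2)).add_const (6⁻¹ : ℂ)).const_mul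
      (2 * (Real.pi : ℂ) ^ 2)
    refine (HasDerivAt.deriv this).trans ?_
    push_cast
    ring
  rw [e1] at w3
  have h4 := h1.const_smul (Complex.I * Real.pi)⁻¹
  convert! h4 using 1
  · funext n
    rw [smul_smul]
    congr 1
    rw [pow_one, mul_inv, mul_inv, mul_inv, one_div]
    ring
  · have e2 : (∑' n : ℤ, ((1 : ℂ) / (n : ℂ) ^ 1) • mode n) = (Complex.I * Real.pi)⁻¹ •
        (Complex.I * Real.pi) • ∑' n : ℤ, ((1 : ℂ) / (n : ℂ) ^ 1) • mode n := by
      rw [inv_smul_smul₀]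
      exact mul_ne_zero Complex.I_ne_zero hpi
    rw [e2, w3, smul_smul, smul_smul, ← neg_one_smul ℂ]
    congr 1
    field_simp
    rw [Complex.I_sq]
    norm_num

/-! ### Sums of functions of time with values in Sobolev spaces -/

theorem LFourSobolevBound.add {σ T : ℝ} {w₁ w₂ : ℝ → LTwo} {B₁ B₂ : ℝ≥0∞}
    (h₁ : LFourSobolevBound σ T w₁ B₁) (h₂ : LFourSobolevBound σ T w₂ B₂) :
    LFourSobolevBound σ T (fun t => w₁ t + w₂ t) (B₁ + B₂) := by
  obtain ⟨F₁, m₁, b₁, a₁⟩ := h₁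
  obtain ⟨F₂, m₂, b₂, a₂⟩ := h₂
  refine ⟨F₁ + F₂, m₁.add m₂, (eLpNorm_add_le m₁.1 m₂.1 (by norm_num)).trans (add_le_add b₁ b₂), ?_⟩
  filter_upwards [a₁, a₂] with t ⟨g₁, e₁⟩ ⟨g₂, e₂⟩
  have h := e₁.add e₂ (Lp.coeFn_add (w₁ t) (w₂ t))
  rw [← MemLp.toLp_add g₁ g₂] at h
  exact ⟨g₁.add g₂, h⟩

theorem LFourSobolevBound.mono {σ T : ℝ} {w : ℝ → LTwo} {B B' : ℝ≥0∞}
    (h : LFourSobolevBound σ T w B) (hB : B ≤ B') : LFourSobolevBound σ T w B' := by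
  obtain ⟨F, m, b, a⟩ := h
  exact ⟨F, m, b.trans hB, a⟩

theorem ContSobolevBound.mono {σ T : ℝ} {w : ℝ → LTwo} {B B' : ℝ≥0∞}
    (h : ContSobolevBound σ T w B) (hB : B ≤ B') : ContSobolevBound σ T w B' :=
  ⟨h.1, h.2.1, fun t ht => (h.2.2 t ht).trans hB⟩

theorem ContSobolevBound.add {σ T : ℝ} {w₁ w₂ : ℝ → LTwo} {B₁ B₂ : ℝ≥0∞}
    (h₁ : ContSobolevBound σ T w₁ B₁) (h₂ : ContSobolevBound σ T w₂ B₂) :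
    ContSobolevBound σ T (fun t => w₁ t + w₂ t) (B₁ + B₂) := by
  have hadd : ∀ t, sobolevNorm σ 2 (Ioo 0 1) (w₁ t + w₂ t : LTwo) ≤
      sobolevNorm σ 2 (Ioo 0 1) (w₁ t) + sobolevNorm σ 2 (Ioo 0 1) (w₂ t) := fun t =>
    sobolevNorm_add_le (Lp.coeFn_add _ _)
  refine ⟨fun t ht => (hadd t).trans_lt (ENNReal.add_lt_top.2 ⟨h₁.1 t ht, h₂.1 t ht⟩),
    fun t₀ ht₀ => ?_, fun t ht => (hadd t).trans (add_le_add (h₁.2.2 t ht) (h₂.2.2 t ht))⟩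
  have h := (h₁.2.1 t₀ ht₀).add (h₂.2.1 t₀ ht₀)
  rw [add_zero] at h
  refine tendsto_of_tendsto_of_tendsto_of_le_of_le tendsto_const_nhds h (fun _ => zero_le)
    fun t => ?_
  simp only []
  rw [add_sub_add_comm]
  exact sobolevNorm_add_le (Lp.coeFn_add _ _)

theorem exists_lFourSobolevBound_smul_smoothUnit (σ T : ℝ) (p : ℝ → ℂ) (hp : ContDiff ℝ ∞ p) :
    ∃ K : ℝ≥0, ∀ (H : ℝ → ℂ) (M : ℝ≥0), Continuous H → (∀ t, ‖H t‖ ≤ M) →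
      LFourSobolevBound σ T (fun t => H t • smoothUnit p hp) (K * M) := by
  set g := besselSchwartz σ (cutSchwartz p hp) with hg
  have hm : MemLp (fun z : ℝ × ℝ => g z.1) 4 (strip T) :=
    (g.memLp 4 (volume : Measure ℝ)).comp_fst (volume.restrict (Ioo 0 T))
  refine ⟨(eLpNorm (fun z : ℝ × ℝ => g z.1) 4 (strip T)).toNNReal, fun H M hH hM => ?_⟩
  have hle : ∀ z : ℝ × ℝ, ‖H z.2 * g z.1‖ ≤ M * ‖g z.1‖ := fun z => by
    rw [norm_mul]; gcongr; exact hM z.2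
  have hc : Continuous fun z : ℝ × ℝ => H z.2 * g z.1 :=
    (hH.comp continuous_snd).mul (g.continuous.comp continuous_fst)
  have hF : MemLp (fun z : ℝ × ℝ => H z.2 * g z.1) 4 (strip T) :=
    hm.of_le_mul hc.aestronglyMeasurable (.of_forall hle)
  refine ⟨fun z => H z.2 * g z.1, strip_eq T ▸ hF, ?_, .of_forall fun t => ?_⟩
  · rw [← strip_eq, ENNReal.coe_toNNReal hm.2.ne]
    refine (eLpNorm_le_mul_eLpNorm_of_ae_le_mul (.of_forall hle) 4).trans (le_of_eq ?_)
    rw [mul_comm, ENNReal.ofReal_coe_nnreal]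
  · have h1 := (isSobolevExtension_smoothUnit σ 4 p hp).const_smul (H t)
      (Lp.coeFn_smul (H t) (smoothUnit p hp))
    exact ⟨(g.memLp 4 (volume : Measure ℝ)).const_mul (H t), h1⟩

theorem exists_contSobolevBound_smul_smoothUnit (σ T : ℝ) (p : ℝ → ℂ) (hp : ContDiff ℝ ∞ p) :
    ∃ K : ℝ≥0, ∀ (H : ℝ → ℂ) (M : ℝ≥0), Continuous H → (∀ t, ‖H t‖ ≤ M) →
      ContSobolevBound σ T (fun t => H t • smoothUnit p hp) (K * M) := by
  set g := (besselSchwartz σ (cutSchwartz p hp)).toLp 2 (volume : Measure ℝ) with hg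
  have hle : ∀ c : ℂ, sobolevNorm σ 2 (Ioo 0 1) (c • smoothUnit p hp : LTwo) ≤ ‖c‖ₑ * ‖g‖ₑ := by
    intro c
    have h1 := (isSobolevExtension_smoothUnit σ 2 p hp).const_smul c
      (Lp.coeFn_smul c (smoothUnit p hp))
    refine h1.sobolevNorm_le.trans (le_of_eq ?_)
    rw [enorm_smul]
  have hg0 : ‖g‖ₑ ≠ ⊤ := enorm_ne_top
  refine ⟨‖g‖₊, fun H M hH hM => ⟨fun t _ => (hle _).trans_lt
    (ENNReal.mul_lt_top enorm_lt_top enorm_lt_top), fun t₀ _ => ?_, fun t _ => (hle _).trans ?_⟩⟩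
  · have h1 : Tendsto (fun t => ‖H t - H t₀‖ₑ * ‖g‖ₑ) (𝓝[Icc 0 T] t₀) (𝓝 0) := by
      have h2 : Tendsto (fun t => ‖H t - H t₀‖ₑ) (𝓝 t₀) (𝓝 0) := by
        have := (hH.sub (continuous_const (y := H t₀))).enorm.tendsto t₀
        simpa using this
      have h3 := ENNReal.Tendsto.mul_const h2 (Or.inr hg0)
      rw [zero_mul] at h3
      exact h3.mono_left nhdsWithin_le_nhds
    refine tendsto_of_tendsto_of_tendsto_of_le_of_le tendsto_const_nhds h1 (fun _ => zero_le)
      fun t => ?_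
    simp only []
    rw [← sub_smul]
    exact hle _
  · rw [mul_comm]
    have : ‖H t‖ₑ ≤ M := by
      rw [← ofReal_norm, ← ENNReal.ofReal_coe_nnreal]
      exact ENNReal.ofReal_le_ofReal (hM t)
    exact mul_le_mul_right this _

/-- Dominated convergence for counting measure on the integers, with majorant `4(e n + e n)`. -/
theorem tendsto_tsum_enorm_sq {T : ℝ} {b : ℤ → ℝ → ℂ} {e : ℤ → ℝ≥0∞} (he : ∑' n, e n ≠ ⊤)
    (hb : ∀ n, ContinuousOn (b n) (Icc 0 T)) (hbe : ∀ n, ∀ t ∈ Icc 0 T, ‖b n t‖ₑ ^ 2 ≤ e n)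
    {t₀ : ℝ} (ht₀ : t₀ ∈ Icc 0 T) :
    Tendsto (fun t => ∑' n, ‖b n t - b n t₀‖ₑ ^ 2) (𝓝[Icc 0 T] t₀) (𝓝 0) := by
  simp_rw [← lintegral_count]
  have h := tendsto_lintegral_filter_of_dominated_convergence
    (μ := Measure.count) (l := 𝓝[Icc 0 T] t₀)
    (F := fun t n => ‖b n t - b n t₀‖ₑ ^ 2) (f := fun _ : ℤ => 0) (fun n => 2 ^ 2 * (e n + e n))
    (.of_forall fun t => measurable_of_countable _) ?_ ?_ ?_
  · simpa using h
  · filter_upwards [self_mem_nhdsWithin] with t ht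
    refine .of_forall fun n => ?_
    refine (pow_le_pow_left' (enorm_sub_le (a := b n t) (b := b n t₀)) 2).trans
      ((ENNReal.add_pow_le_two_pow_mul _ _ 2).trans ?_)
    gcongr
    · exact hbe n t ht
    · exact hbe n t₀ ht₀
  · rw [lintegral_count, ENNReal.tsum_mul_left, ENNReal.tsum_add]
    exact ENNReal.mul_ne_top (by norm_num) (ENNReal.add_ne_top.2 ⟨he, he⟩)
  · refine .of_forall fun n => ?_
    have h1 : Tendsto (fun t => ‖b n t - b n t₀‖ₑ) (𝓝[Icc 0 T] t₀) (𝓝 0) := by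
      have := ((hb n t₀ ht₀).tendsto.sub_const (b n t₀)).enorm
      simpa using this
    have h2 := ((ENNReal.continuous_pow 2).tendsto 0).comp h1
    rw [zero_pow two_ne_zero] at h2
    exact h2

theorem tendsto_zero_of_sq_tendsto_zero {ι : Type*} {l : Filter ι} {f : ι → ℝ≥0∞}
    (h : Tendsto (fun i => f i ^ 2) l (𝓝 0)) : Tendsto f l (𝓝 0) := by
  have := ((ENNReal.continuous_rpow_const (y := (1 / 2 : ℝ))).tendsto 0).comp h
  rw [ENNReal.zero_rpow_of_pos (by norm_num)] at this
  refine this.congr fun i => ?_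
  rw [Function.comp_apply, ← ENNReal.rpow_natCast, ← ENNReal.rpow_mul]
  norm_num

/-- The difference of the sums at two times is again a series of modes, so the static estimate
applies to it and continuity reduces to continuity of the coefficients in weighted `ℓ²`. -/
theorem exists_contSobolevBound {σ : ℝ} (hσ : σ ∈ Icc (0 : ℝ) 1) :
    ∃ K : ℝ≥0, ∀ (T : ℝ) (a : ℤ → ℝ → ℂ) (e : ℤ → ℝ≥0∞), ∑' n, e n ≠ ⊤ →
      (∀ n, ContinuousOn (a n) (Icc 0 T)) →
      (∀ n : ℤ, ∀ t ∈ Icc 0 T, ‖(besselSymbol σ (n / 2) : ℂ) * a n t‖ₑ ^ 2 ≤ e n) →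
      (∀ t ∈ Icc 0 T, Summable fun n => a n t • mode n) ∧
      ∀ B : ℝ≥0∞, K * ∑' n, e n ≤ B ^ 2 →
        ContSobolevBound σ T (fun t => ∑' n, a n t • mode n) B := by
  obtain ⟨K, hK⟩ := exists_hasSum_mode hσ
  refine ⟨K, fun T a e he ha hae => ?_⟩
  have hle : ∀ t ∈ Icc 0 T, ∑' n : ℤ, ‖(besselSymbol σ (n / 2) : ℂ) * a n t‖ₑ ^ 2 ≤ ∑' n, e n :=
    fun t ht => ENNReal.tsum_le_tsum fun n => hae n t ht
  have hs : ∀ t ∈ Icc 0 T, Summable fun n => a n t • mode n := fun t ht =>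
    (hK (fun n => a n t) (ne_top_of_le_ne_top he (hle t ht))).1
  refine ⟨hs, fun B hB => ?_⟩
  have hB' : ∀ t ∈ Icc 0 T, sobolevNorm σ 2 (Ioo 0 1) (∑' n, a n t • mode n : LTwo) ^ 2 ≤
      K * ∑' n, e n := fun t ht =>
    ((hK (fun n => a n t) (ne_top_of_le_ne_top he (hle t ht))).2).trans
      (mul_le_mul_right (hle t ht) _)
  refine ⟨fun t ht => ?_, fun t₀ ht₀ => ?_, fun t ht => ?_⟩
  · have : (K : ℝ≥0∞) * ∑' n, e n < ⊤ := ENNReal.mul_lt_top ENNReal.coe_lt_top he.lt_top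
    exact (ENNReal.pow_lt_top_iff.1 ((hB' t ht).trans_lt this)).resolve_right two_ne_zero
  · have h1 := tendsto_tsum_enorm_sq he
      (b := fun n t => (besselSymbol σ (n / 2) : ℂ) * a n t)
      (fun n => (ha n).const_mul _) hae ht₀
    have h2 := ENNReal.Tendsto.const_mul (a := (K : ℝ≥0∞)) h1 (Or.inr ENNReal.coe_ne_top)
    rw [mul_zero] at h2
    refine tendsto_zero_of_sq_tendsto_zero ?_
    have hev : ∀ᶠ t in 𝓝[Icc 0 T] t₀, sobolevNorm σ 2 (Ioo 0 1)
        ((∑' n, a n t • mode n) - ∑' n, a n t₀ • mode n : LTwo) ^ 2 ≤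
        K * ∑' n : ℤ, ‖(besselSymbol σ (n / 2) : ℂ) * a n t -
          (besselSymbol σ (n / 2) : ℂ) * a n t₀‖ₑ ^ 2 := by
      have hlt := h1.eventually_lt_const ENNReal.zero_lt_top
      filter_upwards [self_mem_nhdsWithin, hlt] with t ht hfin
      simp only [← mul_sub] at hfin ⊢
      have := (hK (fun n => a n t - a n t₀) hfin.ne).2
      simp only [sub_smul] at this
      rwa [(hs t ht).tsum_sub (hs t₀ ht₀)] at this
    exact tendsto_of_tendsto_of_tendsto_of_le_of_le' tendsto_const_nhds h2
      (.of_forall fun _ => zero_le) hev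
  · exact (ENNReal.pow_right_strictMono two_ne_zero).le_iff_le.1 ((hB' t ht).trans hB)

/-! ### Fourier representation of the boundary datum and of the coefficients -/

/-- The continuous function with Fourier transform `besselWeight s * f`. -/
def traceFun (s : ℝ) (f : ℝ → ℂ) (t : ℝ) : ℂ :=
  ∫ ξ, Complex.exp (Complex.I * (2 * Real.pi * (ξ * t) : ℝ)) * ((besselWeight s ξ : ℂ) * f ξ)

theorem traceFun_zero (s : ℝ) (f : ℝ → ℂ) :
    traceFun s f 0 = ∫ ξ, (besselWeight s ξ : ℂ) * f ξ := by
  simp [traceFun]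

theorem norm_traceFun_le (s : ℝ) (f : ℝ → ℂ) (t : ℝ) :
    ‖traceFun s f t‖ ≤ ∫ ξ, ‖(besselWeight s ξ : ℂ) * f ξ‖ := by
  refine (norm_integral_le_integral_norm _).trans (le_of_eq (integral_congr_ae (.of_forall ?_)))
  intro ξ
  simp only []
  rw [norm_mul, norm_exp_I_mul, one_mul]

theorem continuous_traceFun {s : ℝ} {f : ℝ → ℂ}
    (hi : Integrable fun ξ => (besselWeight s ξ : ℂ) * f ξ) : Continuous (traceFun s f) := by
  refine continuous_of_dominated (bound := fun ξ => ‖(besselWeight s ξ : ℂ) * f ξ‖) (fun t => ?_)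
    (fun t => .of_forall fun ξ => ?_) hi.norm (.of_forall fun ξ => ?_)
  · exact (Continuous.aestronglyMeasurable (by fun_prop)).mul hi.1
  · rw [norm_mul, norm_exp_I_mul, one_mul]
  · fun_prop

theorem integral_mul_traceFun {s : ℝ} {f : ℝ → ℂ}
    (hi : Integrable fun ξ => (besselWeight s ξ : ℂ) * f ξ) {μ : Measure ℝ} [SFinite μ]
    {φ : ℝ → ℂ} (hφ : Integrable φ μ) :
    ∫ x, φ x * traceFun s f x ∂μ =
      ∫ ξ, (∫ x, Complex.exp (Complex.I * (2 * Real.pi * (ξ * x) : ℝ)) * φ x ∂μ) *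
        ((besselWeight s ξ : ℂ) * f ξ) := by
  have h1 : Integrable (fun z : ℝ × ℝ => Complex.exp (Complex.I * (2 * Real.pi * (z.2 * z.1) : ℝ)) *
      (φ z.1 * ((besselWeight s z.2 : ℂ) * f z.2))) (μ.prod volume) := by
    refine (hφ.mul_prod hi).bdd_mul (c := 1) (Continuous.aestronglyMeasurable (by fun_prop))
      (.of_forall fun z => (norm_exp_I_mul _).le)
  have h2 := integral_integral_swap
    (f := fun x ξ => Complex.exp (Complex.I * (2 * Real.pi * (ξ * x) : ℝ)) *
      (φ x * ((besselWeight s ξ : ℂ) * f ξ))) h1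
  calc _ = ∫ x, ∫ ξ, Complex.exp (Complex.I * (2 * Real.pi * (ξ * x) : ℝ)) *
      (φ x * ((besselWeight s ξ : ℂ) * f ξ)) ∂volume ∂μ := by
        refine integral_congr_ae (.of_forall fun x => ?_)
        simp only [traceFun]
        rw [← integral_const_mul]
        refine integral_congr_ae (.of_forall fun ξ => ?_)
        simp only []
        ring
    _ = _ := by
        rw [h2]
        refine integral_congr_ae (.of_forall fun ξ => ?_)
        simp only []
        rw [← integral_mul_const]
        refine integral_congr_ae (.of_forall fun x => ?_)
        simp only []
        ring

/-- An element of `H^{(3+s)/4}(ℝ)` is almost everywhere given by its absolutely convergent Fourier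
integral. -/
theorem exists_traceFun_eq {s : ℝ} (hs : 0 ≤ s) {U F : Lp ℂ 2 (volume : Measure ℝ)}
    (h : TemperedDistribution.besselPotential ℝ ℂ ((3 + s) / 4) (U : 𝓢'(ℝ, ℂ)) = (F : 𝓢'(ℝ, ℂ))) :
    ∃ f : ℝ → ℂ, Measurable f ∧ ∫⁻ ξ, ‖f ξ‖ₑ ^ 2 = ‖F‖ₑ ^ 2 ∧ U =ᵐ[volume] traceFun s f := by
  set G : Lp ℂ 2 (volume : Measure ℝ) := FourierTransform.fourier F with hG
  have hpow := eLpNorm_natCast_pow (μ := (volume : Measure ℝ)) G two_ne_zero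
  rw [Nat.cast_ofNat, ← Lp.enorm_def] at hpow
  have hnorm : ‖G‖ₑ = ‖F‖ₑ := by
    rw [← ofReal_norm, ← ofReal_norm, hG, Lp.norm_fourier_eq]
  have hf2 : ∫⁻ ξ, ‖G ξ‖ₑ ^ 2 < ⊤ := by
    rw [← hpow]; exact ENNReal.pow_lt_top enorm_lt_top
  have hGm : Measurable G := (Lp.stronglyMeasurable G).measurable
  have hi := integrable_besselWeight_mul hs hGm hf2
  refine ⟨G, hGm, by rw [← hpow, hnorm], ?_⟩
  have hU := (TemperedDistribution.besselPotential_neg_apply_eq_iff _ _ _).2 h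
  have hV : FourierTransform.fourier (U : 𝓢'(ℝ, ℂ)) = TemperedDistribution.smulLeftCLM ℂ
      (fun x : ℝ => (((1 + ‖x‖ ^ 2) ^ (-((3 + s) / 4) / 2) : ℝ) : ℂ)) (G : 𝓢'(ℝ, ℂ)) := by
    rw [← hU, TemperedDistribution.fourier_besselPotential_eq_smulLeftCLM_fourier_apply,
      Lp.fourier_toTemperedDistribution_eq]
  -- Both functions are tested against smooth compactly supported functions: the Fourier transform
  -- is moved to the test function on the side of `U`, and Fubini does the same for `traceFun`.
  refine ae_eq_of_integral_contDiff_smul_eq ((Lp.memLp U).locallyIntegrable (by norm_num))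
    (continuous_traceFun hi).locallyIntegrable fun g hg hc => ?_
  have hc' : HasCompactSupport fun x => (g x : ℂ) :=
    hc.comp_left (g := Complex.ofReal) Complex.ofReal_zero
  have hg' : ContDiff ℝ ∞ fun x => (g x : ℂ) := Complex.ofRealCLM.contDiff.comp hg
  set φ : 𝓢(ℝ, ℂ) := hc'.toSchwartzMap hg' with hφ
  have hφa : ∀ x, φ x = (g x : ℂ) := fun x => rfl
  have h1 : (U : 𝓢'(ℝ, ℂ)) φ = ∫ x, φ x * U x := by
    rw [Lp.toTemperedDistribution_apply]; rfl
  have h2 : (U : 𝓢'(ℝ, ℂ)) φ = FourierTransform.fourier (U : 𝓢'(ℝ, ℂ))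
      (FourierTransform.fourierInv φ) := by
    rw [TemperedDistribution.fourier_apply, FourierTransform.fourier_fourierInv_eq]
  rw [hV, TemperedDistribution.smulLeftCLM_apply_apply] at h2
  simp_rw [Complex.real_smul, ← hφa]
  rw [← h1, h2, integral_mul_traceFun hi φ.integrable, Lp.toTemperedDistribution_apply]
  refine integral_congr_ae (.of_forall fun ξ => ?_)
  simp only [smul_eq_mul]
  rw [SchwartzMap.smulLeftCLM_apply_apply (by fun_prop), SchwartzMap.fourierInv_coe,
    fourierInv_eq_integral, smul_eq_mul, besselWeight, Real.norm_eq_abs, sq_abs]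
  have e1 : -((3 + s) / 4) / 2 = -(3 + s) / 8 := by ring
  rw [e1, mul_assoc, mul_left_comm]
  congr 3
  funext x
  rw [mul_comm ξ x]

/-- The coefficients of the solution over all integer frequencies. -/
def fullCoeff (s : ℝ) (f : ℝ → ℂ) (n : ℤ) (t : ℝ) : ℂ :=
  bdryCoeff s f n t - (Complex.I * (n * Real.pi))⁻¹ * traceFun s f t

theorem quart_neg (n : ℤ) : quart (-n) = quart n := by
  simp only [quart]; push_cast; ring

theorem osc_neg (n : ℤ) (t : ℝ) : osc (-n) t = osc n t := by
  simp only [osc, quart_neg]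

/-- The eigenvalue is even in `n` and every prefactor is odd. This is what turns the exponential
series into a sine series. -/
theorem fullCoeff_neg (s : ℝ) (f : ℝ → ℂ) (n : ℤ) (t : ℝ) :
    fullCoeff s f (-n) t = -fullCoeff s f n t := by
  have h1 : duhamelIntegrand s f (-n) t = duhamelIntegrand s f n t := by
    funext ξ; simp only [duhamelIntegrand, quart_neg, osc_neg]
  simp only [fullCoeff, bdryCoeff, duhamel, h1, osc_neg, Int.cast_neg, neg_mul, mul_neg, inv_neg]
  ring

theorem bdryCoeff_zero (s : ℝ) (f : ℝ → ℂ) (t : ℝ) : bdryCoeff s f 0 t = 0 := by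
  simp [bdryCoeff, duhamel]

theorem fullCoeff_zero (s : ℝ) (f : ℝ → ℂ) (t : ℝ) : fullCoeff s f 0 t = 0 := by
  simp [fullCoeff, bdryCoeff_zero]

theorem integral_exp_eq_oscInt (η t : ℝ) (ht : 0 ≤ t) :
    ∫ x in Ioc 0 t, Complex.exp (Complex.I * (η * x : ℝ)) = oscInt η t := by
  rw [oscInt, intervalIntegral.integral_of_le ht]

/-- Integration by parts in `τ`, with `(nπ)³ = (nπ)⁴/(nπ)`. It is carried out under the Fourier
integral of `h`, where only the primitive of an exponential is needed. -/
theorem navierCoeff_eq {s : ℝ} (hs : 0 ≤ s) {f : ℝ → ℂ} (hf : Measurable f)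
    (hf2 : ∫⁻ ξ, ‖f ξ‖ₑ ^ 2 < ⊤) {T : ℝ} {h : ℝ → ℂ}
    (hh : h =ᵐ[volume.restrict (Ioo 0 T)] traceFun s f) {k : ℕ} (hk : k ≠ 0) {t : ℝ}
    (ht : t ∈ Icc 0 T) :
    navierCoeff h k t = 2 * Complex.I * fullCoeff s f k t := by
  have hi := integrable_besselWeight_mul hs hf hf2
  set n : ℤ := (k : ℤ) with hn
  set φ : ℝ → ℂ := fun τ => Complex.exp (Complex.I * (quart n * (t - τ) : ℝ)) with hφ
  have hφc : Continuous φ := by fun_prop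
  have h1 : (∫ τ in (0 : ℝ)..t, Complex.exp (Complex.I * (k * Real.pi : ℂ) ^ 4 * (t - τ)) * h τ) =
      ∫ τ in Ioc 0 t, φ τ * traceFun s f τ := by
    rw [intervalIntegral.integral_of_le ht.1, integral_Ioc_eq_integral_Ioo,
      integral_Ioc_eq_integral_Ioo]
    refine integral_congr_ae ?_
    have h2 := ae_restrict_of_ae_restrict_of_subset (Ioo_subset_Ioo_right ht.2) hh
    filter_upwards [h2] with τ hτ
    rw [hτ, hφ, quart]
    congr 2
    rw [hn]
    push_cast
    ring
  have h3 : ∀ ξ : ℝ, (∫ x in Ioc 0 t, Complex.exp (Complex.I * (2 * Real.pi * (ξ * x) : ℝ)) * φ x) =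
      osc n t * oscInt (2 * Real.pi * ξ - quart n) t := by
    intro ξ
    rw [← integral_exp_eq_oscInt _ _ ht.1, ← integral_const_mul]
    refine integral_congr_ae (.of_forall fun x => ?_)
    simp only [hφ, osc]
    rw [← Complex.exp_add, ← Complex.exp_add]
    congr 1
    push_cast
    ring
  have h4 := integral_mul_traceFun hi (μ := volume.restrict (Ioc 0 t)) (φ := φ)
    (hφc.integrableOn_Icc.mono_set Ioc_subset_Icc_self)
  simp_rw [h3] at h4
  have hA : Integrable fun ξ => (osc n t * oscInt (2 * Real.pi * ξ - quart n) t) *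
      ((besselWeight s ξ : ℂ) * f ξ) := by
    refine hi.bdd_mul (c := t) (Continuous.aestronglyMeasurable ?_) (.of_forall fun ξ => ?_)
    · exact continuous_const.mul (continuous_oscInt.comp
        (by fun_prop : Continuous fun ξ : ℝ => (2 * Real.pi * ξ - quart n, t)))
    · rw [norm_mul, norm_osc, one_mul]
      exact norm_oscInt_le _ ht.1
  have hE : Integrable fun ξ => Complex.exp (Complex.I * (2 * Real.pi * (ξ * t) : ℝ)) *
      ((besselWeight s ξ : ℂ) * f ξ) :=
    hi.bdd_mul (c := 1) (Continuous.aestronglyMeasurable (by fun_prop))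
      (.of_forall fun ξ => (norm_exp_I_mul _).le)
  -- Split `iω` as `i(ω - (nπ)⁴) + i(nπ)⁴` with `ω = 2πξ`. The first part times `oscInt` is an exact
  -- exponential difference and produces the values at `t` and at `0`.
  have h5 : Complex.I * ∫ ξ, duhamelIntegrand s f n t ξ =
      traceFun s f t - osc n t * (∫ ξ, (besselWeight s ξ : ℂ) * f ξ) +
        Complex.I * quart n * ∫ ξ, (osc n t * oscInt (2 * Real.pi * ξ - quart n) t) *
          ((besselWeight s ξ : ℂ) * f ξ) := by
    have hS : Integrable fun ξ => Complex.exp (Complex.I * (2 * Real.pi * (ξ * t) : ℝ)) *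
        ((besselWeight s ξ : ℂ) * f ξ) - osc n t * ((besselWeight s ξ : ℂ) * f ξ) :=
      hE.sub (hi.const_mul _)
    rw [traceFun, ← integral_const_mul, ← integral_const_mul, ← integral_const_mul,
      ← integral_sub hE (hi.const_mul _), ← integral_add hS (hA.const_mul _)]
    refine integral_congr_ae (.of_forall fun ξ => ?_)
    simp only [duhamelIntegrand]
    have e1 := mul_oscInt (2 * Real.pi * ξ - quart n) t
    have e2 : Complex.exp (Complex.I * (2 * Real.pi * (ξ * t) : ℝ)) =
        osc n t * Complex.exp (Complex.I * ((2 * Real.pi * ξ - quart n) * t : ℝ)) := by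
      rw [osc, ← Complex.exp_add]
      congr 1
      push_cast
      ring
    rw [e2]
    push_cast at e1 ⊢
    linear_combination (osc n t * ((besselWeight s ξ : ℂ) * f ξ)) * e1
  rw [navierCoeff, h1, h4, fullCoeff, bdryCoeff, duhamel]
  set D := ∫ ξ, duhamelIntegrand s f n t ξ
  set A := ∫ ξ, (osc n t * oscInt (2 * Real.pi * ξ - quart n) t) * ((besselWeight s ξ : ℂ) * f ξ)
  set H₀ := ∫ ξ, (besselWeight s ξ : ℂ) * f ξ
  have hkc : (k : ℂ) ≠ 0 := by exact_mod_cast hk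
  have hpi : (Real.pi : ℂ) ≠ 0 := by exact_mod_cast Real.pi_ne_zero
  have hq : (quart n : ℂ) = (k * Real.pi : ℂ) ^ 4 := by rw [quart, hn]; push_cast; rfl
  have hnk : ((n : ℤ) : ℂ) = (k : ℂ) := by rw [hn]; push_cast; rfl
  rw [hq] at h5
  rw [hnk]
  have hI := Complex.I_ne_zero
  field_simp
  linear_combination (-1 : ℂ) * h5

theorem mode_sub_mode_neg (k : ℕ) : mode (k : ℤ) - mode (-(k : ℤ)) = (2 * Complex.I) • sine k := by
  refine Lp.ext ?_
  filter_upwards [Lp.coeFn_sub (mode (k : ℤ)) (mode (-(k : ℤ))), mode_coeFn (k : ℤ),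
    mode_coeFn (-(k : ℤ)), Lp.coeFn_smul (2 * Complex.I) (sine k),
    (memLp_sine k).coeFn_toLp] with x h1 h2 h3 h4 h5
  rw [h1, h4, Pi.sub_apply, Pi.smul_apply, h2, h3, sine, h5, smul_eq_mul, Complex.ofReal_sin,
    Complex.sin, expo, expo]
  push_cast
  have e1 : -(k * Real.pi * x : ℂ) * Complex.I = Complex.I * (-k * Real.pi * x) := by ring
  have e2 : (k * Real.pi * x : ℂ) * Complex.I = Complex.I * (k * Real.pi * x) := by ring
  rw [e1, e2]
  linear_combination (Complex.exp (Complex.I * (k * Real.pi * x)) -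
    Complex.exp (Complex.I * (-k * Real.pi * x))) * Complex.I_sq

/-- The slowly decaying part `-h(t)/(inπ)` is summed in closed form by the sawtooth series, leaving
a lift that is smooth in `x`. The modes `n` and `-n` are then combined into sines. -/
theorem hasSum_navierTerm {s : ℝ} (hs : 0 ≤ s) {f : ℝ → ℂ} (hf : Measurable f)
    (hf2 : ∫⁻ ξ, ‖f ξ‖ₑ ^ 2 < ⊤) {T : ℝ} {h : ℝ → ℂ}
    (hh : h =ᵐ[volume.restrict (Ioo 0 T)] traceFun s f) {t : ℝ} (ht : t ∈ Icc 0 T)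
    (hsum : Summable fun n : ℤ => bdryCoeff s f n t • mode n) :
    HasSum (navierTerm h t) ((∑' n : ℤ, bdryCoeff s f n t • mode n) + traceFun s f t •
      smoothUnit (fun x : ℝ => (x : ℂ) - 1) contDiff_ofReal_sub_one) := by
  have h1 : HasSum (fun n : ℤ => fullCoeff s f n t • mode n)
      ((∑' n : ℤ, bdryCoeff s f n t • mode n) + traceFun s f t •
        smoothUnit (fun x : ℝ => (x : ℂ) - 1) contDiff_ofReal_sub_one) := by
    convert! hsum.hasSum.sub (hasSum_sawtooth.const_smul (traceFun s f t)) using 1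
    · funext n
      rw [fullCoeff, sub_smul, smul_smul, mul_comm (traceFun s f t)]
    · rw [smul_neg, sub_neg_eq_add]
  have h2 := h1.nat_add_neg
  rw [fullCoeff_zero, zero_smul, add_zero] at h2
  -- The vanishing term at zero is dropped, which matches the shift `k = n + 1` in `navierTerm`.
  rw [← hasSum_nat_add_iff' 1] at h2
  simp only [Finset.range_one, Finset.sum_singleton, Nat.cast_zero, neg_zero, fullCoeff_zero,
    zero_smul, add_zero, sub_zero] at h2
  convert! h2 using 1
  funext k
  rw [navierTerm, navierCoeff_eq hs hf hf2 hh (Nat.succ_ne_zero k) ht, fullCoeff_neg, neg_smul,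
    ← sub_eq_add_neg, ← smul_sub, mode_sub_mode_neg, smul_smul, mul_comm]

/-! ### The boundary integral operator in Sobolev spaces -/

/-- The nearest point of `[0,T]`. -/
def clampTime (T t : ℝ) : ℝ := max 0 (min t T)

theorem continuous_clampTime (T : ℝ) : Continuous (clampTime T) := by
  unfold clampTime; fun_prop

theorem clampTime_mem {T : ℝ} (hT : 0 ≤ T) (t : ℝ) : clampTime T t ∈ Icc 0 T :=
  ⟨le_max_left _ _, max_le hT (min_le_right _ _)⟩

theorem clampTime_eq {T t : ℝ} (ht : t ∈ Icc 0 T) : clampTime T t = t := by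
  rw [clampTime, min_eq_left ht.2, max_eq_right ht.1]

/-- The `m` integer derivatives and the order `σ` together cost `|n|^{σ+m}`, which is `|n|^s`. The
constants come from `1 + n²/4 ≤ 4n²` and `π ≤ 4`. -/
theorem besselSymbol_mul_pow_le {σ : ℝ} (hσ : σ ∈ Icc (0 : ℝ) 1) (m : ℕ) {n : ℤ} (hn : n ≠ 0) :
    besselSymbol σ (n / 2) * ‖(Complex.I * (n * Real.pi : ℂ)) ^ m‖ ≤
      2 * 4 ^ m * |(n : ℝ)| ^ (σ + m) := by
  have h1 := one_le_abs_intCast hn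
  have hpos : 0 < |(n : ℝ)| := by linarith
  have h2 : besselSymbol σ (n / 2) ≤ 2 * |(n : ℝ)| ^ σ := by
    have h3 : 1 + ((n : ℝ) / 2) ^ 2 ≤ (2 * |(n : ℝ)|) ^ 2 := by
      rw [div_pow, ← sq_abs (n : ℝ)]; nlinarith
    calc besselSymbol σ (n / 2) ≤ ((2 * |(n : ℝ)|) ^ 2) ^ (σ / 2) :=
          Real.rpow_le_rpow (by positivity) h3 (by linarith [hσ.1])
      _ = 2 ^ σ * |(n : ℝ)| ^ σ := by
          rw [← Real.rpow_natCast, ← Real.rpow_mul (by positivity),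
            ← Real.mul_rpow (by positivity) (by positivity)]
          congr 1
          push_cast
          ring
      _ ≤ 2 * |(n : ℝ)| ^ σ := by
          gcongr
          exact Real.rpow_le_self_of_one_le (by norm_num) hσ.2
  have h4 : ‖(Complex.I * (n * Real.pi : ℂ)) ^ m‖ ≤ 4 ^ m * |(n : ℝ)| ^ m := by
    rw [norm_pow, norm_mul, norm_mul, Complex.norm_I, one_mul, Complex.norm_intCast,
      Complex.norm_real, Real.norm_eq_abs, abs_of_pos Real.pi_pos, mul_comm, ← mul_pow]
    gcongr
    exact Real.pi_le_four
  calc _ ≤ (2 * |(n : ℝ)| ^ σ) * (4 ^ m * |(n : ℝ)| ^ m) := by gcongr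
    _ = _ := by rw [Real.rpow_add hpos, Real.rpow_natCast]; ring

theorem enorm_le_of_norm_le_mul {x y : ℂ} {C : ℝ≥0} (h : ‖x‖ ≤ C * ‖y‖) : ‖x‖ₑ ≤ C * ‖y‖ₑ := by
  rw [← ofReal_norm, ← ofReal_norm, ← ENNReal.ofReal_coe_nnreal, ← ENNReal.ofReal_mul C.coe_nonneg]
  exact ENNReal.ofReal_le_ofReal h

theorem DerivBound.mono {s T : ℝ} {u : ℝ → LTwo} {B B' : ℝ≥0∞} (h : DerivBound s T u B)
    (hB : B ≤ B') : DerivBound s T u B' := by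
  obtain ⟨w, h1, h2, h3⟩ := h
  exact ⟨w, h1, h2.mono hB, h3.mono hB⟩

theorem floor_sub_mem {s : ℝ} (hs : 0 ≤ s) : s - ⌊s⌋₊ ∈ Icc (0 : ℝ) 1 :=
  ⟨by linarith [Nat.floor_le hs], by linarith [Nat.lt_floor_add_one s]⟩

/-- The series of the weak derivatives. -/
theorem exists_bdrySeries_bounds {T s : ℝ} (hT : 0 < T) (hs : s ∈ Icc (0 : ℝ) 4) :
    ∃ C : ℝ≥0, ∀ (f : ℝ → ℂ) (M : ℝ≥0), Measurable f → ∫⁻ ξ, ‖f ξ‖ₑ ^ 2 = (M : ℝ≥0∞) ^ 2 →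
      (∫ ξ, (besselWeight s ξ : ℂ) * f ξ = 0 ∨ s = 0) → ∃ w : ℝ → LTwo,
        (∀ t ∈ Icc 0 T, Summable fun n : ℤ => bdryCoeff s f n t • mode n) ∧
        (∀ t ∈ Icc 0 T, IsWeakDeriv ⌊s⌋₊ (Ioo 0 1)
          (∑' n : ℤ, bdryCoeff s f n t • mode n : LTwo) (w t)) ∧
        LFourSobolevBound (s - ⌊s⌋₊) T w (C * M) ∧ ContSobolevBound (s - ⌊s⌋₊) T w (C * M) := by
  set m := ⌊s⌋₊ with hm
  set σ := s - m with hσdef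
  have hσ : σ ∈ Icc (0 : ℝ) 1 := floor_sub_mem hs.1
  have hσm : σ + m = s := by rw [hσdef]; ring
  obtain ⟨C, hC⟩ := exists_bdryCoeff_bounds hT hs
  obtain ⟨K₂, hK₂⟩ := exists_contSobolevBound hσ
  obtain ⟨K₀, hK₀⟩ := exists_contSobolevBound (σ := 0) (by simp)
  obtain ⟨K₄, hK₄⟩ := exists_lFourSobolevBound hσ
  set C₀ : ℝ≥0 := 2 * 4 ^ m with hC₀
  have hC₀r : (C₀ : ℝ) = 2 * 4 ^ m := by rw [hC₀]; push_cast; rfl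
  have hC₀pos : (0 : ℝ) < C₀ := by rw [hC₀r]; positivity
  -- The constant dominates both norm bounds at once; being at least one, it is bounded by its own
  -- square and fourth power, so no roots need be taken.
  refine ⟨(1 + K₂ * (C₀ ^ 2 * C)) + (1 + K₄ * (C₀ ^ 4 * C) * C ^ 2), fun f M hf hM h0 => ?_⟩
  obtain ⟨e, he, hpt, hS⟩ := hC f M hf hM h0
  have hf2 : ∫⁻ ξ, ‖f ξ‖ₑ ^ 2 < ⊤ := by
    rw [hM]; exact ENNReal.pow_lt_top ENNReal.coe_lt_top
  have het : ∑' n, e n ≠ ⊤ :=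
    ne_top_of_le_ne_top (ENNReal.mul_ne_top ENNReal.coe_ne_top
      (ENNReal.pow_ne_top ENNReal.coe_ne_top)) he
  -- The clamped time makes the coefficients continuous, hence measurable, on all of `ℝ` without
  -- changing them on `[0,T]`.
  set a : ℤ → ℝ → ℂ := fun n t =>
    (Complex.I * (n * Real.pi : ℂ)) ^ m * bdryCoeff s f n (clampTime T t) with ha
  have hac : ∀ n, Continuous (a n) := fun n =>
    continuous_const.mul ((continuousOn_bdryCoeff hs.1 hf hf2 n T).comp_continuous
      (continuous_clampTime T) (clampTime_mem hT.le))
  have hβ : ∀ n : ℤ, ∀ t, ‖(besselSymbol σ (n / 2) : ℂ) * a n t‖ ≤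
      C₀ * ‖((|(n : ℝ)| ^ s : ℝ) : ℂ) * bdryCoeff s f n (clampTime T t)‖ := by
    intro n t
    by_cases hn : n = 0
    · subst hn; simp [ha, bdryCoeff_zero]
    · rw [ha]
      simp only []
      rw [norm_mul, norm_mul, norm_mul, Complex.norm_real, Complex.norm_real,
        Real.norm_of_nonneg (besselSymbol_nonneg _ _), Real.norm_of_nonneg (by positivity),
        ← mul_assoc, ← mul_assoc, hC₀r]
      have := besselSymbol_mul_pow_le hσ m hn
      rw [hσm] at this
      rw [← mul_assoc (2 * 4 ^ m : ℝ), mul_assoc Complex.I]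
      exact mul_le_mul_of_nonneg_right this (norm_nonneg (bdryCoeff s f n (clampTime T t)))
  have hae : ∀ n : ℤ, ∀ t ∈ Icc 0 T, ‖(besselSymbol σ (n / 2) : ℂ) * a n t‖ₑ ^ 2 ≤
      (C₀ : ℝ≥0∞) ^ 2 * e n := by
    intro n t ht
    refine (pow_le_pow_left' (enorm_le_of_norm_le_mul (hβ n t)) 2).trans ?_
    rw [mul_pow]
    gcongr
    exact hpt n _ (clampTime_mem hT.le t)
  have htsum : ∑' n, (C₀ : ℝ≥0∞) ^ 2 * e n = (C₀ : ℝ≥0∞) ^ 2 * ∑' n, e n := ENNReal.tsum_mul_left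
  have het' : ∑' n, (C₀ : ℝ≥0∞) ^ 2 * e n ≠ ⊤ := by
    rw [htsum]; exact ENNReal.mul_ne_top (ENNReal.pow_ne_top ENNReal.coe_ne_top) het
  obtain ⟨hsum, hcont⟩ := hK₂ T a _ het' (fun n => (hac n).continuousOn) hae
  obtain ⟨hsum0, -⟩ := hK₀ T (fun n t => bdryCoeff s f n t) e het
    (fun n => continuousOn_bdryCoeff hs.1 hf hf2 n T) (fun n t ht => by
      refine le_trans (pow_le_pow_left' ?_ 2) (hpt n t ht)
      rw [besselSymbol_zero, Complex.ofReal_one, one_mul, enorm_mul]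
      by_cases hn : n = 0
      · subst hn; simp [bdryCoeff_zero]
      · refine le_mul_of_one_le_left zero_le ?_
        rw [← ofReal_norm, Complex.norm_real, Real.norm_of_nonneg (by positivity)]
        exact ENNReal.one_le_ofReal.2 (Real.one_le_rpow (one_le_abs_intCast hn) hs.1))
  refine ⟨fun t => ∑' n, a n t • mode n, hsum0, fun t ht => ?_, ?_, ?_⟩
  · refine IsWeakDeriv.hasSum (fun n => ?_) (hsum0 t ht).hasSum (hsum t ht).hasSum
    have := (isWeakDeriv_mode m n).smul_lTwo (bdryCoeff s f n t)
    rw [smul_smul, mul_comm] at this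
    simp only [ha, clampTime_eq ht]
    exact this
  · refine hK₄ T a (fun n => (hac n).measurable) e het (C₀ ^ 4 * C) (fun S b hb => ?_) _
      ((ae_restrict_mem measurableSet_Ioo).mono fun t ht =>
        (hsum t (Ioo_subset_Icc_self ht)).hasSum) _ ?_
    · set b' : ℤ → ℂ := fun n => b n * (besselSymbol σ (n / 2) : ℂ) *
        (Complex.I * (n * Real.pi : ℂ)) ^ m / (C₀ * ((|(n : ℝ)| ^ s : ℝ) : ℂ)) with hb'
      -- The ratio of multipliers is controlled only for `n ≠ 0`; at `n = 0` the coefficient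
      -- vanishes and any value would do.
      set b'' : ℤ → ℂ := fun n => if n = 0 then 0 else b' n with hb''
      have h1 := hS S b'' (fun n => by
        by_cases hn : n = 0
        · simp [hb'', hn]
        · have hpos : 0 < |(n : ℝ)| ^ s :=
            Real.rpow_pos_of_pos (by linarith [one_le_abs_intCast hn]) _
          simp only [hb'', hn, if_false, hb']
          rw [norm_div, norm_mul, norm_mul, norm_mul (C₀ : ℂ), Complex.norm_real, Complex.norm_real,
            Complex.norm_real, Real.norm_of_nonneg hpos.le,
            Real.norm_of_nonneg (besselSymbol_nonneg _ _), Real.norm_of_nonneg C₀.coe_nonneg]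
          refine div_le_one_of_le₀ ?_ (by positivity)
          have h2 := besselSymbol_mul_pow_le hσ m hn
          rw [hσm, ← hC₀r] at h2
          calc _ = ‖b n‖ * (besselSymbol σ (n / 2) * ‖(Complex.I * (n * Real.pi : ℂ)) ^ m‖) := by
                ring
            _ ≤ 1 * (C₀ * |(n : ℝ)| ^ s) := mul_le_mul (hb n) h2
                (mul_nonneg (besselSymbol_nonneg _ _) (norm_nonneg _)) zero_le_one
            _ = _ := one_mul _)
      calc _ = ∫⁻ z, (C₀ : ℝ≥0∞) ^ 4 * ‖∑ n ∈ S, b'' n * (((|(n : ℝ)| ^ s : ℝ) : ℂ) *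
            bdryCoeff s f n z.2) * expo n z.1‖ₑ ^ 4 ∂(cell T) := by
            refine lintegral_congr_ae ?_
            filter_upwards [ae_cell_snd_mem T] with z hz
            have e1 : (C₀ : ℝ≥0∞) = ‖((C₀ : ℝ) : ℂ)‖ₑ := by
              rw [← ofReal_norm, Complex.norm_real, Real.norm_of_nonneg C₀.coe_nonneg,
                ENNReal.ofReal_coe_nnreal]
            rw [e1, ← mul_pow, ← enorm_mul, Finset.mul_sum]
            congr 2
            refine Finset.sum_congr rfl fun n _ => ?_
            simp only [ha, clampTime_eq (Ioo_subset_Icc_self hz), hb'']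
            by_cases hn : n = 0
            · subst hn; simp [bdryCoeff_zero]
            · have hpos : 0 < |(n : ℝ)| ^ s :=
                Real.rpow_pos_of_pos (by linarith [one_le_abs_intCast hn]) _
              have hp' : ((|(n : ℝ)| ^ s : ℝ) : ℂ) ≠ 0 := by exact_mod_cast hpos.ne'
              have hc' : ((C₀ : ℝ) : ℂ) ≠ 0 := by exact_mod_cast hC₀pos.ne'
              simp only [hn, if_false, hb']
              change _ = ((C₀ : ℝ) : ℂ) * (b n * (besselSymbol σ (n / 2) : ℂ) *
                (Complex.I * (n * Real.pi : ℂ)) ^ m / (((C₀ : ℝ) : ℂ) * ((|(n : ℝ)| ^ s : ℝ) : ℂ)) *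
                _ * _)
              field_simp
        _ ≤ (C₀ : ℝ≥0∞) ^ 4 * (C * (∑ n ∈ S, e n) ^ 2) := by
            rw [lintegral_const_mul' _ _ (ENNReal.pow_ne_top ENNReal.coe_ne_top)]
            gcongr
        _ = _ := by push_cast; ring
    · calc (K₄ : ℝ≥0∞) * ((C₀ ^ 4 * C : ℝ≥0) : ℝ≥0∞) * (∑' n, e n) ^ 2
          ≤ K₄ * ((C₀ ^ 4 * C : ℝ≥0) : ℝ≥0∞) * (C * (M : ℝ≥0∞) ^ 2) ^ 2 := by gcongr
        _ = ((K₄ * (C₀ ^ 4 * C) * C ^ 2 * M ^ 4 : ℝ≥0) : ℝ≥0∞) := by push_cast; ring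
        _ ≤ ((((1 + K₂ * (C₀ ^ 2 * C)) + (1 + K₄ * (C₀ ^ 4 * C) * C ^ 2)) ^ 4 * M ^ 4 : ℝ≥0) :
            ℝ≥0∞) := by
            rw [ENNReal.coe_le_coe]
            gcongr
            set x := K₄ * (C₀ ^ 4 * C) * C ^ 2
            calc x ≤ 1 + K₂ * (C₀ ^ 2 * C) + (1 + x) := by
                  rw [← add_assoc]; exact le_add_self
              _ ≤ _ := le_self_pow₀ (le_add_of_le_of_nonneg (le_add_of_nonneg_right zero_le)
                  zero_le) four_ne_zero
        _ = _ := by push_cast; ring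
  · refine hcont _ ?_
    rw [htsum]
    calc (K₂ : ℝ≥0∞) * ((C₀ : ℝ≥0∞) ^ 2 * ∑' n, e n)
        ≤ K₂ * ((C₀ : ℝ≥0∞) ^ 2 * (C * (M : ℝ≥0∞) ^ 2)) := by gcongr
      _ = ((K₂ * (C₀ ^ 2 * C) * M ^ 2 : ℝ≥0) : ℝ≥0∞) := by push_cast; ring
      _ ≤ ((((1 + K₂ * (C₀ ^ 2 * C)) + (1 + K₄ * (C₀ ^ 4 * C) * C ^ 2)) ^ 2 * M ^ 2 : ℝ≥0) :
            ℝ≥0∞) := by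
          rw [ENNReal.coe_le_coe]
          gcongr
          set x := K₂ * (C₀ ^ 2 * C)
          set y := K₄ * (C₀ ^ 4 * C) * C ^ 2
          calc x ≤ 1 + x + (1 + y) := by
                rw [add_comm 1 x, add_assoc]; exact le_self_add
            _ ≤ _ := le_self_pow₀ (le_add_of_le_of_nonneg (le_add_of_nonneg_right zero_le)
                zero_le) two_ne_zero
      _ = _ := by push_cast; ring

/-- The estimate for the boundary integral operator in terms of the Fourier data of an extension of
the boundary datum. -/
theorem exists_navierZero_bounds {T s : ℝ} (hT : 0 < T) (hs : s ∈ Icc (0 : ℝ) 4) :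
    ∃ C : ℝ≥0, ∀ (h f : ℝ → ℂ) (M : ℝ≥0), Measurable f → ∫⁻ ξ, ‖f ξ‖ₑ ^ 2 = (M : ℝ≥0∞) ^ 2 →
      h =ᵐ[volume.restrict (Ioo 0 T)] traceFun s f → (traceFun s f 0 = 0 ∨ s = 0) →
        (∀ t ∈ Icc 0 T, Summable (navierTerm h t)) ∧ DerivBound s T (navierZero h) (C * M) := by
  obtain ⟨C₁, hC₁⟩ := exists_bdrySeries_bounds hT hs
  obtain ⟨C₂, hC₂⟩ := exists_norm_integral_besselWeight_le hs.1
  set p : ℝ → ℂ := fun x => (x : ℂ) - 1 with hp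
  have hpc : ContDiff ℝ ∞ p := contDiff_ofReal_sub_one
  have hpm := contDiff_iteratedDeriv hpc ⌊s⌋₊
  obtain ⟨K₄, hK₄⟩ := exists_lFourSobolevBound_smul_smoothUnit (s - ⌊s⌋₊) T _ hpm
  obtain ⟨K₂, hK₂⟩ := exists_contSobolevBound_smul_smoothUnit (s - ⌊s⌋₊) T _ hpm
  refine ⟨C₁ + (K₂ + K₄) * C₂, fun h f M hf hM hh h0 => ?_⟩
  rw [traceFun_zero] at h0
  obtain ⟨w, hsum, hweak, h4, h2⟩ := hC₁ f M hf hM h0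
  have hf2 : ∫⁻ ξ, ‖f ξ‖ₑ ^ 2 < ⊤ := by
    rw [hM]; exact ENNReal.pow_lt_top ENNReal.coe_lt_top
  have hi := integrable_besselWeight_mul hs.1 hf hf2
  have hH : ∀ t, ‖traceFun s f t‖ ≤ ((C₂ * M : ℝ≥0) : ℝ) := by
    intro t
    refine (norm_traceFun_le s f t).trans ?_
    rw [integral_norm_eq_lintegral_enorm hi.1]
    refine ENNReal.toReal_le_of_le_ofReal (by positivity) ?_
    rw [ENNReal.ofReal_coe_nnreal, ENNReal.coe_mul]
    exact hC₂ f M hf hM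
  have hHc := continuous_traceFun hi
  have hu : ∀ t ∈ Icc 0 T, HasSum (navierTerm h t) ((∑' n : ℤ, bdryCoeff s f n t • mode n) +
      traceFun s f t • smoothUnit p hpc) := fun t ht =>
    hasSum_navierTerm hs.1 hf hf2 hh ht (hsum t ht)
  refine ⟨fun t ht => (hu t ht).summable, fun t => w t +
    traceFun s f t • smoothUnit (iteratedDeriv ⌊s⌋₊ p) hpm, fun t ht => ?_, ?_, ?_⟩
  · rw [navierZero, (hu t ht).tsum_eq]
    exact (hweak t ht).add_lTwo ((isWeakDeriv_smoothUnit _ p hpc).smul_lTwo _)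
  · refine (h4.add (hK₄ _ _ hHc hH)).mono ?_
    rw [← ENNReal.coe_mul, ← ENNReal.coe_mul, ← ENNReal.coe_add, ← ENNReal.coe_mul,
      ENNReal.coe_le_coe]
    calc _ ≤ C₁ * M + K₄ * (C₂ * M) + K₂ * (C₂ * M) := le_self_add
      _ = _ := by ring
  · refine (h2.add (hK₂ _ _ hHc hH)).mono ?_
    rw [← ENNReal.coe_mul, ← ENNReal.coe_mul, ← ENNReal.coe_add, ← ENNReal.coe_mul,
      ENNReal.coe_le_coe]
    calc _ ≤ C₁ * M + K₂ * (C₂ * M) + K₄ * (C₂ * M) := le_self_add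
      _ = _ := by ring

/-! ### From Fourier data to the quotient norm -/

theorem exists_traceFun_ae_eq {s T : ℝ} (hs : 0 ≤ s) {h : ℝ → ℂ} {F : Lp ℂ 2 (volume : Measure ℝ)}
    (hF : IsSobolevExtension ((3 + s) / 4) 2 (Ioo 0 T) h F) :
    ∃ f : ℝ → ℂ, Measurable f ∧ ∫⁻ ξ, ‖f ξ‖ₑ ^ 2 = ‖F‖ₑ ^ 2 ∧
      h =ᵐ[volume.restrict (Ioo 0 T)] traceFun s f := by
  obtain ⟨U, hJ, hU⟩ := hF
  obtain ⟨f, hf, hf2, hUf⟩ := exists_traceFun_eq hs hJ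
  exact ⟨f, hf, hf2, hU.symm.trans (ae_restrict_of_ae hUf)⟩

/-- Extensions of arbitrarily small norm bound `h` almost everywhere by `C/j` for each `j`, through
the supremum bound for `traceFun`. -/
theorem ae_eq_zero_of_sobolevNorm_eq_zero {s T : ℝ} (hs : 0 ≤ s) {h : ℝ → ℂ}
    (h0 : sobolevNorm ((3 + s) / 4) 2 (Ioo 0 T) h = 0) :
    h =ᵐ[volume.restrict (Ioo 0 T)] fun _ => 0 := by
  obtain ⟨C, hC⟩ := exists_norm_integral_besselWeight_le hs
  have hle : ∀ j : ℕ, ∀ᵐ x ∂(volume.restrict (Ioo 0 T)), ‖h x‖ₑ ≤ C * (j : ℝ≥0∞)⁻¹ := by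
    intro j
    have hj : sobolevNorm ((3 + s) / 4) 2 (Ioo 0 T) h < (j : ℝ≥0∞)⁻¹ := by
      rw [h0]
      exact ENNReal.inv_pos.2 (ENNReal.natCast_ne_top j)
    simp only [sobolevNorm, iInf_lt_iff] at hj
    obtain ⟨F, hF, hlt⟩ := hj
    obtain ⟨f, hf, hf2, hh⟩ := exists_traceFun_ae_eq hs hF
    filter_upwards [hh] with x hx
    rw [hx, traceFun]
    refine (enorm_integral_le_lintegral_enorm _).trans ?_
    have h1 : ∀ ξ, ‖Complex.exp (Complex.I * (2 * Real.pi * (ξ * x) : ℝ)) *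
        ((besselWeight s ξ : ℂ) * f ξ)‖ₑ = ‖(besselWeight s ξ : ℂ) * f ξ‖ₑ := by
      intro ξ
      rw [enorm_mul, ← ofReal_norm (Complex.exp _), norm_exp_I_mul, ENNReal.ofReal_one, one_mul]
    simp_rw [h1]
    refine (hC f ‖F‖₊ hf hf2).trans ?_
    gcongr
    exact hlt.le
  filter_upwards [ae_all_iff.2 hle] with x hx
  have h1 : Tendsto (fun j : ℕ => (C : ℝ≥0∞) * (j : ℝ≥0∞)⁻¹) atTop (𝓝 0) := by
    have := ENNReal.Tendsto.const_mul (a := (C : ℝ≥0∞)) ENNReal.tendsto_inv_nat_nhds_zero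
      (Or.inr ENNReal.coe_ne_top)
    rwa [mul_zero] at this
  have h2 := ge_of_tendsto' h1 hx
  exact enorm_eq_zero.1 (le_antisymm h2 zero_le)

/-- The infimum is not shown to be attained. A positive norm leaves room for a factor 2; if the norm
is zero, then `h = 0` almost everywhere and the zero extension works. -/
theorem exists_sobolevExtension_le {s T : ℝ} (hs : 0 ≤ s) {h : ℝ → ℂ}
    (hh : MemH ((3 + s) / 4) T h) : ∃ F : Lp ℂ 2 (volume : Measure ℝ),
      IsSobolevExtension ((3 + s) / 4) 2 (Ioo 0 T) h F ∧
        ‖F‖ₑ ≤ 2 * sobolevNorm ((3 + s) / 4) 2 (Ioo 0 T) h := by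
  by_cases h0 : sobolevNorm ((3 + s) / 4) 2 (Ioo 0 T) h = 0
  · refine ⟨0, ⟨0, ?_, ?_⟩, by simp⟩
    · rw [← Lp.toTemperedDistributionCLM_apply, map_zero, map_zero]
    · filter_upwards [ae_eq_zero_of_sobolevNorm_eq_zero hs h0,
        ae_restrict_of_ae (Lp.coeFn_zero ℂ 2 (volume : Measure ℝ))] with x h1 h2
      rw [h1, h2, Pi.zero_apply]
  · have hlt : sobolevNorm ((3 + s) / 4) 2 (Ioo 0 T) h <
        2 * sobolevNorm ((3 + s) / 4) 2 (Ioo 0 T) h := by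
      rw [two_mul]
      exact ENNReal.lt_add_right hh.ne h0
    conv_lhs at hlt => rw [sobolevNorm]
    simp only [iInf_lt_iff] at hlt
    obtain ⟨F, hF, hlt⟩ := hlt
    exact ⟨F, hF, hlt.le⟩

/-- The estimate for the boundary integral operator in terms of the Sobolev norm. -/
theorem exists_navierZero_sobolev_bounds {T s : ℝ} (hT : 0 < T) (hs : s ∈ Icc (0 : ℝ) 4) :
    ∃ C : ℝ≥0, ∀ h : ℝ → ℂ, MemH ((3 + s) / 4) T h →
      (s = 0 ∨ ∃ g : ℝ → ℂ, ContinuousOn g (Icc 0 T) ∧ g =ᵐ[volume.restrict (Ioo 0 T)] h ∧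
        g 0 = 0) → (∀ t ∈ Icc 0 T, Summable (navierTerm h t)) ∧
        DerivBound s T (navierZero h) (C * sobolevNorm ((3 + s) / 4) 2 (Ioo 0 T) h) := by
  obtain ⟨C, hC⟩ := exists_navierZero_bounds hT hs
  refine ⟨C * 2, fun h hh h0 => ?_⟩
  obtain ⟨F, hF, hle⟩ := exists_sobolevExtension_le hs.1 hh
  obtain ⟨f, hf, hf2, hhf⟩ := exists_traceFun_ae_eq hs.1 hF
  have hfin : ∫⁻ ξ, ‖f ξ‖ₑ ^ 2 < ⊤ := by
    rw [hf2]; exact ENNReal.pow_lt_top enorm_lt_top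
  have htr : traceFun s f 0 = 0 ∨ s = 0 := by
    rcases h0 with h0 | ⟨g, hg, hgh, hg0⟩
    · exact Or.inr h0
    · left
      -- Two continuous functions equal almost everywhere on a nondegenerate interval agree at its
      -- endpoint, so the condition on `g 0` passes to the chosen extension.
      have h1 : g =ᵐ[volume.restrict (Icc 0 T)] traceFun s f := by
        rw [← restrict_Ioo_eq_restrict_Icc]
        exact hgh.trans hhf
      have h2 := Measure.eqOn_Icc_of_ae_eq volume hT.ne h1 hg
        (continuous_traceFun (integrable_besselWeight_mul hs.1 hf hfin)).continuousOn
      rw [← h2 ⟨le_rfl, hT.le⟩, hg0]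
  obtain ⟨h1, h2⟩ := hC h f ‖F‖₊ hf hf2 hhf htr
  refine ⟨h1, h2.mono ?_⟩
  rw [ENNReal.coe_mul, mul_assoc]
  exact mul_le_mul_right hle _

/-! ### Order zero: comparison with Lebesgue norms -/

theorem IsSobolevExtension.ae_eq_of_zero {p : ℝ≥0∞} [Fact (1 ≤ p)] {I : Set ℝ} {g : ℝ → ℂ}
    {F : Lp ℂ p (volume : Measure ℝ)} (h : IsSobolevExtension 0 p I g F) :
    F =ᵐ[volume.restrict I] g := by
  obtain ⟨U, hJ, hU⟩ := h
  rw [TemperedDistribution.besselPotential_zero] at hJ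
  -- At order zero the Bessel potential is the identity, and an element of `L^p` is determined by
  -- its distribution.
  have hinj : Function.Injective (Lp.toTemperedDistributionCLM ℂ (volume : Measure ℝ) p) :=
    LinearMap.ker_eq_bot.1 Lp.ker_toTemperedDistributionCLM_eq_bot
  have hUF : U = F := hinj hJ
  rw [← hUF]
  exact hU

theorem enorm_le_sobolevNorm_zero (g : LTwo) : ‖g‖ₑ ≤ sobolevNorm 0 2 (Ioo 0 1) g := by
  refine le_iInf₂ fun F hF => ?_
  rw [Lp.enorm_def, Lp.enorm_def, ← eLpNorm_congr_ae hF.ae_eq_of_zero]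
  exact eLpNorm_mono_measure _ Measure.restrict_le_self

theorem LFourSobolevBound.lFourBound {T : ℝ} {w : ℝ → LTwo} {B : ℝ≥0∞}
    (h : LFourSobolevBound 0 T w B) : LFourBound T w B := by
  obtain ⟨F, hF, hB, hae⟩ := h
  have hle : (volume : Measure (ℝ × ℝ)).restrict (Ioo 0 1 ×ˢ Ioo 0 T) ≤
      volume.restrict (univ ×ˢ Ioo 0 T) :=
    Measure.restrict_mono (prod_mono_left (subset_univ _)) le_rfl
  refine ⟨F, hF.mono_measure hle, (eLpNorm_mono_measure _ hle).trans hB, ?_⟩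
  filter_upwards [hae] with t ⟨hm, ht⟩
  have h1 : (fun x => F (x, t)) =ᵐ[volume.restrict (Ioo 0 1)] hm.toLp _ :=
    ae_restrict_of_ae hm.coeFn_toLp.symm
  exact h1.trans ht.ae_eq_of_zero

theorem isWeakDeriv_zero_self (u : LTwo) : IsWeakDeriv 0 (Ioo 0 1) u u := by
  rw [isWeakDeriv_iff]
  intro φ h
  rw [IsTest.pairing_apply, IsTest.pairing_apply, iteratedDeriv_zero, pow_zero, one_mul]

theorem ContSobolevBound.continuousOn {T : ℝ} {w : ℝ → LTwo} {B : ℝ≥0∞}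
    (h : ContSobolevBound 0 T w B) : ContinuousOn w (Icc 0 T) := by
  intro t₀ ht₀
  rw [ContinuousWithinAt, tendsto_iff_edist_tendsto_0]
  refine tendsto_of_tendsto_of_tendsto_of_le_of_le tendsto_const_nhds (h.2.1 t₀ ht₀)
    (fun _ => zero_le) fun t => ?_
  simp only []
  rw [edist_eq_enorm_sub]
  exact enorm_le_sobolevNorm_zero _

theorem LFourBound.congr {T : ℝ} {u w : ℝ → LTwo} {B : ℝ≥0∞} (h : LFourBound T w B)
    (huw : ∀ t ∈ Icc 0 T, u t = w t) : LFourBound T u B := by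
  obtain ⟨v, hv, hB, hae⟩ := h
  refine ⟨v, hv, hB, ?_⟩
  filter_upwards [hae, ae_restrict_mem measurableSet_Ioo] with t ht htm
  rw [huw t (Ioo_subset_Icc_self htm)]
  exact ht

end

theorem mainTheorem4 (T : ℝ) (hT : 0 < T) :
    (∃ C : ℝ≥0, ∀ h : ℝ → ℂ, MemH (3 / 4) T h →
      (∀ t ∈ Icc 0 T, Summable (navierTerm h t)) ∧
      ContinuousOn (navierZero h) (Icc 0 T) ∧
      LFourBound T (navierZero h) (C * sobolevNorm (3 / 4) 2 (Ioo 0 T) h) ∧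
      ∀ t ∈ Icc 0 T, ‖navierZero h t‖ₑ ≤ C * sobolevNorm (3 / 4) 2 (Ioo 0 T) h) ∧
    ∀ s ∈ Icc (0 : ℝ) 4, ∃ C : ℝ≥0, ∀ h : ℝ → ℂ, MemHZero ((3 + s) / 4) T h →
      DerivBound s T (navierZero h) (C * sobolevNorm ((3 + s) / 4) 2 (Ioo 0 T) h) := by
  refine ⟨?_, fun s hs => ?_⟩
  -- The first part is the case `s = 0`, which needs no condition at time zero. The function `w`
  -- supplied there is a weak derivative of order zero, hence the solution itself.
  · obtain ⟨C, hC⟩ := exists_navierZero_sobolev_bounds hT (s := 0) (by simp)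
    rw [add_zero] at hC
    refine ⟨C, fun h hh => ?_⟩
    obtain ⟨hsum, w, hweak, h4, h2⟩ := hC h hh (Or.inl rfl)
    rw [Nat.floor_zero] at hweak h4 h2
    rw [Nat.cast_zero, sub_zero] at h4 h2
    have huw : ∀ t ∈ Icc 0 T, navierZero h t = w t := fun t ht =>
      (isWeakDeriv_zero_self _).unique_lTwo (hweak t ht)
    exact ⟨hsum, h2.continuousOn.congr huw, h4.lFourBound.congr huw, fun t ht => by
      rw [huw t ht]
      exact (enorm_le_sobolevNorm_zero _).trans (h2.2.2 t ht)⟩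
  · obtain ⟨C, hC⟩ := exists_navierZero_sobolev_bounds hT hs
    exact ⟨C, fun h hh => (hC h hh.1 (Or.inr hh.2)).2⟩
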